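/- Conventions. Graphs are finite loopless multigraphs with labelled vertices and edges. A plane embedding $H$ of a graph is a cyclic order of the incident edges around every vertex satisfying Euler's formula $n-m+f=2c$ ($c$ the number of connected components, every component counting its own faces). $\mathrm{Emb}(G)$ is the set of plane embeddings of $G$, and $G$ is planar if it is nonempty. A *flip* takes a connected subgraph $A$ that shares at most two vertices $s,t$ with the rest of the graph (a separation flip, or for $s=t$ an articulation flip), whose edges are consecutive around $s$ and around $t$, and either *reflects* it in place (reversing the cyclic orders at the other vertices of $A$ and the order of the edges of $A$ at $s$ and $t$), or *slides* it to a new position in the cyclic orders around $s$ and $t$ (keeping everything else); the result has to be a plane embedding again. The *flip-graph* has all plane embedded graphs as vertices, two of them being adjacent if one arises from the other by deleting one edge or by one flip (in either direction); $\operatorname{dist}$ is the distance in it. Theorem. For $h\ge 1$ let $G_h$ be the graph obtained from two complete binary trees of height $h$ by identifying corresponding leaves, and let $L$ be the set of the joined leaves. Then $G_h$ has exactly $3\cdot 2^h-2=O(2^h)$ vertices, $G_h$ is planar, and $G_h\cup(x,y)$ is planar for any two distinct $x,y\in L$. For every plane embedding $H\in\mathrm{Emb}(G_h)$ there are distinct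 $x,y\in L$ such that admitting the edge $(x,y)$ requires exactly $h-1$ flips: the minimum number of flips transforming $H$ into an embedding of $G_h$ in which $(x,y)$ can be inserted across a face is $h-1$. Moreover, counting also the insertion of the edge, and allowing arbitrary insertions and deletions of edges on the way, $$\min_{H'\in \mathrm{Emb}(G_h\cup(x,y))}\operatorname{dist}(H,H') = h=\log_2\frac{n+2}{3},\qquad n=3\cdot 2^h-2 .$$ -/

import Mathlib

open scoped Graph

section PlaneGraphs

variable {V E : Type*}

/-- A dart of a loopless multigraph is a pair `(v, e)` of an edge `e` and one of its ends `v`.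
Given the cyclic orders `rot v` of the edges around the vertices `v`, the successor of the dart
`(v, e)` on its face is `(w, rot w e)`, where `w` is the other end of `e`. -/
def FaceStep (G : Graph V E) (rot : V → Equiv.Perm E) (d d' : V × E) : Prop :=
  G.IsLink d.2 d.1 d'.1 ∧ d'.2 = rot d'.1 d.2

/-- The faces of a rotation system: the orbits of the face permutation on the darts. -/
def faceSet (G : Graph V E) (rot : V → Equiv.Perm E) : Set (Set (V × E)) :=
  {F | ∃ v e, G.Inc e v ∧ F = {d | Relation.ReflTransGen (FaceStep G rot) (v, e) d}}

/-- The isolated vertices of `G`. Such a vertex has no dart, and is the boundary of one face. -/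
def isolatedSet (G : Graph V E) : Set V :=
  {v | v ∈ V(G) ∧ ∀ e, ¬ G.Inc e v}

/-- The vertex sets of the connected components of `G`. -/
def componentSet (G : Graph V E) : Set (Set V) :=
  {C | ∃ v ∈ V(G), C = {w | Relation.ReflTransGen G.Adj v w}}

/-- A plane embedded graph: a finite loopless multigraph with labelled vertices and edges,
together with a combinatorial embedding (for every vertex, a cyclic order of the edges at this
vertex) that is planar, i.e. satisfies Euler's formula `n - m + f = 2 c`, where every component
counts its own faces. -/
structure PlaneGraph (V E : Type*) where
  /-- the underlying multigraph -/
  graph : Graph V E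
  finite_vertexSet : V(graph).Finite
  finite_edgeSet : E(graph).Finite
  loopless : graph.Loopless
  /-- `rot v e` is the edge that follows `e` in the circular order around `v` -/
  rot : V → Equiv.Perm E
  rot_isCycleOn : ∀ v, (rot v).IsCycleOn {e | graph.Inc e v}
  rot_of_not_inc : ∀ v e, ¬ graph.Inc e v → rot v e = e
  euler : V(graph).ncard + ((faceSet graph rot).ncard + (isolatedSet graph).ncard) =
    E(graph).ncard + 2 * (componentSet graph).ncard

/-- The set of all plane embeddings of the multigraph `G`. -/
def Emb (G : Graph V E) : Set (PlaneGraph V E) :=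
  {H | H.graph = G}

/-- A multigraph is planar if it has a plane embedding. -/
def IsPlanar (G : Graph V E) : Prop :=
  (Emb G).Nonempty

/-- The multigraph `G ∪ (x, y)`, with `e` as the label of the edge `(x, y)`. -/
def addEdge (G : Graph V E) (e : E) (x y : V) : Graph V E where
  vertexSet := insert x (insert y V(G))
  IsLink f u v := (f ≠ e ∧ G.IsLink f u v) ∨ (f = e ∧ ((u = x ∧ v = y) ∨ (u = y ∧ v = x)))
  isLink_symm := by
    intro f _
    constructor
    rintro u v (⟨h1, h2⟩ | ⟨h1, h2⟩)
    · exact Or.inl ⟨h1, h2.symm⟩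
    · exact Or.inr ⟨h1, by tauto⟩
  eq_or_eq_of_isLink_of_isLink := by
    rintro f a b c d (⟨h1, h2⟩ | ⟨h1, h2⟩) (⟨h3, h4⟩ | ⟨h3, h4⟩)
    · exact h2.left_eq_or_eq h4
    · exact absurd h3 h1
    · exact absurd h1 h3
    · rcases h2 with ⟨rfl, rfl⟩ | ⟨rfl, rfl⟩ <;> rcases h4 with ⟨rfl, rfl⟩ | ⟨rfl, rfl⟩ <;> simp
  left_mem_of_isLink := by
    rintro f u v (⟨_, h⟩ | ⟨_, ⟨rfl, _⟩ | ⟨rfl, _⟩⟩)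
    · exact Or.inr (Or.inr h.left_mem)
    · exact Or.inl rfl
    · exact Or.inr (Or.inl rfl)

variable [DecidableEq E]

/-- `K = H - e`: the edge `e` is deleted from the plane embedded graph `H`, and around each end
`v` of `e` the predecessor of `e` is now followed by the successor `H.rot v e` of `e`.
Equivalently, `H` arises from `K` by inserting `e` across a face (or between two components). -/
def IsDeletion (H : PlaneGraph V E) (e : E) (K : PlaneGraph V E) : Prop :=
  e ∈ E(H.graph) ∧ K.graph = H.graph.deleteEdges {e} ∧
    ∀ v, K.rot v = Equiv.swap e (H.rot v e) * H.rot v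

/-- The edge set `A` is a nonempty connected subgraph of `G` that is separated from the rest of `G`
by the vertices `s` and `t`: every vertex incident both with an edge of `A` and with an
edge outside `A` is `s` or `t`. (The case `s = t` is that of an articulation point.) -/
structure IsSeparated (G : Graph V E) (A : Set E) (s t : V) : Prop where
  left_mem : s ∈ V(G)
  right_mem : t ∈ V(G)
  nonempty : A.Nonempty
  subset : A ⊆ E(G)
  connected : ∀ e ∈ A, ∀ f ∈ A,
    Relation.ReflTransGen (fun e' f' => f' ∈ A ∧ ∃ v, G.Inc e' v ∧ G.Inc f' v) e f
  separated : ∀ v e f, e ∈ A → f ∉ A → G.Inc e v → G.Inc f v → v = s ∨ v = t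

/-- The lists `a` and `b` consist of the edges at `v` in `A` and of those not in `A`,
and the cyclic order of `H` around `v` is `a` followed by `b`. In particular, the edges of `A` are
consecutive around `v`. -/
def IsCutAt (H : PlaneGraph V E) (A : Set E) (v : V) (a b : List E) : Prop :=
  (a ++ b).Nodup ∧ (∀ e, e ∈ a ↔ e ∈ A ∧ H.graph.Inc e v) ∧
    (∀ e, e ∈ b ↔ e ∉ A ∧ H.graph.Inc e v) ∧ H.rot v = (a ++ b).formPerm

/-- `H'` arises from `H` by reflecting in place a subgraph `A` that is separated by `s, t`. -/
def IsReflect (H H' : PlaneGraph V E) : Prop :=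
  H'.graph = H.graph ∧ ∃ A s t, IsSeparated H.graph A s t ∧
    (∀ v, v = s ∨ v = t →
      ∃ a b, IsCutAt H A v a b ∧ H'.rot v = (a.reverse ++ b).formPerm) ∧
    (∀ v, v ≠ s → v ≠ t → (∃ e ∈ A, H.graph.Inc e v) → H'.rot v = (H.rot v)⁻¹) ∧
    (∀ v, v ≠ s → v ≠ t → (¬ ∃ e ∈ A, H.graph.Inc e v) → H'.rot v = H.rot v)

/-- `H'` arises from `H` by sliding a subgraph `A` that is separated by `s, t` to a new position in
the cyclic edge orders around `s` and `t`; the rest of these orders, and the orders around all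
other vertices, are kept. -/
def IsSlide (H H' : PlaneGraph V E) : Prop :=
  H'.graph = H.graph ∧ ∃ A s t, IsSeparated H.graph A s t ∧
    (∀ v, v = s ∨ v = t →
      ∃ a b b', IsCutAt H A v a b ∧ b'.IsRotated b ∧ H'.rot v = (a ++ b').formPerm) ∧
    (∀ v, v ≠ s → v ≠ t → H'.rot v = H.rot v)

/-- A single flip: a separation flip or (for `s = t`) an articulation flip, which either reflects
or slides the separated subgraph. -/
def IsFlip (H H' : PlaneGraph V E) : Prop :=
  IsReflect H H' ∨ IsSlide H H'

variable (V E) in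
/-- The flip-graph: its vertices are all plane embedded graphs, and two of them are adjacent if one
arises from the other by deleting an edge, or by a single flip. -/
def flipGraph : SimpleGraph (PlaneGraph V E) :=
  SimpleGraph.fromRel fun H H' => (∃ e, IsDeletion H e H') ∨ IsFlip H H'

variable (V E) in
/-- The subgraph of the flip-graph in which only flips are allowed. Distances in it are the least
numbers of flips. -/
def pureFlipGraph : SimpleGraph (PlaneGraph V E) :=
  SimpleGraph.fromRel fun H H' => IsFlip H H'

end PlaneGraphs

/-- Vertex labels: `Sum.inl w` is the leaf `w`, common to the two trees, and `Sum.inr (i, w)` is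
the inner node `w` of the tree number `i`. A node of a complete binary tree is given by the
path from the node up to the root, so that `b :: w` are the two children of `w`. -/
abbrev TreeVertex : Type := List Bool ⊕ Bool × List Bool

/-- Edge labels: in `doubleTree`, `(i, b :: w)` is the edge of the tree number `i` from the node
`b :: w` to its parent `w`; all other labels are not used there. -/
abbrev TreeEdge : Type := Bool × List Bool

/-- The node `w` (of depth `w.length ≤ h`) of the tree number `i`, of height `h`. -/
def treeNode (h : ℕ) (i : Bool) (w : List Bool) : TreeVertex :=
  if w.length < h then Sum.inr (i, w) else Sum.inl w

/-- The joined leaves. -/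
def leafSet (h : ℕ) : Set TreeVertex :=
  {v | ∃ w : List Bool, w.length = h ∧ v = Sum.inl w}

theorem treeNode_injective (h : ℕ) (i : Bool) : Function.Injective (treeNode h i) := by
  intro w w' hw
  unfold treeNode at hw
  split_ifs at hw <;> simp_all

/-- Two complete binary trees of height `h` whose corresponding leaves are identified. -/
def doubleTree (h : ℕ) : Graph TreeVertex TreeEdge where
  vertexSet := {v | ∃ i w, w.length ≤ h ∧ v = treeNode h i w}
  IsLink f u v := ∃ i b w, w.length < h ∧ f = (i, b :: w) ∧
    ((u = treeNode h i (b :: w) ∧ v = treeNode h i w) ∨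
      (u = treeNode h i w ∧ v = treeNode h i (b :: w)))
  isLink_symm := by
    intro f _
    constructor
    rintro u v ⟨i, b, w, h1, h2, h3⟩
    exact ⟨i, b, w, h1, h2, by tauto⟩
  eq_or_eq_of_isLink_of_isLink := by
    rintro f x y v w ⟨i, b, l, _, rfl, h3⟩ ⟨i', b', l', _, h2', h3'⟩
    simp only [Prod.mk.injEq, List.cons.injEq] at h2'
    obtain ⟨rfl, rfl, rfl⟩ := h2'
    rcases h3 with ⟨rfl, rfl⟩ | ⟨rfl, rfl⟩ <;> rcases h3' with ⟨rfl, rfl⟩ | ⟨rfl, rfl⟩ <;> simp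
  left_mem_of_isLink := by
    rintro f x y ⟨i, b, l, hl, rfl, ⟨rfl, _⟩ | ⟨rfl, _⟩⟩
    · exact ⟨i, b :: l, hl, rfl⟩
    · exact ⟨i, l, hl.le, rfl⟩

/-!
The embeddings of the double tree are described by one bit per inner node. Going around a face, the
next joined leaf is always reached from the previous one by climbing in one of the two trees and
descending again; so a face meets at least two leaves, and Euler's formula leaves room only for
faces that meet exactly two, one ascent and descent in each tree. Hence the two trees are embedded
as mirror images of each other, and an embedding amounts to a function `β` that tells for every
inner node other than the root which of its two children comes last (`exists_eq_treeEmb`). Two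
leaves are on a common face if and only if one of them is followed by the other in the leaf order
that belongs to `β` (`NextLeaf`, `isDeletion_edgeEmb`, `nextLeaf_of_mem_Emb_addEdge`).

Given `β`, let `x` and `y` be the leaves that are reached from the two children of the root by
turning alternately to the side of the last child and to that of the first child (`zigzag`), in such
a way that along the path from `x` to `y`, without the root, every second one of the `2 * (h - 1)`
inner nodes has the wrong bit. For the upper bound, at each of these `h - 1` nodes slide the part of
the graph below one child, which is attached at the two copies of the node only; this changes one
bit (`edist_flipRule_le`, `nextLeaf_flipRule`). Then the edge can be inserted.

For the lower bound, cut the path into `h - 1` pairs of consecutive nodes, and assign all vertices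
of the graph to the pairs at which they are attached to the path (`group`). A group contains both
copies of its two path nodes. At the end, up to a reflection of everything, the orders have changed
at the copies of exactly one of the two nodes of each pair; the `defect` of the four copies measures
how far their changes are from being all the same. It is `0` at the start and has to be `2` at the
end. The path nodes of a group stay connected within the group when one of its vertices is removed
(`exists_const_of_group`). So a flip with at most one separating vertex in a group acts in the same
way on all other path nodes of this group; as no defect exceeds `2`, a flip increases the sum of the
defects by at most `2`, one for each separating vertex (`groupDefect_flip_le`). Insertions and
deletions of edges do not change the defect of a group unless they affect its own edges of the
double tree (`groupDefect_deletion`). An edge of the double tree that is deleted on the way has to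
be inserted again; these two steps spoil at most two groups, that is, a defect of at most `4`. With
one step for the new edge, every walk has at least `h` steps (`le_length_of_walk`).
-/

/-! ### Counting the orbits of a bijective relation by first returns -/

section Orbits

variable {α : Type*} {R : α → α → Prop} {X D : Set α}

/-- A relation that is deterministic in both directions runs in cycles on a finite set. -/
theorem exists_reflTransGen_back (hX : X.Finite) (hstep : ∀ a ∈ X, ∃ b ∈ X, R a b)
    (hr : Relator.RightUnique R) (hl : Relator.LeftUnique R) {a b : α} (ha : a ∈ X)
    (hab : R a b) : Relation.ReflTransGen R b a := by
  choose! f hfX hf using hstep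
  let g : X → X := fun x => ⟨f x, hfX x x.2⟩
  have hg : Function.Injective g := by
    rintro ⟨x, hx⟩ ⟨y, hy⟩ hxy
    have h1 : f x = f y := congrArg Subtype.val hxy
    have h2 := hf y hy
    rw [← h1] at h2
    exact Subtype.ext (hl (hf x hx) h2)
  have := hX.to_subtype
  have key : ∀ (n : ℕ) (x : X), Relation.ReflTransGen R x.1 (g^[n] x).1 := by
    intro n
    induction n with
    | zero => exact fun x => .refl
    | succ n ih => exact fun x => .head (hf x.1 x.2) (ih (g x))
  obtain ⟨n, hn, hp⟩ := hg.mem_periodicPts ⟨a, ha⟩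
  obtain ⟨m, rfl⟩ := Nat.exists_eq_add_of_lt hn
  have h1 := key m (g ⟨a, ha⟩)
  have h2 : g^[m] (g ⟨a, ha⟩) = ⟨a, ha⟩ := by
    rw [← Function.iterate_succ_apply]
    simpa [Function.IsPeriodicPt, Function.IsFixedPt] using hp
  rw [h2] at h1
  have h3 : (g ⟨a, ha⟩).1 = b := hr (hf a ha) hab
  rwa [h3] at h1

theorem reflTransGen_symm (hX : X.Finite) (hstep : ∀ a ∈ X, ∃ b ∈ X, R a b)
    (hr : Relator.RightUnique R) (hl : Relator.LeftUnique R) {a b : α} (ha : a ∈ X)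
    (hab : Relation.ReflTransGen R a b) : b ∈ X ∧ Relation.ReflTransGen R b a := by
  induction hab with
  | refl => exact ⟨ha, .refl⟩
  | tail _ hbc ih =>
    obtain ⟨c, hc, hbc'⟩ := hstep _ ih.1
    obtain rfl := hr hbc hbc'
    exact ⟨hc, (exists_reflTransGen_back hX hstep hr hl ih.1 hbc).trans ih.2⟩

/-- Following `R` from `a`, the first point of `D` met after at least one step is `b`. -/
def FirstReturn (R : α → α → Prop) (D : Set α) (a b : α) : Prop :=
  b ∈ D ∧ ∃ c, Relation.ReflTransGen (fun u v => R u v ∧ v ∉ D) a c ∧ R c b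

theorem FirstReturn.reflTransGen {a b : α} (h : FirstReturn R D a b) :
    Relation.ReflTransGen R a b := by
  obtain ⟨_, c, h1, h2⟩ := h
  exact (Relation.ReflTransGen.mono (fun _ _ h => h.1) _ _ h1).tail h2

theorem FirstReturn.rightUnique (hr : Relator.RightUnique R) :
    Relator.RightUnique (FirstReturn R D) := by
  rintro a b b' ⟨hb, c, hc, hcb⟩ ⟨hb', c', hc', hcb'⟩
  have hr' : Relator.RightUnique (fun u v => R u v ∧ v ∉ D) := fun _ _ _ h h' => hr h.1 h'.1
  -- The two trajectories agree until one of them enters `D`.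
  rcases Relation.ReflTransGen.total_of_right_unique hr' hc hc' with h | h
  · rcases Relation.ReflTransGen.cases_head h with rfl | ⟨d, hd, _⟩
    · exact hr hcb hcb'
    · exact absurd (hr hcb hd.1 ▸ hb) hd.2
  · rcases Relation.ReflTransGen.cases_head h with rfl | ⟨d, hd, _⟩
    · exact hr hcb hcb'
    · exact absurd (hr hcb' hd.1 ▸ hb') hd.2

/-- If the first return is symmetric, an orbit through `d ∈ D` meets `D` only in `d` and in the
first return of `d`. -/
theorem mem_pair_of_firstReturn_symm (hr : Relator.RightUnique R) {d d' z : α} (hd : d ∈ D)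
    (h : FirstReturn R D d d') (h' : FirstReturn R D d' d)
    (hz : Relation.ReflTransGen R d z) (hzD : z ∈ D) : z = d ∨ z = d' := by
  have key : (∃ e, (e = d ∨ e = d') ∧
      Relation.ReflTransGen (fun u v => R u v ∧ v ∉ D) e z) := by
    clear hzD
    induction hz with
    | refl => exact ⟨d, Or.inl rfl, .refl⟩
    | @tail y z _ hyz ih =>
      obtain ⟨e, he, hey⟩ := ih
      by_cases hzD : z ∈ D
      · have hez : FirstReturn R D e z := ⟨hzD, y, hey, hyz⟩
        refine ⟨z, ?_, .refl⟩
        rcases he with rfl | rfl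
        · exact Or.inr (FirstReturn.rightUnique hr hez h)
        · exact Or.inl (FirstReturn.rightUnique hr hez h')
      · exact ⟨e, he, hey.tail ⟨hyz, hzD⟩⟩
  obtain ⟨e, he, hez⟩ := key
  rcases Relation.ReflTransGen.cases_tail hez with rfl | ⟨_, _, h2⟩
  · exact he
  · exact absurd hzD h2.2

variable (hX : X.Finite) (hstep : ∀ a ∈ X, ∃ b ∈ X, R a b)
  (hr : Relator.RightUnique R) (hl : Relator.LeftUnique R) (hDX : D ⊆ X)
  (hcover : ∀ x ∈ X, ∃ d ∈ D, Relation.ReflTransGen R x d ∨ Relation.ReflTransGen R d x)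
  (hret : ∀ d ∈ D, ∃ d', d' ≠ d ∧ FirstReturn R D d d')

include hX hstep hr hl in
theorem orbit_eq_iff {a b : α} (ha : a ∈ X) :
    {y | Relation.ReflTransGen R a y} = {y | Relation.ReflTransGen R b y} ↔
      Relation.ReflTransGen R a b := by
  constructor
  · intro h
    have : b ∈ {y | Relation.ReflTransGen R a y} := by rw [h]; exact .refl
    exact this
  · intro h
    have h' := (reflTransGen_symm hX hstep hr hl ha h).2
    ext y
    exact ⟨fun hy => h'.trans hy, fun hy => h.trans hy⟩

include hX hstep hr hl hDX hcover in
open Classical in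
theorem orbits_eq_image (hDf : D.Finite) :
    {F : Set α | ∃ x ∈ X, F = {y | Relation.ReflTransGen R x y}} =
      (hDf.toFinset.image fun d => {y | Relation.ReflTransGen R d y} : Finset (Set α)) := by
  ext F
  simp only [Set.mem_ofPred_eq, Finset.coe_image, Set.Finite.coe_toFinset, Set.mem_image]
  constructor
  · rintro ⟨x, hx, rfl⟩
    obtain ⟨d, hd, h | h⟩ := hcover x hx
    · exact ⟨d, hd, ((orbit_eq_iff hX hstep hr hl hx).2 h).symm⟩
    · exact ⟨d, hd, (orbit_eq_iff hX hstep hr hl (hDX hd)).2 h⟩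
  · rintro ⟨d, hd, rfl⟩
    exact ⟨d, hDX hd, rfl⟩

open Classical in
include hX hstep hr hl hDX hret in
theorem two_le_card_fiber (hDf : D.Finite) :
    ∀ F ∈ (hDf.toFinset.image fun d => {y | Relation.ReflTransGen R d y} : Finset (Set α)),
      2 ≤ (hDf.toFinset.filter fun d => {y | Relation.ReflTransGen R d y} = F).card := by
  intro F hF
  obtain ⟨d, hd, rfl⟩ := Finset.mem_image.1 hF
  have hd' : d ∈ D := by simpa using hd
  obtain ⟨d', hne, h⟩ := hret d hd'
  rw [← Finset.card_pair hne.symm]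
  refine Finset.card_le_card ?_
  intro z hz
  simp only [Finset.mem_insert, Finset.mem_singleton] at hz
  rcases hz with rfl | rfl
  · simp [hd']
  · simp only [Finset.mem_filter, Set.Finite.mem_toFinset]
    exact ⟨h.1, ((orbit_eq_iff hX hstep hr hl (hDX hd')).2 h.reflTransGen).symm⟩

include hX hstep hr hl hDX hcover hret in
/-- If the orbits are as numerous as half the points of the transversal `D`, every one of them
contains exactly two of these points, so that the first return map is an involution. -/
theorem firstReturn_symm_of_card (hcard : D.ncard =
      2 * {F : Set α | ∃ x ∈ X, F = {y | Relation.ReflTransGen R x y}}.ncard)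
    {d d' : α} (hd : d ∈ D) (h : FirstReturn R D d d') : FirstReturn R D d' d := by
  classical
  have hDf : D.Finite := hX.subset hDX
  rw [orbits_eq_image hX hstep hr hl hDX hcover hDf, Set.ncard_coe_finset,
    Set.ncard_eq_toFinset_card D hDf,
    Finset.card_eq_sum_card_image (fun d => {y | Relation.ReflTransGen R d y})] at hcard
  have hge := two_le_card_fiber hX hstep hr hl hDX hret hDf
  have heq := (Finset.sum_eq_sum_iff_of_le (f := fun _ => 2) hge).1 (by
    rw [hcard, Finset.sum_const, smul_eq_mul, mul_comm])
  obtain ⟨d₁, hne₁, h₁⟩ := hret d hd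
  obtain rfl := FirstReturn.rightUnique hr h h₁
  obtain ⟨d₂, hne₂, h₂⟩ := hret d' h.1
  by_cases hd₂ : d₂ = d
  · rwa [← hd₂]
  exfalso
  have h3 := heq {y | Relation.ReflTransGen R d y}
    (Finset.mem_image_of_mem (fun d => {y | Relation.ReflTransGen R d y})
      (hDf.mem_toFinset.2 hd))
  have h4 : ({d, d', d₂} : Finset α) ⊆ hDf.toFinset.filter
      (fun e => {y | Relation.ReflTransGen R e y} = {y | Relation.ReflTransGen R d y}) := by
    intro z hz
    simp only [Finset.mem_insert, Finset.mem_singleton] at hz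
    simp only [Finset.mem_filter, Set.Finite.mem_toFinset]
    rcases hz with rfl | rfl | rfl
    · exact ⟨hd, rfl⟩
    · exact ⟨h.1, ((orbit_eq_iff hX hstep hr hl (hDX hd)).2 h.reflTransGen).symm⟩
    · exact ⟨h₂.1, ((orbit_eq_iff hX hstep hr hl (hDX hd)).2
        (h.reflTransGen.trans h₂.reflTransGen)).symm⟩
  have h5 := Finset.card_le_card h4
  rw [Finset.card_eq_three.2 ⟨d, d', d₂, hne₁.symm, Ne.symm hd₂, hne₂.symm, rfl⟩] at h5
  omega

include hX hstep hr hl hDX hcover hret in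
theorem card_of_firstReturn_symm
    (hsymm : ∀ d ∈ D, ∀ d', FirstReturn R D d d' → FirstReturn R D d' d) :
    D.ncard = 2 * {F : Set α | ∃ x ∈ X, F = {y | Relation.ReflTransGen R x y}}.ncard := by
  classical
  have hDf : D.Finite := hX.subset hDX
  rw [orbits_eq_image hX hstep hr hl hDX hcover hDf, Set.ncard_coe_finset,
    Set.ncard_eq_toFinset_card D hDf,
    Finset.card_eq_sum_card_image (fun d => {y | Relation.ReflTransGen R d y}),
    mul_comm, ← smul_eq_mul, ← Finset.sum_const]
  refine Finset.sum_congr rfl fun F hF => ?_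
  refine le_antisymm ?_ (two_le_card_fiber hX hstep hr hl hDX hret hDf F hF)
  obtain ⟨d, hd, rfl⟩ := Finset.mem_image.1 hF
  have hd' : d ∈ D := by simpa using hd
  obtain ⟨d', hne, h⟩ := hret d hd'
  rw [← Finset.card_pair hne.symm]
  refine Finset.card_le_card fun z hz => ?_
  simp only [Finset.mem_filter, Set.Finite.mem_toFinset] at hz
  have := mem_pair_of_firstReturn_symm hr hd' h (hsymm d hd' d' h)
    ((orbit_eq_iff hX hstep hr hl (hDX hd')).1 hz.2.symm) hz.1
  simpa using this

end Orbits

/-! ### Cyclic orders given by permutations -/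

section CyclicOrder

variable {E : Type*} {π : Equiv.Perm E} {a b c : E}

theorem isCycleOn_pair_apply (h : π.IsCycleOn {a, b}) (hab : a ≠ b) : π a = b ∧ π b = a := by
  have hm := h.1.mapsTo
  have hnt : ({a, b} : Set E).Nontrivial := ⟨a, by simp, b, by simp, hab⟩
  have ha := hm (show a ∈ ({a, b} : Set E) by simp)
  have hb := hm (show b ∈ ({a, b} : Set E) by simp)
  have ha' := h.apply_ne hnt (show a ∈ ({a, b} : Set E) by simp)
  have hb' := h.apply_ne hnt (show b ∈ ({a, b} : Set E) by simp)
  simp only [Set.mem_insert_iff, Set.mem_singleton_iff] at ha hb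
  tauto

theorem isCycleOn_triple_apply (h : π.IsCycleOn {a, b, c}) (hab : a ≠ b) (hac : a ≠ c)
    (hbc : b ≠ c) :
    (π a = b ∧ π b = c ∧ π c = a) ∨ (π a = c ∧ π c = b ∧ π b = a) := by
  have hm := h.1.mapsTo
  have hnt : ({a, b, c} : Set E).Nontrivial := ⟨a, by simp, b, by simp, hab⟩
  have ha := hm (show a ∈ ({a, b, c} : Set E) by simp)
  have hb := hm (show b ∈ ({a, b, c} : Set E) by simp)
  have hc := hm (show c ∈ ({a, b, c} : Set E) by simp)
  have ha' := h.apply_ne hnt (show a ∈ ({a, b, c} : Set E) by simp)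
  have hb' := h.apply_ne hnt (show b ∈ ({a, b, c} : Set E) by simp)
  have hc' := h.apply_ne hnt (show c ∈ ({a, b, c} : Set E) by simp)
  have i1 : π a ≠ π b := fun h => hab (π.injective h)
  have i2 : π a ≠ π c := fun h => hac (π.injective h)
  have i3 : π b ≠ π c := fun h => hbc (π.injective h)
  simp only [Set.mem_insert_iff, Set.mem_singleton_iff] at ha hb hc
  grind

/-- Iterating `π` from `a` leads to `b` before it leads to `c`. If `π` is cyclic on a set containing
the three elements, this says that they occur in the cyclic order `a, b, c`. -/
def CycOrd (π : Equiv.Perm E) (a b c : E) : Prop :=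
  Relation.ReflTransGen (fun x y => y = π x ∧ y ≠ c) a b

theorem cycOrd_iff_pow :
    CycOrd π a b c ↔ ∃ n : ℕ, (π ^ n) a = b ∧ ∀ k, 0 < k → k ≤ n → (π ^ k) a ≠ c := by
  constructor
  · intro h
    unfold CycOrd at h
    induction h with
    | refl => exact ⟨0, by simp, fun k hk hk' => absurd hk' (by omega)⟩
    | @tail y z _ h2 ih =>
      obtain ⟨n, hn, hk⟩ := ih
      have hn' : (π ^ (n + 1)) a = z := by rw [pow_succ', Equiv.Perm.mul_apply, hn]; exact h2.1.symm
      refine ⟨n + 1, hn', fun k h0 hk' => ?_⟩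
      rcases Nat.lt_or_ge k (n + 1) with h3 | h3
      · exact hk k h0 (by omega)
      · obtain rfl : k = n + 1 := by omega
        rw [hn']
        exact h2.2
  · rintro ⟨n, hn, hk⟩
    unfold CycOrd
    induction n generalizing b with
    | zero => simp only [pow_zero, Equiv.Perm.one_apply] at hn; subst hn; exact .refl
    | succ n ih =>
      refine (ih rfl fun k h0 hk' => hk k h0 (by omega)).tail ⟨?_, ?_⟩
      · rw [← hn, pow_succ', Equiv.Perm.mul_apply]
      · rw [← hn]; exact hk _ (by omega) le_rfl

/-- The three elements are in the order in which they occur in the orbit of `a`. -/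
theorem cycOrd_iff_lt {S : Finset E} (hπ : π.IsCycleOn S) (ha : a ∈ S) (hac : a ≠ c) {i j : ℕ}
    (hi : i < S.card) (hj : j < S.card) (hib : (π ^ i) a = b) (hjc : (π ^ j) a = c) :
    CycOrd π a b c ↔ i < j := by
  have hj0 : 0 < j := by
    rcases Nat.eq_zero_or_pos j with rfl | h
    · exact absurd hjc (by simpa using hac)
    · exact h
  rw [cycOrd_iff_pow]
  constructor
  · rintro ⟨n, hn, hk⟩
    by_contra hij
    have h1 : n ≡ i [MOD S.card] := (hπ.pow_apply_eq_pow_apply ha).1 (by rw [hn, hib])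
    have h2 : i ≤ n := by
      unfold Nat.ModEq at h1
      rw [Nat.mod_eq_of_lt hi] at h1
      rw [← h1]
      exact Nat.mod_le _ _
    exact hk j hj0 (by omega) hjc
  · intro hij
    refine ⟨i, hib, fun k h0 hk hkc => ?_⟩
    have h1 : k ≡ j [MOD S.card] := (hπ.pow_apply_eq_pow_apply ha).1 (by rw [hkc, hjc])
    unfold Nat.ModEq at h1
    rw [Nat.mod_eq_of_lt hj, Nat.mod_eq_of_lt (by omega)] at h1
    omega

/-- The inverse of a cyclic permutation has the opposite cyclic orders. -/
theorem cycOrd_inv {S : Set E} (hS : S.Finite) (hπ : π.IsCycleOn S) (ha : a ∈ S) (hb : b ∈ S)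
    (hc : c ∈ S) (hab : a ≠ b) (hac : a ≠ c) (hbc : b ≠ c) :
    CycOrd π⁻¹ a b c ↔ ¬ CycOrd π a b c := by
  lift S to Finset E using hS
  simp only [Finset.mem_coe] at ha hb hc
  obtain ⟨i, hi, hib⟩ := hπ.exists_pow_eq ha hb
  obtain ⟨j, hj, hjc⟩ := hπ.exists_pow_eq ha hc
  have hN : (π ^ S.card) a = a := hπ.pow_card_apply ha
  have back : ∀ {k : ℕ} {x : E}, k < S.card → (π ^ k) a = x → (π⁻¹ ^ (S.card - k)) a = x := by
    intro k x hk hx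
    rw [inv_pow, Equiv.Perm.inv_eq_iff_eq, ← hx, ← Equiv.Perm.mul_apply, ← pow_add,
      Nat.sub_add_cancel hk.le, hN]
  have hi0 : 0 < i := by
    rcases Nat.eq_zero_or_pos i with rfl | h
    · exact absurd hib (by simpa using hab)
    · exact h
  have hj0 : 0 < j := by
    rcases Nat.eq_zero_or_pos j with rfl | h
    · exact absurd hjc (by simpa using hac)
    · exact h
  have hij : i ≠ j := by
    rintro rfl
    exact hbc (hib.symm.trans hjc)
  rw [cycOrd_iff_lt hπ ha hac hi hj hib hjc,
    cycOrd_iff_lt hπ.inv ha hac (by omega) (by omega) (back hi hib) (back hj hjc)]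
  omega

theorem cycOrd_of_apply (h : π a = b) (hbc : b ≠ c) : CycOrd π a b c :=
  .single ⟨h.symm, hbc⟩

theorem not_cycOrd_of_apply (h : π a = c) (hab : a ≠ b) : ¬ CycOrd π a b c := by
  intro h'
  rcases Relation.ReflTransGen.cases_head h' with rfl | ⟨d, ⟨rfl, hd⟩, _⟩
  · exact hab rfl
  · exact hd h

/-- Bypassing `e` in a permutation does not alter the cyclic order of other elements. -/
theorem cycOrd_swap_mul [DecidableEq E] {e : E} (hae : a ≠ e) (hbe : b ≠ e) (hce : c ≠ e) :
    CycOrd (Equiv.swap e (π e) * π) a b c ↔ CycOrd π a b c := by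
  set π' := Equiv.swap e (π e) * π with hπ'
  have h1 : ∀ x, π x = e → π' x = π e := by
    intro x hx
    rw [hπ', Equiv.Perm.mul_apply, hx, Equiv.swap_apply_left]
  have h2 : ∀ x, x ≠ e → π x ≠ e → π' x = π x := by
    intro x hx hx'
    rw [hπ', Equiv.Perm.mul_apply, Equiv.swap_apply_of_ne_of_ne hx' (π.injective.ne hx)]
  constructor
  · intro h
    have key : ∀ y, Relation.ReflTransGen (fun x y => y = π' x ∧ y ≠ c) a y →
        y ≠ e ∧ CycOrd π a y c := by
      intro y hy
      induction hy with
      | refl => exact ⟨hae, .refl⟩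
      | @tail y z _ hz ih =>
        obtain ⟨rfl, hz⟩ := hz
        by_cases hye : π y = e
        · rw [h1 y hye] at hz ⊢
          refine ⟨fun h => ih.1 (π.injective (hye.trans h.symm)), ?_⟩
          exact Relation.ReflTransGen.tail (ih.2.tail ⟨rfl, by rw [hye]; exact hce.symm⟩)
            ⟨by rw [hye], hz⟩
        · rw [h2 y ih.1 hye] at hz ⊢
          exact ⟨hye, ih.2.tail ⟨rfl, hz⟩⟩
    exact (key b h).2
  · intro h
    have key : ∀ y, Relation.ReflTransGen (fun x y => y = π x ∧ y ≠ c) a y →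
        ∃ z, z ≠ e ∧ CycOrd π' a z c ∧ (y = z ∨ y = e ∧ π z = e) := by
      intro y hy
      induction hy with
      | refl => exact ⟨a, hae, .refl, Or.inl rfl⟩
      | @tail y w _ hw ih =>
        obtain ⟨rfl, hw⟩ := hw
        obtain ⟨z, hz, haz, rfl | ⟨rfl, hze⟩⟩ := ih
        · by_cases hye : π y = e
          · exact ⟨y, hz, haz, Or.inr ⟨hye, hye⟩⟩
          · exact ⟨π y, hye, haz.tail ⟨(h2 y hz hye).symm, hw⟩, Or.inl rfl⟩
        · refine ⟨π y, fun h => hz (π.injective (hze.trans h.symm)),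
            haz.tail ⟨(h1 z hze).symm, hw⟩, Or.inl rfl⟩
    obtain ⟨z, _, haz, rfl | ⟨rfl, _⟩⟩ := key b h
    · exact haz
    · exact absurd rfl hbe

end CyclicOrder

/-! ### The double tree: incidences, cardinalities, connectedness -/

section DoubleTree

theorem treeNode_of_lt {h : ℕ} {i : Bool} {w : List Bool} (hw : w.length < h) :
    treeNode h i w = Sum.inr (i, w) := if_pos hw

theorem treeNode_leaf {h : ℕ} {i : Bool} {w : List Bool} (hw : w.length = h) :
    treeNode h i w = Sum.inl w := if_neg (by omega)

theorem treeNode_eq_inr {h : ℕ} {i j : Bool} {w u : List Bool} :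
    treeNode h i w = Sum.inr (j, u) ↔ w.length < h ∧ i = j ∧ w = u := by
  unfold treeNode
  split_ifs with hw <;> simp [hw]

theorem treeNode_eq_inl {h : ℕ} {i : Bool} {w u : List Bool} :
    treeNode h i w = Sum.inl u ↔ h ≤ w.length ∧ w = u := by
  unfold treeNode
  split_ifs with hw
  · simp only [false_iff]; omega
  · simp only [Sum.inl.injEq]; exact ⟨fun h => ⟨by omega, h⟩, fun h => h.2⟩

theorem isLink_doubleTree {h : ℕ} (i b : Bool) {w : List Bool} (hw : w.length < h) :
    (doubleTree h).IsLink (i, b :: w) (treeNode h i (b :: w)) (treeNode h i w) :=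
  ⟨i, b, w, hw, rfl, Or.inl ⟨rfl, rfl⟩⟩

theorem mem_edgeSet_doubleTree {h : ℕ} {f : TreeEdge} :
    f ∈ E(doubleTree h) ↔ ∃ i b w, w.length < h ∧ f = (i, b :: w) := by
  constructor
  · intro hf
    obtain ⟨u, v, i, b, w, hw, rfl, _⟩ := Graph.exists_isLink_of_mem_edgeSet hf
    exact ⟨i, b, w, hw, rfl⟩
  · rintro ⟨i, b, w, hw, rfl⟩
    exact (isLink_doubleTree i b hw).edge_mem

theorem inc_doubleTree_iff {h : ℕ} {f : TreeEdge} {v : TreeVertex} :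
    (doubleTree h).Inc f v ↔ ∃ i b w, w.length < h ∧ f = (i, b :: w) ∧
      (v = treeNode h i (b :: w) ∨ v = treeNode h i w) := by
  constructor
  · rintro ⟨u, i, b, w, hw, rfl, ⟨rfl, rfl⟩ | ⟨rfl, rfl⟩⟩
    · exact ⟨i, b, w, hw, rfl, Or.inl rfl⟩
    · exact ⟨i, b, w, hw, rfl, Or.inr rfl⟩
  · rintro ⟨i, b, w, hw, rfl, rfl | rfl⟩
    · exact (isLink_doubleTree i b hw).inc_left
    · exact (isLink_doubleTree i b hw).inc_right

theorem inc_doubleTree_inr {h : ℕ} {f : TreeEdge} {i : Bool} {w : List Bool} :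
    (doubleTree h).Inc f (Sum.inr (i, w)) ↔
      w.length < h ∧ ((w ≠ [] ∧ f = (i, w)) ∨ ∃ b, f = (i, b :: w)) := by
  rw [inc_doubleTree_iff]
  constructor
  · rintro ⟨j, b, u, hu, rfl, hv | hv⟩
    · obtain ⟨h1, rfl, rfl⟩ := treeNode_eq_inr.1 hv.symm
      exact ⟨h1, Or.inl ⟨by simp, rfl⟩⟩
    · obtain ⟨h1, rfl, rfl⟩ := treeNode_eq_inr.1 hv.symm
      exact ⟨h1, Or.inr ⟨b, rfl⟩⟩
  · rintro ⟨hw, ⟨hne, rfl⟩ | ⟨b, rfl⟩⟩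
    · obtain ⟨b, u, rfl⟩ := List.exists_cons_of_ne_nil hne
      exact ⟨i, b, u, by simp at hw; omega, rfl, Or.inl (treeNode_of_lt hw).symm⟩
    · exact ⟨i, b, w, hw, rfl, Or.inr (treeNode_of_lt hw).symm⟩

theorem inc_doubleTree_inl {h : ℕ} (hh : 1 ≤ h) {f : TreeEdge} {w : List Bool} :
    (doubleTree h).Inc f (Sum.inl w) ↔ w.length = h ∧ ∃ i, f = (i, w) := by
  rw [inc_doubleTree_iff]
  constructor
  · rintro ⟨j, b, u, hu, rfl, hv | hv⟩
    · obtain ⟨h1, rfl⟩ := treeNode_eq_inl.1 hv.symm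
      exact ⟨by simp at h1 ⊢; omega, j, rfl⟩
    · have := (treeNode_eq_inl.1 hv.symm).1
      omega
  · rintro ⟨hw, i, rfl⟩
    obtain ⟨b, u, rfl⟩ := List.exists_cons_of_ne_nil (l := w) (by rintro rfl; simp at hw; omega)
    exact ⟨i, b, u, by simp at hw; omega, rfl, Or.inl (treeNode_leaf hw).symm⟩

theorem mem_vertexSet_inl {h : ℕ} {w : List Bool} :
    Sum.inl w ∈ V(doubleTree h) ↔ w.length = h := by
  constructor
  · rintro ⟨i, u, hu, hv⟩
    obtain ⟨h1, rfl⟩ := treeNode_eq_inl.1 hv.symm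
    omega
  · intro hw
    exact ⟨false, w, hw.le, (treeNode_leaf hw).symm⟩

theorem mem_vertexSet_inr {h : ℕ} {i : Bool} {w : List Bool} :
    Sum.inr (i, w) ∈ V(doubleTree h) ↔ w.length < h := by
  constructor
  · rintro ⟨j, u, hu, hv⟩
    obtain ⟨h1, rfl, rfl⟩ := treeNode_eq_inr.1 hv.symm
    exact h1
  · intro hw
    exact ⟨i, w, hw.le, (treeNode_of_lt hw).symm⟩

theorem finite_length_eq_bool (n : ℕ) : {w : List Bool | w.length = n}.Finite :=
  List.finite_length_eq Bool n

theorem finite_length_lt_bool (n : ℕ) : {w : List Bool | w.length < n}.Finite :=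
  List.finite_length_lt Bool n

theorem ncard_length_eq (n : ℕ) : {w : List Bool | w.length = n}.ncard = 2 ^ n := by
  rw [← Nat.card_coe_set_eq]
  have : Nat.card (List.Vector Bool n) = 2 ^ n := by simp [Nat.card_eq_fintype_card]
  exact this

theorem ncard_length_lt (n : ℕ) : {w : List Bool | w.length < n}.ncard + 1 = 2 ^ n := by
  induction n with
  | zero => simp
  | succ n ih =>
    have h1 : {w : List Bool | w.length < n + 1} =
        {w : List Bool | w.length < n} ∪ {w : List Bool | w.length = n} := by
      ext w; simp only [Set.mem_union, Set.mem_ofPred_eq]; omega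
    rw [h1, Set.ncard_union_eq ?_ (finite_length_lt_bool n) (finite_length_eq_bool n),
      ncard_length_eq, pow_succ]
    · omega
    · rw [Set.disjoint_left]
      intro w h2 h3
      simp only [Set.mem_ofPred_eq] at h2 h3
      omega

theorem vertexSet_doubleTree (h : ℕ) :
    V(doubleTree h) = Sum.inl '' {w : List Bool | w.length = h} ∪
      Sum.inr '' ((Set.univ : Set Bool) ×ˢ {w : List Bool | w.length < h}) := by
  ext v
  rcases v with w | ⟨i, w⟩
  · simp [mem_vertexSet_inl]
  · simp [mem_vertexSet_inr]

theorem finite_vertexSet_doubleTree (h : ℕ) : V(doubleTree h).Finite := by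
  rw [vertexSet_doubleTree]
  exact ((finite_length_eq_bool h).image _).union
    ((Set.finite_univ.prod (finite_length_lt_bool h)).image _)

theorem ncard_vertexSet_doubleTree (h : ℕ) : V(doubleTree h).ncard + 2 = 3 * 2 ^ h := by
  rw [vertexSet_doubleTree, Set.ncard_union_eq ?_ ((finite_length_eq_bool h).image _)
    ((Set.finite_univ.prod (finite_length_lt_bool h)).image _),
    Set.ncard_image_of_injective _ Sum.inl_injective,
    Set.ncard_image_of_injective _ Sum.inr_injective, Set.ncard_prod, ncard_length_eq,
    Set.ncard_univ, Nat.card_eq_fintype_card, Fintype.card_bool]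
  · have := ncard_length_lt h
    omega
  · rw [Set.disjoint_left]
    rintro v ⟨w, _, rfl⟩ ⟨w', _, h3⟩
    cases h3

theorem edgeSet_doubleTree (h : ℕ) :
    E(doubleTree h) = (fun p : (Bool × Bool) × List Bool => ((p.1.1, p.1.2 :: p.2) : TreeEdge)) ''
      ((Set.univ : Set (Bool × Bool)) ×ˢ {w : List Bool | w.length < h}) := by
  ext f
  rw [mem_edgeSet_doubleTree]
  constructor
  · rintro ⟨i, b, w, hw, rfl⟩
    exact ⟨((i, b), w), ⟨trivial, hw⟩, rfl⟩
  · rintro ⟨⟨⟨i, b⟩, w⟩, ⟨_, hw⟩, rfl⟩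
    exact ⟨i, b, w, hw, rfl⟩

theorem finite_edgeSet_doubleTree (h : ℕ) : E(doubleTree h).Finite := by
  rw [edgeSet_doubleTree]
  exact (Set.finite_univ.prod (finite_length_lt_bool h)).image _

theorem ncard_edgeSet_doubleTree (h : ℕ) : E(doubleTree h).ncard + 4 = 4 * 2 ^ h := by
  rw [edgeSet_doubleTree, Set.ncard_image_of_injective, Set.ncard_prod, Set.ncard_univ,
    Nat.card_eq_fintype_card, Fintype.card_prod, Fintype.card_bool]
  · have := ncard_length_lt h
    omega
  · rintro ⟨⟨i, b⟩, w⟩ ⟨⟨j, c⟩, u⟩ heq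
    simp only [Prod.mk.injEq, List.cons.injEq] at heq ⊢
    tauto

theorem not_isLink_self_doubleTree {h : ℕ} {f : TreeEdge} {v : TreeVertex} :
    ¬ (doubleTree h).IsLink f v v := by
  rintro ⟨i, b, w, hw, rfl, ⟨h1, h2⟩ | ⟨h1, h2⟩⟩ <;>
  · have := congrArg List.length (treeNode_injective h i (h1.symm.trans h2))
    simp at this

/-- Every node is connected to the root of its tree. -/
theorem reflTransGen_adj_root {h : ℕ} (i : Bool) (w : List Bool) (hw : w.length ≤ h) :
    Relation.ReflTransGen (doubleTree h).Adj (treeNode h i w) (treeNode h i []) := by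
  induction w with
  | nil => exact .refl
  | cons b w ih =>
    simp only [List.length_cons] at hw
    exact .head (isLink_doubleTree i b (by omega)).adj (ih (by omega))

theorem reflTransGen_adj_doubleTree {h : ℕ} {u v : TreeVertex} (hu : u ∈ V(doubleTree h))
    (hv : v ∈ V(doubleTree h)) : Relation.ReflTransGen (doubleTree h).Adj u v := by
  have symm : ∀ {a b}, Relation.ReflTransGen (doubleTree h).Adj a b →
      Relation.ReflTransGen (doubleTree h).Adj b a := by
    intro a b hab
    induction hab with
    | refl => exact .refl
    | tail _ h2 ih => exact .head h2.symm ih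
  have roots : ∀ i j, Relation.ReflTransGen (doubleTree h).Adj (treeNode h i [])
      (treeNode h j []) := by
    intro i j
    have hl : (List.replicate h false).length = h := by simp
    have h1 := symm (reflTransGen_adj_root (h := h) i (List.replicate h false) hl.le)
    have h2 := reflTransGen_adj_root (h := h) j (List.replicate h false) hl.le
    rw [treeNode_leaf hl] at h1 h2
    exact h1.trans h2
  obtain ⟨i, w, hw, rfl⟩ := hu
  obtain ⟨j, w', hw', rfl⟩ := hv
  exact (reflTransGen_adj_root i w hw).trans
    ((roots i j).trans (symm (reflTransGen_adj_root j w' hw')))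

theorem componentSet_eq_singleton {V E : Type*} {G : Graph V E} (hne : V(G).Nonempty)
    (hconn : ∀ u ∈ V(G), ∀ v ∈ V(G), Relation.ReflTransGen G.Adj u v) :
    componentSet G = {V(G)} := by
  have key : ∀ v ∈ V(G), {w | Relation.ReflTransGen G.Adj v w} = V(G) := by
    intro v hv
    ext w
    refine ⟨fun hw => ?_, fun hw => hconn v hv w hw⟩
    rcases Relation.ReflTransGen.cases_tail hw with rfl | ⟨_, _, h2⟩
    · exact hv
    · exact h2.right_mem
  ext C
  constructor
  · rintro ⟨v, hv, rfl⟩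
    exact key v hv
  · rintro rfl
    obtain ⟨v, hv⟩ := hne
    exact ⟨v, hv, (key v hv).symm⟩

/-! ### Adding an edge between two leaves -/

theorem isLink_addEdge_of_ne {V E : Type*} {G : Graph V E} {e f : E} {x y u v : V} (hf : f ≠ e) :
    (addEdge G e x y).IsLink f u v ↔ G.IsLink f u v := by
  simp [addEdge, hf]

theorem isLink_addEdge_self {V E : Type*} {G : Graph V E} {e : E} {x y u v : V} :
    (addEdge G e x y).IsLink e u v ↔ (u = x ∧ v = y) ∨ (u = y ∧ v = x) := by
  simp [addEdge]

theorem inc_addEdge_iff {V E : Type*} {G : Graph V E} {e f : E} {x y v : V} :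
    (addEdge G e x y).Inc f v ↔ (f ≠ e ∧ G.Inc f v) ∨ (f = e ∧ (v = x ∨ v = y)) := by
  by_cases hf : f = e
  · subst hf
    simp only [Graph.Inc, isLink_addEdge_self, ne_eq, not_true_eq_false, false_and, true_and,
      false_or]
    constructor
    · rintro ⟨u, ⟨rfl, _⟩ | ⟨rfl, _⟩⟩ <;> simp
    · rintro (rfl | rfl)
      · exact ⟨y, Or.inl ⟨rfl, rfl⟩⟩
      · exact ⟨x, Or.inr ⟨rfl, rfl⟩⟩
  · simp [Graph.Inc, isLink_addEdge_of_ne hf, hf]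

theorem edgeSet_addEdge {V E : Type*} {G : Graph V E} {e : E} {x y : V} (he : e ∉ E(G)) :
    E(addEdge G e x y) = insert e E(G) := by
  ext f
  by_cases hf : f = e
  · subst hf
    simp only [Set.mem_insert_iff, true_or, iff_true]
    exact (isLink_addEdge_self.2 (Or.inl ⟨rfl, rfl⟩)).edge_mem
  · simp only [Set.mem_insert_iff, hf, false_or, Graph.edge_mem_iff_exists_isLink,
      isLink_addEdge_of_ne hf]

theorem vertexSet_addEdge {V E : Type*} {G : Graph V E} {e : E} {x y : V} (hx : x ∈ V(G))
    (hy : y ∈ V(G)) : V(addEdge G e x y) = V(G) := by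
  change insert x (insert y V(G)) = V(G)
  rw [Set.insert_eq_of_mem hy, Set.insert_eq_of_mem hx]

theorem componentSet_addEdge_doubleTree {h : ℕ} {e : TreeEdge} {x y : TreeVertex}
    (he : e ∉ E(doubleTree h)) (hx : x ∈ V(doubleTree h)) (hy : y ∈ V(doubleTree h)) :
    componentSet (addEdge (doubleTree h) e x y) = {V(doubleTree h)} := by
  rw [← vertexSet_addEdge (e := e) hx hy]
  refine componentSet_eq_singleton ⟨x, Or.inl rfl⟩ ?_
  rw [vertexSet_addEdge hx hy]
  intro u hu v hv
  refine Relation.ReflTransGen.mono ?_ _ _ (reflTransGen_adj_doubleTree hu hv)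
  rintro a b ⟨f, hf⟩
  exact ⟨f, (isLink_addEdge_of_ne (by rintro rfl; exact he hf.edge_mem)).2 hf⟩

end DoubleTree

/-! ### Leaves reached by a rule, and consecutive leaves -/

section EndLeaf

/-- `l` is the leaf that is reached from the node `w` if at every node `v` one goes on to its child
`g v :: v`. -/
def EndLeaf (h : ℕ) (g : List Bool → Bool) (w l : List Bool) : Prop :=
  l.length = h ∧ w <:+ l ∧ ∀ c v, c :: v <:+ l → w <:+ v → c = g v

/-- `l'` is the leaf that follows `l` if at every node `v ≠ []` the subtree of `(!b v) :: v` comes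
directly before that of `b v :: v`, while the two subtrees at the root are in a circular order. -/
def NextLeaf (h : ℕ) (b : List Bool → Bool) (l l' : List Bool) : Prop :=
  ∃ c w, (w ≠ [] → b w = !c) ∧ EndLeaf h b (c :: w) l ∧ EndLeaf h (fun v => !b v) ((!c) :: w) l'

variable {h : ℕ} {g : List Bool → Bool} {w l l' : List Bool}

theorem EndLeaf.length_le (hl : EndLeaf h g w l) : w.length ≤ h := hl.1 ▸ hl.2.1.length_le

theorem EndLeaf.eq_of_length (hl : EndLeaf h g w l) (hw : w.length = h) : l = w :=
  (hl.2.1.eq_of_length (hw.trans hl.1.symm)).symm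

theorem endLeaf_self (hw : w.length = h) : EndLeaf h g w w := by
  refine ⟨hw, List.suffix_rfl, fun c v hc hv => ?_⟩
  have h1 := hc.length_le
  have h2 := hv.length_le
  simp at h1
  omega

theorem endLeaf_cons_iff (hw : w.length < h) : EndLeaf h g (g w :: w) l ↔ EndLeaf h g w l := by
  constructor
  · rintro ⟨h1, h2, h3⟩
    refine ⟨h1, (List.suffix_cons _ _).trans h2, fun c v hc hv => ?_⟩
    rcases Nat.lt_or_ge w.length v.length with hlt | hge
    · exact h3 c v hc (List.suffix_of_suffix_length_le h2 ((List.suffix_cons _ _).trans hc)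
        (by simpa using hlt))
    · obtain rfl := hv.eq_of_length (le_antisymm hv.length_le hge)
      have := (List.suffix_of_suffix_length_le hc h2 (by simp)).eq_of_length (by simp)
      simpa using this
  · rintro ⟨h1, h2, h3⟩
    have h4 : ∃ c, c :: w <:+ l := by
      obtain ⟨t, rfl⟩ := h2
      rcases List.eq_nil_or_concat t with rfl | ⟨t, c, rfl⟩
      · simp at h1; omega
      · exact ⟨c, t, by simp⟩
    obtain ⟨c, hc⟩ := h4
    obtain rfl := h3 c w hc List.suffix_rfl
    exact ⟨h1, hc, fun c v hc' hv => h3 c v hc' ((List.suffix_cons _ _).trans hv)⟩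

theorem exists_endLeaf (h : ℕ) (g : List Bool → Bool) (w : List Bool) (hw : w.length ≤ h) :
    ∃ l, EndLeaf h g w l := by
  induction hn : h - w.length generalizing w with
  | zero => exact ⟨w, endLeaf_self (by omega)⟩
  | succ n ih =>
    obtain ⟨l, hl⟩ := ih (g w :: w) (by simp; omega) (by simp; omega)
    exact ⟨l, (endLeaf_cons_iff (by omega)).1 hl⟩

theorem not_cons_suffix_and {c d : Bool} (hc : c :: w <:+ l) (hd : d :: w <:+ l) : c = d := by
  have := (List.suffix_of_suffix_length_le hc hd (by simp)).eq_of_length (by simp)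
  simpa using this

theorem NextLeaf.ne {b : List Bool → Bool} (hl : NextLeaf h b l l') : l ≠ l' := by
  rintro rfl
  obtain ⟨c, w, _, h1, h2⟩ := hl
  have := not_cons_suffix_and h1.2.1 h2.2.1
  simp at this

/-- From `l` one climbs as long as one comes from the last child of a node that is not the root; the
next leaf is found by descending from the other child of the node where the climb stops. -/
theorem exists_nextLeaf (hh : 1 ≤ h) (b : List Bool → Bool) (l : List Bool) (hl : l.length = h) :
    ∃ l', NextLeaf h b l l' := by
  have key : ∀ v, v ≠ [] → EndLeaf h b v l → ∃ l', NextLeaf h b l l' := by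
    intro v
    induction v with
    | nil => exact fun h => absurd rfl h
    | cons c w ih =>
      intro _ hv
      by_cases hw : w ≠ [] → b w = !c
      · obtain ⟨l', hl'⟩ := exists_endLeaf h (fun v => !b v) ((!c) :: w)
          (by simpa using hv.length_le)
        exact ⟨l', c, w, hw, hv, hl'⟩
      · rw [Classical.not_imp] at hw
        obtain ⟨hne, hb⟩ := hw
        have hb' : b w = c := by
          cases hbw : b w <;> cases c <;> simp_all
        refine ih hne ((endLeaf_cons_iff ?_).1 (by rwa [hb']))
        have := hv.length_le
        simp at this
        omega
  exact key l (by rintro rfl; simp at hl; omega) (endLeaf_self hl)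

end EndLeaf

/-! ### Walking around the faces of an embedded double tree -/

section Faces

/-- The graph `Γ` with the rotations `rot` consists of the double tree of height `h` and perhaps
further edges between leaves. At the node `w ≠ []` of the tree `i`, the rotation leads from the
edge to the parent to the child `!b i w`, then to the child `b i w`, and back to the parent. -/
structure IsTreeRotation (h : ℕ) (Γ : Graph TreeVertex TreeEdge)
    (rot : TreeVertex → Equiv.Perm TreeEdge) (b : Bool → List Bool → Bool) : Prop where
  finite_vertexSet : V(Γ).Finite
  finite_edgeSet : E(Γ).Finite
  isLink : ∀ i c w, w.length < h →
    Γ.IsLink (i, c :: w) (treeNode h i (c :: w)) (treeNode h i w)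
  inc_inr : ∀ f i w, Γ.Inc f (Sum.inr (i, w)) ↔ (doubleTree h).Inc f (Sum.inr (i, w))
  isCycleOn : ∀ v, (rot v).IsCycleOn {e | Γ.Inc e v}
  rot_child : ∀ i c w, w.length < h → rot (Sum.inr (i, w)) (i, c :: w) =
    if w ≠ [] ∧ b i w = c then (i, w) else (i, (!c) :: w)
  rot_parent : ∀ i w, w.length < h → w ≠ [] →
    rot (Sum.inr (i, w)) (i, w) = (i, (!b i w) :: w)

/-- The darts at the leaves. -/
def leafDarts (Γ : Graph TreeVertex TreeEdge) : Set (TreeVertex × TreeEdge) :=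
  {d | Γ.Inc d.2 d.1 ∧ ∃ w, d.1 = Sum.inl w}

variable {V E : Type*} {G : Graph V E} {rot' : V → Equiv.Perm E}

theorem faceStep_rightUnique : Relator.RightUnique (FaceStep G rot') := by
  rintro ⟨v, e⟩ ⟨w, f⟩ ⟨w', f'⟩ ⟨h1, h2⟩ ⟨h3, h4⟩
  obtain rfl : w = w' := Graph.IsLink.right_unique h1 h3
  exact Prod.ext rfl (h2.trans h4.symm)

theorem faceStep_leftUnique : Relator.LeftUnique (FaceStep G rot') := by
  rintro ⟨v, e⟩ ⟨v', e'⟩ ⟨w, f⟩ ⟨h1, h2⟩ ⟨h3, h4⟩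
  obtain rfl : e = e' := (rot' w).injective (h2.symm.trans h4)
  exact Prod.ext (Graph.IsLink.left_unique h1 h3) rfl

theorem faceStep_exists (hc : ∀ v, (rot' v).IsCycleOn {e | G.Inc e v}) :
    ∀ d ∈ {d : V × E | G.Inc d.2 d.1}, ∃ d' ∈ {d : V × E | G.Inc d.2 d.1},
      FaceStep G rot' d d' := by
  rintro ⟨v, e⟩ ⟨w, hw⟩
  exact ⟨(w, rot' w e), (hc w).1.mapsTo (show G.Inc e w from hw.inc_right), hw, rfl⟩

theorem finite_darts (hV : V(G).Finite) (hE : E(G).Finite) :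
    {d : V × E | G.Inc d.2 d.1}.Finite :=
  (hV.prod hE).subset fun _ hd => ⟨hd.vertex_mem, hd.edge_mem⟩

theorem faceSet_eq_orbits : faceSet G rot' = {F | ∃ d ∈ {d : V × E | G.Inc d.2 d.1},
    F = {y | Relation.ReflTransGen (FaceStep G rot') d y}} := by
  ext F
  constructor
  · rintro ⟨v, e, he, rfl⟩
    exact ⟨(v, e), he, rfl⟩
  · rintro ⟨⟨v, e⟩, he, rfl⟩
    exact ⟨v, e, he, rfl⟩

variable {h : ℕ} {Γ : Graph TreeVertex TreeEdge} {rot : TreeVertex → Equiv.Perm TreeEdge}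
  {b : Bool → List Bool → Bool}

theorem inr_notMem_leafDarts {p : Bool × List Bool} {f : TreeEdge} :
    ((Sum.inr p, f) : TreeVertex × TreeEdge) ∉ leafDarts Γ := by
  rintro ⟨_, w, hw⟩
  cases hw

namespace IsTreeRotation

theorem inc_leaf (T : IsTreeRotation h Γ rot b) (hh : 1 ≤ h) (i : Bool) {l : List Bool}
    (hl : l.length = h) : Γ.Inc (i, l) (Sum.inl l) := by
  obtain ⟨a, v, rfl⟩ := List.exists_cons_of_ne_nil (l := l) (by rintro rfl; simp at hl; omega)
  have := (T.isLink i a v (by simp at hl; omega)).inc_left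
  rwa [treeNode_leaf hl] at this

/-- Going up from a leaf: the face walk stays in the tree as long as it comes from the last
child. -/
theorem ascend (T : IsTreeRotation h Γ rot b) (i : Bool) {v l : List Bool} (hv : v ≠ [])
    (hl : EndLeaf h (b i) v l) :
    Relation.ReflTransGen (fun d d' => FaceStep Γ rot d d' ∧ d' ∉ leafDarts Γ)
      (Sum.inl l, (i, l)) (treeNode h i v, (i, v)) := by
  induction hn : h - v.length generalizing v with
  | zero =>
    have hv' : v.length = h := le_antisymm hl.length_le (by omega)
    rw [hl.eq_of_length hv', treeNode_leaf hv']
  | succ n ih =>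
    have hlt : v.length < h := by omega
    refine (ih (v := b i v :: v) (by simp) ((endLeaf_cons_iff hlt).2 hl) (by simp; omega)).tail
      ⟨⟨T.isLink i _ v hlt, ?_⟩, ?_⟩
    · simp [treeNode_of_lt hlt, T.rot_child i _ v hlt, hv]
    · rw [treeNode_of_lt hlt]
      exact inr_notMem_leafDarts

/-- Going down to a leaf: the face walk always takes the first child. -/
theorem descend (T : IsTreeRotation h Γ rot b) (i c : Bool) {w l : List Bool}
    (hl : EndLeaf h (fun v => !b i v) (c :: w) l) :
    ∃ d, Relation.ReflTransGen (fun d d' => FaceStep Γ rot d d' ∧ d' ∉ leafDarts Γ)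
      (treeNode h i w, (i, c :: w)) d ∧
      FaceStep Γ rot d (Sum.inl l, rot (Sum.inl l) (i, l)) := by
  induction hn : h - (c :: w).length generalizing c w with
  | zero =>
    have hv' : (c :: w).length = h := le_antisymm hl.length_le (by omega)
    rw [hl.eq_of_length hv', ← treeNode_leaf (i := i) hv']
    exact ⟨_, .refl, (T.isLink i c w (by simp at hv'; omega)).symm, rfl⟩
  | succ n ih =>
    have hlt : (c :: w).length < h := by omega
    obtain ⟨d, h1, h2⟩ := ih (!b i (c :: w)) (w := c :: w) ((endLeaf_cons_iff hlt).2 hl)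
      (by simp at hn ⊢; omega)
    refine ⟨d, h1.head ⟨⟨(T.isLink i c w (by simp at hlt; omega)).symm, ?_⟩, ?_⟩, h2⟩
    · simp only [treeNode_of_lt hlt]
      rw [T.rot_parent i _ hlt (by simp)]
    · rw [treeNode_of_lt hlt]
      exact inr_notMem_leafDarts

/-- The face walk that enters the tree `i` at the leaf `l` leaves it at the leaf that follows `l`
in the order given by this tree. -/
theorem firstReturn (T : IsTreeRotation h Γ rot b) (i : Bool) {l l' : List Bool}
    (hl : NextLeaf h (b i) l l') :
    FirstReturn (FaceStep Γ rot) (leafDarts Γ) (Sum.inl l, (i, l))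
      (Sum.inl l', rot (Sum.inl l') (i, l')) := by
  obtain ⟨c, w, hw, h1, h2⟩ := hl
  have hlt : w.length < h := by simpa using h1.length_le
  obtain ⟨d, h3, h4⟩ := T.descend i (!c) h2
  refine ⟨⟨?_, l', rfl⟩, d, ((T.ascend i (by simp) h1).tail ⟨⟨T.isLink i c w hlt, ?_⟩, ?_⟩).trans
    h3, h4⟩
  · exact (T.isCycleOn _).1.mapsTo (T.inc_leaf (by omega) i h2.1)
  · simp only [treeNode_of_lt hlt, T.rot_child i c w hlt]
    rw [if_neg]
    rintro ⟨hne, hb⟩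
    have := hw hne
    simp [hb] at this
  · rw [treeNode_of_lt hlt]
    exact inr_notMem_leafDarts

/-- Every face passes through a leaf. -/
theorem cover (T : IsTreeRotation h Γ rot b) :
    ∀ d ∈ {d : TreeVertex × TreeEdge | Γ.Inc d.2 d.1}, ∃ d' ∈ leafDarts Γ,
      Relation.ReflTransGen (FaceStep Γ rot) d d' ∨
        Relation.ReflTransGen (FaceStep Γ rot) d' d := by
  have mono : ∀ {a b}, Relation.ReflTransGen
      (fun d d' => FaceStep Γ rot d d' ∧ d' ∉ leafDarts Γ) a b →
      Relation.ReflTransGen (FaceStep Γ rot) a b :=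
    fun h => Relation.ReflTransGen.mono (fun _ _ h => h.1) _ _ h
  rintro ⟨w | ⟨i, w⟩, f⟩ hd
  · exact ⟨_, ⟨hd, w, rfl⟩, Or.inl .refl⟩
  · rcases inc_doubleTree_inr.1 ((T.inc_inr _ _ _).1 hd) with ⟨hw, ⟨hne, rfl⟩ | ⟨c, rfl⟩⟩
    · obtain ⟨l, hl⟩ := exists_endLeaf h (b i) w hw.le
      have := T.ascend i hne hl
      rw [treeNode_of_lt hw] at this
      exact ⟨(Sum.inl l, (i, l)), ⟨T.inc_leaf (by omega) i hl.1, l, rfl⟩, Or.inr (mono this)⟩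
    · obtain ⟨l, hl⟩ := exists_endLeaf h (fun v => !b i v) (c :: w) (by simpa using hw)
      obtain ⟨d, h1, h2⟩ := T.descend i c hl
      rw [treeNode_of_lt hw] at h1
      exact ⟨(Sum.inl l, rot (Sum.inl l) (i, l)), ⟨(T.isCycleOn _).1.mapsTo
        (T.inc_leaf (by omega) i hl.1), l, rfl⟩, Or.inl ((mono h1).tail h2)⟩

/-- A tree rotation with as few leaf darts as twice the number of faces has faces with exactly two
leaf darts. -/
theorem symm_of_card (T : IsTreeRotation h Γ rot b)
    (hret : ∀ d ∈ leafDarts Γ, ∃ d', d' ≠ d ∧ FirstReturn (FaceStep Γ rot) (leafDarts Γ) d d')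
    (hcard : (leafDarts Γ).ncard = 2 * (faceSet Γ rot).ncard) {d d' : TreeVertex × TreeEdge}
    (hd : d ∈ leafDarts Γ) (hdd' : FirstReturn (FaceStep Γ rot) (leafDarts Γ) d d') :
    FirstReturn (FaceStep Γ rot) (leafDarts Γ) d' d :=
  firstReturn_symm_of_card (finite_darts T.finite_vertexSet T.finite_edgeSet)
    (faceStep_exists T.isCycleOn) faceStep_rightUnique faceStep_leftUnique (fun _ h => h.1)
    T.cover hret (by rw [hcard, faceSet_eq_orbits]) hd hdd'

theorem card_of_symm (T : IsTreeRotation h Γ rot b)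
    (hret : ∀ d ∈ leafDarts Γ, ∃ d', d' ≠ d ∧ FirstReturn (FaceStep Γ rot) (leafDarts Γ) d d')
    (hsymm : ∀ d ∈ leafDarts Γ, ∀ d', FirstReturn (FaceStep Γ rot) (leafDarts Γ) d d' →
      FirstReturn (FaceStep Γ rot) (leafDarts Γ) d' d) :
    (leafDarts Γ).ncard = 2 * (faceSet Γ rot).ncard := by
  rw [faceSet_eq_orbits]
  exact card_of_firstReturn_symm (finite_darts T.finite_vertexSet T.finite_edgeSet)
    (faceStep_exists T.isCycleOn) faceStep_rightUnique faceStep_leftUnique (fun _ h => h.1)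
    T.cover hret hsymm

end IsTreeRotation

end Faces

/-! ### Euler's formula in terms of the orders of the leaves -/

section Planarity

variable {h : ℕ}

theorem setOf_inc_node {i : Bool} {w : List Bool} (hw : w.length < h) (hne : w ≠ []) :
    {f | (doubleTree h).Inc f (Sum.inr (i, w))} = {(i, w), (i, false :: w), (i, true :: w)} := by
  ext f
  simp only [Set.mem_ofPred_eq, inc_doubleTree_inr, hw, true_and, hne, ne_eq, not_false_eq_true,
    Bool.exists_bool, Set.mem_insert_iff, Set.mem_singleton_iff]

theorem setOf_inc_root {i : Bool} (hh : 1 ≤ h) :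
    {f | (doubleTree h).Inc f (Sum.inr (i, []))} = {(i, [false]), (i, [true])} := by
  ext f
  have : 0 < h := by omega
  simp [inc_doubleTree_inr, this]

theorem setOf_inc_leaf {l : List Bool} (hh : 1 ≤ h) (hl : l.length = h) :
    {f | (doubleTree h).Inc f (Sum.inl l)} = {(false, l), (true, l)} := by
  ext f
  simp [inc_doubleTree_inl hh, hl]

theorem ne_cons_edge (i j c : Bool) (w : List Bool) : ((i, w) : TreeEdge) ≠ (j, c :: w) := by
  intro h
  have := congrArg (fun p : TreeEdge => p.2.length) h
  simp at this

/-- The three edges at a node have only two circular orders, so the rotations at the nodes are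
described by one bit per node, whatever they are at the leaves. -/
theorem exists_isTreeRotation {Γ : Graph TreeVertex TreeEdge}
    {rot : TreeVertex → Equiv.Perm TreeEdge} (hV : V(Γ).Finite) (hE : E(Γ).Finite)
    (hlink : ∀ i c w, w.length < h →
      Γ.IsLink (i, c :: w) (treeNode h i (c :: w)) (treeNode h i w))
    (hinc : ∀ f i w, Γ.Inc f (Sum.inr (i, w)) ↔ (doubleTree h).Inc f (Sum.inr (i, w)))
    (hcyc : ∀ v, (rot v).IsCycleOn {e | Γ.Inc e v}) :
    ∃ b, IsTreeRotation h Γ rot b := by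
  refine ⟨fun i w => decide (rot (Sum.inr (i, w)) (i, true :: w) = (i, w)), hV, hE, hlink, hinc,
    hcyc, ?_, ?_⟩
  · intro i c w hw
    have h1 := hcyc (Sum.inr (i, w))
    simp only [hinc] at h1
    by_cases hne : w = []
    · subst hne
      rw [setOf_inc_root (by simp at hw; omega)] at h1
      have := isCycleOn_pair_apply h1 (by simp)
      cases c <;> simp [this]
    · rw [setOf_inc_node hw hne] at h1
      have := ne_cons_edge i i true w
      rcases isCycleOn_triple_apply h1 (by simp) (by simp) (by simp) with
        ⟨h2, h3, h4⟩ | ⟨h2, h3, h4⟩ <;>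
      cases c <;> simp [h3, h4, hne]
  · intro i w hw hne
    have h1 := hcyc (Sum.inr (i, w))
    simp only [hinc] at h1
    rw [setOf_inc_node hw hne] at h1
    rcases isCycleOn_triple_apply h1 (by simp) (by simp) (by simp) with
      ⟨h2, h3, h4⟩ | ⟨h2, h3, h4⟩ <;>
      simp [h2, h3, h4]

/-! #### The double tree itself -/

theorem exists_isTreeRotation_of_mem_Emb {H : PlaneGraph TreeVertex TreeEdge}
    (hH : H ∈ Emb (doubleTree h)) : ∃ b, IsTreeRotation h (doubleTree h) H.rot b := by
  have hH' : H.graph = doubleTree h := hH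
  refine exists_isTreeRotation (finite_vertexSet_doubleTree h) (finite_edgeSet_doubleTree h)
    (fun i c w hw => isLink_doubleTree i c hw) (fun _ _ _ => Iff.rfl) ?_
  rw [← hH']
  exact H.rot_isCycleOn

theorem leafDarts_doubleTree (hh : 1 ≤ h) : leafDarts (doubleTree h) =
    (fun p : Bool × List Bool => ((Sum.inl p.2, p) : TreeVertex × TreeEdge)) ''
      ((Set.univ : Set Bool) ×ˢ {w : List Bool | w.length = h}) := by
  ext ⟨v, f⟩
  constructor
  · rintro ⟨h1, w, rfl⟩
    obtain ⟨hw, i, rfl⟩ := (inc_doubleTree_inl hh).1 h1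
    exact ⟨(i, w), ⟨trivial, hw⟩, rfl⟩
  · rintro ⟨⟨i, w⟩, ⟨_, hw⟩, heq⟩
    obtain ⟨rfl, rfl⟩ := Prod.mk.inj heq
    exact ⟨(inc_doubleTree_inl hh).2 ⟨hw, i, rfl⟩, w, rfl⟩

theorem mem_leafDarts_doubleTree (hh : 1 ≤ h) {d : TreeVertex × TreeEdge} :
    d ∈ leafDarts (doubleTree h) ↔ ∃ i l, l.length = h ∧ d = (Sum.inl l, (i, l)) := by
  rw [leafDarts_doubleTree hh]
  constructor
  · rintro ⟨⟨i, w⟩, ⟨_, hw⟩, rfl⟩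
    exact ⟨i, w, hw, rfl⟩
  · rintro ⟨i, w, hw, rfl⟩
    exact ⟨(i, w), ⟨trivial, hw⟩, rfl⟩

theorem finite_leafDarts {Γ : Graph TreeVertex TreeEdge} (hV : V(Γ).Finite) (hE : E(Γ).Finite) :
    (leafDarts Γ).Finite :=
  (finite_darts hV hE).subset fun _ hd => hd.1

theorem ncard_leafDarts_doubleTree (hh : 1 ≤ h) :
    (leafDarts (doubleTree h)).ncard = 2 * 2 ^ h := by
  rw [leafDarts_doubleTree hh, Set.ncard_image_of_injective, Set.ncard_prod, Set.ncard_univ,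
    Nat.card_eq_fintype_card, Fintype.card_bool, ncard_length_eq]
  rintro p q hpq
  exact (Prod.mk.inj hpq).2

theorem isolatedSet_eq_empty {V E : Type*} {G : Graph V E} (hG : ∀ v ∈ V(G), ∃ e, G.Inc e v) :
    isolatedSet G = ∅ := by
  ext v
  simp only [Set.mem_empty_iff_false, iff_false]
  rintro ⟨hv, h⟩
  obtain ⟨e, he⟩ := hG v hv
  exact h e he

theorem exists_inc_doubleTree (hh : 1 ≤ h) :
    ∀ v ∈ V(doubleTree h), ∃ e, (doubleTree h).Inc e v := by
  rintro (l | ⟨i, w⟩) hv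
  · exact ⟨(true, l), (inc_doubleTree_inl hh).2 ⟨mem_vertexSet_inl.1 hv, true, rfl⟩⟩
  · exact ⟨(i, true :: w), inc_doubleTree_inr.2 ⟨mem_vertexSet_inr.1 hv, Or.inr ⟨true, rfl⟩⟩⟩

theorem rot_leaf_doubleTree {b : Bool → List Bool → Bool}
    {rot : TreeVertex → Equiv.Perm TreeEdge} (T : IsTreeRotation h (doubleTree h) rot b)
    (hh : 1 ≤ h) (i : Bool) {l : List Bool} (hl : l.length = h) :
    rot (Sum.inl l) (i, l) = (!i, l) := by
  have h1 := T.isCycleOn (Sum.inl l)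
  rw [setOf_inc_leaf hh hl] at h1
  have h2 := isCycleOn_pair_apply h1 (by simp)
  cases i
  · exact h2.1
  · exact h2.2

/-- As a walk through a tree ends at another leaf than it starts from, no face has fewer than two
leaf darts. -/
theorem hret_doubleTree {b : Bool → List Bool → Bool}
    {rot : TreeVertex → Equiv.Perm TreeEdge} (T : IsTreeRotation h (doubleTree h) rot b)
    (hh : 1 ≤ h) : ∀ d ∈ leafDarts (doubleTree h), ∃ d', d' ≠ d ∧
      FirstReturn (FaceStep (doubleTree h) rot) (leafDarts (doubleTree h)) d d' := by
  intro d hd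
  obtain ⟨i, l, hl, rfl⟩ := (mem_leafDarts_doubleTree hh).1 hd
  obtain ⟨l', hl'⟩ := exists_nextLeaf hh (b i) l hl
  refine ⟨_, ?_, T.firstReturn i hl'⟩
  intro h1
  exact hl'.ne.symm (Sum.inl_injective (Prod.mk.inj h1).1)

/-- Euler's formula for the double tree is equivalent to the faces having two leaf darts each. -/
theorem euler_doubleTree_iff (hh : 1 ≤ h) (rot : TreeVertex → Equiv.Perm TreeEdge) :
    V(doubleTree h).ncard +
        ((faceSet (doubleTree h) rot).ncard + (isolatedSet (doubleTree h)).ncard) =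
      E(doubleTree h).ncard + 2 * (componentSet (doubleTree h)).ncard ↔
    (leafDarts (doubleTree h)).ncard = 2 * (faceSet (doubleTree h) rot).ncard := by
  have hne : V(doubleTree h).Nonempty :=
    ⟨Sum.inr (true, []), mem_vertexSet_inr.2 (by simp; omega)⟩
  rw [isolatedSet_eq_empty (exists_inc_doubleTree hh), Set.ncard_empty,
    componentSet_eq_singleton hne (fun u hu v hv => reflTransGen_adj_doubleTree hu hv),
    Set.ncard_singleton, ncard_leafDarts_doubleTree hh]
  have h1 := ncard_vertexSet_doubleTree h
  have h2 := ncard_edgeSet_doubleTree h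
  omega

/-- In a plane embedding every face has two leaf darts, so it passes from `l` to `l'` through one
tree and from `l'` back to `l` through the other one. -/
theorem nextLeaf_symm_of_mem_Emb (hh : 1 ≤ h) {H : PlaneGraph TreeVertex TreeEdge}
    (hH : H ∈ Emb (doubleTree h)) {b : Bool → List Bool → Bool}
    (T : IsTreeRotation h (doubleTree h) H.rot b) {i : Bool} {l l' : List Bool}
    (hl : NextLeaf h (b i) l l') : NextLeaf h (b !i) l' l := by
  have hH' : H.graph = doubleTree h := hH
  have heuler := H.euler
  rw [hH', euler_doubleTree_iff hh] at heuler
  have hlen : l.length = h := by obtain ⟨c, w, _, h1, _⟩ := hl; exact h1.1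
  have hlen' : l'.length = h := by obtain ⟨c, w, _, _, h1⟩ := hl; exact h1.1
  have h1 := T.firstReturn i hl
  have h2 := T.symm_of_card (hret_doubleTree T hh) heuler
    ((mem_leafDarts_doubleTree hh).2 ⟨i, l, hlen, rfl⟩) h1
  rw [rot_leaf_doubleTree T hh i hlen'] at h2
  obtain ⟨l₂, hl₂⟩ := exists_nextLeaf hh (b !i) l' hlen'
  have h3 := FirstReturn.rightUnique faceStep_rightUnique h2 (T.firstReturn (!i) hl₂)
  obtain rfl : l = l₂ := Sum.inl_injective (Prod.mk.inj h3).1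
  exact hl₂

/-- In a plane embedding of the double tree, the two trees are embedded as mirror images. -/
theorem mirror_of_mem_Emb (hh : 1 ≤ h) {H : PlaneGraph TreeVertex TreeEdge}
    (hH : H ∈ Emb (doubleTree h)) {b : Bool → List Bool → Bool}
    (T : IsTreeRotation h (doubleTree h) H.rot b) {w : List Bool} (hw : w.length < h)
    (hne : w ≠ []) : b true w = !b false w := by
  obtain ⟨l, hl⟩ := exists_endLeaf h (b false) ((!b false w) :: w) (by simpa using hw)
  obtain ⟨l', hl'⟩ := exists_endLeaf h (fun v => !b false v) ((b false w) :: w)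
    (by simpa using hw)
  have h1 : NextLeaf h (b false) l l' :=
    ⟨!b false w, w, fun _ => by simp, hl, by rwa [Bool.not_not]⟩
  obtain ⟨c, v, h2, h3, h4⟩ := nextLeaf_symm_of_mem_Emb hh hH T h1
  simp only [Bool.not_false] at h2 h3 h4
  -- The two leaves branch at a single node.
  have hvw : v = w := by
    rcases Nat.lt_trichotomy v.length w.length with hlt | heq | hgt
    · have h5 : (b false w :: w) <:+ l' := hl'.2.1
      have h6 : c = !c := by
        have h7 := List.suffix_of_suffix_length_le h3.2.1 ((List.suffix_cons _ _).trans h5)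
          (by simpa using hlt)
        have h8 := List.suffix_of_suffix_length_le h4.2.1 ((List.suffix_cons _ _).trans hl.2.1)
          (by simpa using hlt)
        exact not_cons_suffix_and h7 h8
      simp at h6
    · exact (List.suffix_of_suffix_length_le ((List.suffix_cons _ _).trans h3.2.1)
        ((List.suffix_cons _ _).trans hl'.2.1) heq.le).eq_of_length heq
    · have h6 : b false w = !b false w := by
        have h7 := List.suffix_of_suffix_length_le hl'.2.1 ((List.suffix_cons _ _).trans h3.2.1)
          (by simpa using hgt)
        have h8 := List.suffix_of_suffix_length_le hl.2.1 ((List.suffix_cons _ _).trans h4.2.1)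
          (by simpa using hgt)
        exact not_cons_suffix_and h7 h8
      simp at h6
  subst hvw
  rw [h2 hne, not_cons_suffix_and h3.2.1 hl'.2.1]

/-! #### The double tree with an additional edge -/

theorem inc_addEdge_inr {e f : TreeEdge} {x y : List Bool} {p : Bool × List Bool}
    (he : e ∉ E(doubleTree h)) :
    (addEdge (doubleTree h) e (Sum.inl x) (Sum.inl y)).Inc f (Sum.inr p) ↔
      (doubleTree h).Inc f (Sum.inr p) := by
  rw [inc_addEdge_iff]
  constructor
  · rintro (⟨_, h1⟩ | ⟨_, h1 | h1⟩)
    · exact h1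
    · cases h1
    · cases h1
  · intro h1
    exact Or.inl ⟨by rintro rfl; exact he h1.edge_mem, h1⟩

theorem finite_vertexSet_addEdge {V E : Type*} {G : Graph V E} {e : E} {x y : V}
    (hG : V(G).Finite) : V(addEdge G e x y).Finite :=
  (hG.insert y).insert x

variable {e : TreeEdge} {x y : List Bool}

theorem finite_edgeSet_addEdge (he : e ∉ E(doubleTree h)) :
    E(addEdge (doubleTree h) e (Sum.inl x) (Sum.inl y)).Finite := by
  rw [edgeSet_addEdge he]
  exact (finite_edgeSet_doubleTree h).insert e

theorem isLink_addEdge_doubleTree (he : e ∉ E(doubleTree h)) {f : TreeEdge} {u v : TreeVertex}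
    (hf : (doubleTree h).IsLink f u v) :
    (addEdge (doubleTree h) e (Sum.inl x) (Sum.inl y)).IsLink f u v :=
  (isLink_addEdge_of_ne (by rintro rfl; exact he hf.edge_mem)).2 hf

theorem exists_isTreeRotation_addEdge {H : PlaneGraph TreeVertex TreeEdge}
    (he : e ∉ E(doubleTree h))
    (hH : H ∈ Emb (addEdge (doubleTree h) e (Sum.inl x) (Sum.inl y))) :
    ∃ b, IsTreeRotation h (addEdge (doubleTree h) e (Sum.inl x) (Sum.inl y)) H.rot b := by
  have hH' : H.graph = addEdge (doubleTree h) e (Sum.inl x) (Sum.inl y) := hH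
  refine exists_isTreeRotation (finite_vertexSet_addEdge (finite_vertexSet_doubleTree h))
    (finite_edgeSet_addEdge he)
    (fun i c w hw => isLink_addEdge_doubleTree he (isLink_doubleTree i c hw))
    (fun _ _ _ => inc_addEdge_inr he) ?_
  rw [← hH']
  exact H.rot_isCycleOn

theorem leafDarts_addEdge (he : e ∉ E(doubleTree h)) :
    leafDarts (addEdge (doubleTree h) e (Sum.inl x) (Sum.inl y)) =
      insert (Sum.inl x, e) (insert (Sum.inl y, e) (leafDarts (doubleTree h))) := by
  ext ⟨v, f⟩
  simp only [leafDarts, Set.mem_ofPred_eq, inc_addEdge_iff, Set.mem_insert_iff, Prod.mk.injEq]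
  constructor
  · rintro ⟨⟨_, h1⟩ | ⟨rfl, rfl | rfl⟩, w, hw⟩
    · exact Or.inr (Or.inr ⟨h1, w, hw⟩)
    · exact Or.inl ⟨rfl, rfl⟩
    · exact Or.inr (Or.inl ⟨rfl, rfl⟩)
  · rintro (⟨rfl, rfl⟩ | ⟨rfl, rfl⟩ | ⟨h1, w, hw⟩)
    · exact ⟨Or.inr ⟨rfl, Or.inl rfl⟩, x, rfl⟩
    · exact ⟨Or.inr ⟨rfl, Or.inr rfl⟩, y, rfl⟩
    · exact ⟨Or.inl ⟨by rintro rfl; exact he h1.edge_mem, h1⟩, w, hw⟩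

theorem ncard_leafDarts_addEdge (hh : 1 ≤ h) (he : e ∉ E(doubleTree h)) (hxy : x ≠ y) :
    (leafDarts (addEdge (doubleTree h) e (Sum.inl x) (Sum.inl y))).ncard = 2 * 2 ^ h + 2 := by
  have hf := finite_leafDarts (finite_vertexSet_doubleTree h) (finite_edgeSet_doubleTree h)
  have hn : ∀ v, ((v, e) : TreeVertex × TreeEdge) ∉ leafDarts (doubleTree h) :=
    fun v hv => he hv.1.edge_mem
  rw [leafDarts_addEdge he, Set.ncard_insert_of_notMem _ (hf.insert _),
    Set.ncard_insert_of_notMem (hn _) hf, ncard_leafDarts_doubleTree hh]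
  rintro (h1 | h1)
  · exact hxy (Sum.inl_injective (Prod.mk.inj h1).1)
  · exact hn _ h1

/-- The additional edge provides one more face and two more leaf darts. -/
theorem euler_addEdge_iff (hh : 1 ≤ h) (he : e ∉ E(doubleTree h)) (hx : x.length = h)
    (hy : y.length = h) (hxy : x ≠ y) (rot : TreeVertex → Equiv.Perm TreeEdge)
    {Γ : Graph TreeVertex TreeEdge}
    (hΓ : Γ = addEdge (doubleTree h) e (Sum.inl x) (Sum.inl y)) :
    V(Γ).ncard + ((faceSet Γ rot).ncard + (isolatedSet Γ).ncard) =
      E(Γ).ncard + 2 * (componentSet Γ).ncard ↔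
    (leafDarts Γ).ncard = 2 * (faceSet Γ rot).ncard := by
  have hxV : Sum.inl x ∈ V(doubleTree h) := mem_vertexSet_inl.2 hx
  have hyV : Sum.inl y ∈ V(doubleTree h) := mem_vertexSet_inl.2 hy
  have hiso : isolatedSet Γ = ∅ := by
    refine isolatedSet_eq_empty fun v hv => ?_
    rw [hΓ, vertexSet_addEdge hxV hyV] at hv
    obtain ⟨f, u, hf⟩ := exists_inc_doubleTree hh v hv
    exact ⟨f, hΓ ▸ (isLink_addEdge_doubleTree he hf).inc_left⟩
  have h1 := ncard_vertexSet_doubleTree h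
  have h2 := ncard_edgeSet_doubleTree h
  have h3 : E(Γ).ncard = E(doubleTree h).ncard + 1 := by
    rw [hΓ, edgeSet_addEdge he, Set.ncard_insert_of_notMem he (finite_edgeSet_doubleTree h)]
  have h4 : V(Γ) = V(doubleTree h) := by rw [hΓ, vertexSet_addEdge hxV hyV]
  have h5 : (componentSet Γ).ncard = 1 := by
    rw [hΓ, componentSet_addEdge_doubleTree he hxV hyV, Set.ncard_singleton]
  have h6 : (leafDarts Γ).ncard = 2 * 2 ^ h + 2 := by
    rw [hΓ, ncard_leafDarts_addEdge hh he hxy]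
  rw [hiso, Set.ncard_empty, h3, h4, h5, h6]
  omega

theorem setOf_inc_addEdge_end (hh : 1 ≤ h) (he : e ∉ E(doubleTree h)) {l : List Bool}
    (hl : l.length = h) (hlxy : l = x ∨ l = y) :
    {f | (addEdge (doubleTree h) e (Sum.inl x) (Sum.inl y)).Inc f (Sum.inl l)} =
      {(false, l), (true, l), e} := by
  ext f
  simp only [Set.mem_ofPred_eq, inc_addEdge_iff, inc_doubleTree_inl hh, hl, true_and,
    Bool.exists_bool, Sum.inl.injEq, Set.mem_insert_iff, Set.mem_singleton_iff]
  constructor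
  · tauto
  · rintro (rfl | rfl | rfl)
    · refine Or.inl ⟨?_, Or.inl rfl⟩
      rintro rfl
      exact he ((inc_doubleTree_inl hh).2 ⟨hl, false, rfl⟩).edge_mem
    · refine Or.inl ⟨?_, Or.inr rfl⟩
      rintro rfl
      exact he ((inc_doubleTree_inl hh).2 ⟨hl, true, rfl⟩).edge_mem
    · exact Or.inr ⟨rfl, hlxy⟩

theorem firstReturn_edge {rot : TreeVertex → Equiv.Perm TreeEdge} {Γ : Graph TreeVertex TreeEdge}
    {u v : List Bool} (hcyc : ∀ v, (rot v).IsCycleOn {e | Γ.Inc e v})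
    (hlink : Γ.IsLink e (Sum.inl u) (Sum.inl v)) :
    FirstReturn (FaceStep Γ rot) (leafDarts Γ) (Sum.inl u, e) (Sum.inl v, rot (Sum.inl v) e) :=
  ⟨⟨(hcyc _).1.mapsTo (show Γ.Inc e _ from hlink.inc_right), v, rfl⟩, _, .refl, hlink, rfl⟩

theorem hret_addEdge {b : Bool → List Bool → Bool} {rot : TreeVertex → Equiv.Perm TreeEdge}
    {Γ : Graph TreeVertex TreeEdge} (hΓ : Γ = addEdge (doubleTree h) e (Sum.inl x) (Sum.inl y))
    (T : IsTreeRotation h Γ rot b) (hh : 1 ≤ h)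
    (he : e ∉ E(doubleTree h)) (hxy : x ≠ y) :
    ∀ d ∈ leafDarts Γ, ∃ d', d' ≠ d ∧ FirstReturn (FaceStep Γ rot) (leafDarts Γ) d d' := by
  intro d hd
  have hlink : Γ.IsLink e (Sum.inl x) (Sum.inl y) := by
    rw [hΓ]; exact isLink_addEdge_self.2 (Or.inl ⟨rfl, rfl⟩)
  rw [hΓ, leafDarts_addEdge he] at hd
  rcases hd with rfl | rfl | hd
  · exact ⟨_, fun h1 => hxy.symm (Sum.inl_injective (Prod.mk.inj h1).1),
      firstReturn_edge T.isCycleOn hlink⟩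
  · exact ⟨_, fun h1 => hxy (Sum.inl_injective (Prod.mk.inj h1).1),
      firstReturn_edge T.isCycleOn hlink.symm⟩
  · obtain ⟨i, l, hl, rfl⟩ := (mem_leafDarts_doubleTree hh).1 hd
    obtain ⟨l', hl'⟩ := exists_nextLeaf hh (b i) l hl
    exact ⟨_, fun h1 => hl'.ne.symm (Sum.inl_injective (Prod.mk.inj h1).1), T.firstReturn i hl'⟩

/-- In a plane embedding of the double tree with an additional edge between two leaves, these
are consecutive in the orders of both trees. -/
theorem nextLeaf_of_mem_Emb_addEdge (hh : 1 ≤ h) {H : PlaneGraph TreeVertex TreeEdge}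
    (he : e ∉ E(doubleTree h)) (hx : x.length = h) (hy : y.length = h) (hxy : x ≠ y)
    (hH : H ∈ Emb (addEdge (doubleTree h) e (Sum.inl x) (Sum.inl y)))
    {b : Bool → List Bool → Bool} (T : IsTreeRotation h H.graph H.rot b) :
    ∃ i, NextLeaf h (b i) y x ∧ NextLeaf h (b !i) x y := by
  have hH' : H.graph = addEdge (doubleTree h) e (Sum.inl x) (Sum.inl y) := hH
  have hlink : H.graph.IsLink e (Sum.inl x) (Sum.inl y) := by
    rw [hH']; exact isLink_addEdge_self.2 (Or.inl ⟨rfl, rfl⟩)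
  have hcard := (euler_addEdge_iff hh he hx hy hxy H.rot hH').1 H.euler
  have hsymm := fun {d d'} =>
    T.symm_of_card (d := d) (d' := d') (hret_addEdge hH' T hh he hxy) hcard
  have tri : ∀ l : List Bool, l = x ∨ l = y → l.length = h → ∃ i, H.rot (Sum.inl l) e = (i, l) ∧
      H.rot (Sum.inl l) (i, l) = (!i, l) ∧ H.rot (Sum.inl l) (!i, l) = e := by
    intro l hl hlen
    have h1 := H.rot_isCycleOn (Sum.inl l)
    rw [hH', setOf_inc_addEdge_end hh he hlen hl] at h1
    have hne : ∀ i, (i, l) ≠ e := by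
      rintro i rfl
      exact he ((inc_doubleTree_inl hh).2 ⟨hlen, i, rfl⟩).edge_mem
    rcases isCycleOn_triple_apply h1 (by simp) (hne _) (hne _) with ⟨h2, h3, h4⟩ | ⟨h2, h3, h4⟩
    · exact ⟨false, h4, h2, h3⟩
    · exact ⟨true, h3, h4, h2⟩
  obtain ⟨i, hy1, hy2, hy3⟩ := tri y (Or.inr rfl) hy
  obtain ⟨j, hx1, hx2, hx3⟩ := tri x (Or.inl rfl) hx
  -- The walk enters `y` along `e` and returns to `x` through the tree `i`.
  have r1 := firstReturn_edge H.rot_isCycleOn hlink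
  have r2 := hsymm ⟨hlink.inc_left, x, rfl⟩ r1
  rw [hy1] at r2
  obtain ⟨l, hl⟩ := exists_nextLeaf hh (b i) y hy
  have e1 := FirstReturn.rightUnique faceStep_rightUnique r2 (T.firstReturn i hl)
  obtain rfl : x = l := Sum.inl_injective (Prod.mk.inj e1).1
  have hji : j = !i := by
    have h1 := (Prod.mk.inj e1).2.symm
    rw [← hx3] at h1
    have h2 := congrArg Prod.fst ((H.rot _).injective h1)
    simp only at h2
    rw [h2, Bool.not_not]
  refine ⟨i, hl, ?_⟩
  have r3 := firstReturn_edge H.rot_isCycleOn hlink.symm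
  have r4 := hsymm ⟨hlink.inc_right, y, rfl⟩ r3
  rw [hx1, hji] at r4
  obtain ⟨l, hl⟩ := exists_nextLeaf hh (b !i) x hx
  have e2 := FirstReturn.rightUnique faceStep_rightUnique r4 (T.firstReturn (!i) hl)
  obtain rfl : y = l := Sum.inl_injective (Prod.mk.inj e2).1
  exact hl

end Planarity

/-! ### The plane embeddings of the double tree -/

section Embeddings

theorem formPerm_triple_apply {E : Type*} [DecidableEq E] {a b c : E} (hab : a ≠ b) (hac : a ≠ c)
    (hbc : b ≠ c) : [a, b, c].formPerm a = b ∧ [a, b, c].formPerm b = c ∧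
      [a, b, c].formPerm c = a := by
  refine ⟨?_, ?_, ?_⟩ <;> simp [Equiv.swap_apply_def] <;> grind

/-- Bypassing the last one of three elements in a cyclic order. -/
theorem formPerm_pair_eq_last {E : Type*} [DecidableEq E] {a b e : E} (hab : a ≠ b) (hae : a ≠ e)
    (hbe : b ≠ e) :
    [a, b].formPerm = Equiv.swap e ([a, b, e].formPerm e) * [a, b, e].formPerm := by
  rw [(formPerm_triple_apply hab hae hbe).2.2]
  ext z
  simp [Equiv.swap_apply_def]
  grind

/-- Bypassing the middle one of three elements in a cyclic order. -/
theorem formPerm_pair_eq_mid {E : Type*} [DecidableEq E] {a b e : E} (hab : a ≠ b) (hae : a ≠ e)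
    (hbe : b ≠ e) :
    [a, b].formPerm = Equiv.swap e ([a, e, b].formPerm e) * [a, e, b].formPerm := by
  rw [(formPerm_triple_apply hae hab hbe.symm).2.1]
  ext z
  simp [Equiv.swap_apply_def]
  grind

theorem formPerm_triple_rotate {E : Type*} [DecidableEq E] {a b c : E} (hab : a ≠ b) (hac : a ≠ c)
    (hbc : b ≠ c) : [b, c, a].formPerm = [a, b, c].formPerm := by
  have := List.formPerm_rotate_one [a, b, c] (by simp [hab, hac, hbc])
  simpa using this

/-- The edges around the vertices in their circular order: at a leaf `l` this is the list `L l`;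
at the node `w ≠ []` of the tree `i` the order is parent, first child, last child, where the last
child is the one with the bit `β w` in the tree `false`, and the other one in the tree `true`. -/
def rotList (h : ℕ) (L : List Bool → List TreeEdge) (β : List Bool → Bool) :
    TreeVertex → List TreeEdge
  | Sum.inl l => L l
  | Sum.inr (i, w) => if w.length < h then
      if w = [] then [(i, [false]), (i, [true])]
      else [(i, w), (i, (!(i ^^ β w)) :: w), (i, (i ^^ β w) :: w)]
    else []

variable {h : ℕ} {L : List Bool → List TreeEdge} {β : List Bool → Bool}

theorem mem_rotList_inr {f : TreeEdge} {p : Bool × List Bool} :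
    f ∈ rotList h L β (Sum.inr p) ↔ (doubleTree h).Inc f (Sum.inr p) := by
  obtain ⟨i, w⟩ := p
  rw [inc_doubleTree_inr]
  simp only [rotList]
  split_ifs with h1 h2
  · subst h2
    have h1' : 0 < h := h1
    simp [h1']
  · simp only [List.mem_cons, List.not_mem_nil, or_false, h1, ne_eq, h2, not_false_eq_true,
      true_and, Bool.exists_bool]
    cases i <;> cases β w <;> simp <;> tauto
  · simp [h1]

theorem nodup_rotList_inr {p : Bool × List Bool} : (rotList h L β (Sum.inr p)).Nodup := by
  obtain ⟨i, w⟩ := p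
  simp only [rotList]
  split_ifs with h1 h2
  · simp
  · cases i <;> cases β w <;> simp
  · simp

theorem isTreeRotation_rotList {Γ : Graph TreeVertex TreeEdge} (hV : V(Γ).Finite)
    (hE : E(Γ).Finite) (hlink : ∀ i c w, w.length < h →
      Γ.IsLink (i, c :: w) (treeNode h i (c :: w)) (treeNode h i w))
    (hinc : ∀ f i w, Γ.Inc f (Sum.inr (i, w)) ↔ (doubleTree h).Inc f (Sum.inr (i, w)))
    (hL : ∀ l f, f ∈ L l ↔ Γ.Inc f (Sum.inl l)) (hnd : ∀ l, (L l).Nodup) :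
    IsTreeRotation h Γ (fun v => (rotList h L β v).formPerm) (fun i w => i ^^ β w) := by
  refine ⟨hV, hE, hlink, hinc, ?_, ?_, ?_⟩
  · rintro (l | ⟨i, w⟩)
    · have := (hnd l).isCycleOn_formPerm
      simp only [hL] at this
      exact this
    · have := (nodup_rotList_inr (h := h) (L := L) (β := β) (p := (i, w))).isCycleOn_formPerm
      simp only [mem_rotList_inr, ← hinc] at this
      exact this
  · intro i c w hw
    by_cases hne : w = []
    · subst hne
      have hw' : 0 < h := hw
      cases c <;> simp [rotList, hw']
    · have h1 := formPerm_triple_apply (a := ((i, w) : TreeEdge)) (b := (i, (!(i ^^ β w)) :: w))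
        (c := (i, (i ^^ β w) :: w)) (by simp) (by simp) (by simp)
      simp only [rotList, hw, if_true, hne, if_false, ne_eq, not_false_eq_true, true_and]
      split_ifs with hc
      · rw [← hc, h1.2.2]
      · have hc' : c = !(i ^^ β w) := by cases c <;> simp_all
        rw [hc', h1.2.1, Bool.not_not]
  · intro i w hw hne
    have h1 := formPerm_triple_apply (a := ((i, w) : TreeEdge)) (b := (i, (!(i ^^ β w)) :: w))
        (c := (i, (i ^^ β w) :: w)) (by simp) (by simp) (by simp)
    simp only [rotList, hw, if_true, hne, if_false, h1]

theorem NextLeaf.mirror {b : List Bool → Bool} {l l' : List Bool} (hl : NextLeaf h b l l') :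
    NextLeaf h (fun w => !b w) l' l := by
  obtain ⟨c, w, h1, h2, h3⟩ := hl
  exact ⟨!c, w, fun hne => by simp [h1 hne], h3, by simpa using h2⟩

theorem NextLeaf.length_left {b : List Bool → Bool} {l l' : List Bool} (hl : NextLeaf h b l l') :
    l.length = h := by
  obtain ⟨_, _, _, h2, _⟩ := hl
  exact h2.1

theorem NextLeaf.length_right {b : List Bool → Bool} {l l' : List Bool} (hl : NextLeaf h b l l') :
    l'.length = h := by
  obtain ⟨_, _, _, _, h2⟩ := hl
  exact h2.1

theorem nextLeaf_mirror_xor {i : Bool} {l l' : List Bool}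
    (hl : NextLeaf h (fun w => i ^^ β w) l l') : NextLeaf h (fun w => (!i) ^^ β w) l' l := by
  have := hl.mirror
  simpa using this

theorem PlaneGraph.eq_of_graph_of_rot {V E : Type*} {H K : PlaneGraph V E} (h1 : H.graph = K.graph)
    (h2 : H.rot = K.rot) : H = K := by
  cases H
  cases K
  cases h1
  cases h2
  rfl

/-- The order of the edges at the leaves of the double tree. -/
def leafList (h : ℕ) (l : List Bool) : List TreeEdge :=
  if l.length = h then [(false, l), (true, l)] else []

theorem mem_leafList (hh : 1 ≤ h) (l : List Bool) (f : TreeEdge) :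
    f ∈ leafList h l ↔ (doubleTree h).Inc f (Sum.inl l) := by
  rw [inc_doubleTree_inl hh]
  unfold leafList
  split_ifs with hl <;> simp [hl]

theorem nodup_leafList (l : List Bool) : (leafList h l).Nodup := by
  unfold leafList
  split_ifs <;> simp

theorem isTreeRotation_doubleTree (hh : 1 ≤ h) (β : List Bool → Bool) :
    IsTreeRotation h (doubleTree h) (fun v => (rotList h (leafList h) β v).formPerm)
      (fun i w => i ^^ β w) :=
  isTreeRotation_rotList (finite_vertexSet_doubleTree h) (finite_edgeSet_doubleTree h)
    (fun i c _ hw => isLink_doubleTree i c hw) (fun _ _ _ => Iff.rfl) (mem_leafList hh)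
    nodup_leafList

/-- The plane embedding of the double tree in which the node `w ≠ []` has its children in the order
`!β w, β w` in the tree `false`, and in the opposite order in the tree `true`. -/
def treeEmb (hh : 1 ≤ h) (β : List Bool → Bool) : PlaneGraph TreeVertex TreeEdge where
  graph := doubleTree h
  finite_vertexSet := finite_vertexSet_doubleTree h
  finite_edgeSet := finite_edgeSet_doubleTree h
  loopless := ⟨fun _ _ => not_isLink_self_doubleTree⟩
  rot v := (rotList h (leafList h) β v).formPerm
  rot_isCycleOn := (isTreeRotation_doubleTree hh β).isCycleOn
  rot_of_not_inc v e he := by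
    refine List.formPerm_apply_of_notMem fun hmem => he ?_
    rcases v with l | p
    · exact (mem_leafList hh l e).1 hmem
    · exact mem_rotList_inr.1 hmem
  euler := by
    rw [euler_doubleTree_iff hh]
    have T := isTreeRotation_doubleTree hh β
    refine T.card_of_symm (hret_doubleTree T hh) fun d hd d' hdd' => ?_
    obtain ⟨i, l, hl, rfl⟩ := (mem_leafDarts_doubleTree hh).1 hd
    obtain ⟨l', hl'⟩ := exists_nextLeaf hh (fun w => i ^^ β w) l hl
    obtain rfl := FirstReturn.rightUnique faceStep_rightUnique hdd' (T.firstReturn i hl')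
    have h1 := T.firstReturn (!i) (nextLeaf_mirror_xor hl')
    rw [rot_leaf_doubleTree T hh _ hl, Bool.not_not] at h1
    rw [rot_leaf_doubleTree T hh _ hl'.length_right]
    exact h1

theorem treeEmb_mem_Emb (hh : 1 ≤ h) (β : List Bool → Bool) : treeEmb hh β ∈ Emb (doubleTree h) :=
  rfl

/-- Every plane embedding of the double tree is one of the embeddings `treeEmb`. -/
theorem exists_eq_treeEmb (hh : 1 ≤ h) {H : PlaneGraph TreeVertex TreeEdge}
    (hH : H ∈ Emb (doubleTree h)) : ∃ β, H = treeEmb hh β := by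
  have hH' : H.graph = doubleTree h := hH
  obtain ⟨b, T⟩ := exists_isTreeRotation_of_mem_Emb hH
  refine ⟨b false, PlaneGraph.eq_of_graph_of_rot hH' ?_⟩
  have T' := isTreeRotation_doubleTree hh (b false)
  have hb : ∀ i w, w.length < h → w ≠ [] → b i w = (i ^^ b false w) := by
    intro i w hw hne
    cases i
    · simp
    · simpa using mirror_of_mem_Emb hh hH T hw hne
  funext v
  ext1 f
  by_cases hf : (doubleTree h).Inc f v
  · rcases v with l | ⟨i, w⟩
    · obtain ⟨hl, i, rfl⟩ := (inc_doubleTree_inl hh).1 hf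
      rw [rot_leaf_doubleTree T hh i hl]
      exact (rot_leaf_doubleTree T' hh i hl).symm
    · rcases inc_doubleTree_inr.1 hf with ⟨hw, ⟨hne, rfl⟩ | ⟨c, rfl⟩⟩
      · rw [T.rot_parent i w hw hne, hb i w hw hne]
        exact (T'.rot_parent i w hw hne).symm
      · rw [T.rot_child i c w hw]
        refine Eq.trans ?_ (T'.rot_child i c w hw).symm
        by_cases hne : w = []
        · simp [hne]
        · rw [hb i w hw hne]
  · rw [H.rot_of_not_inc v f (by rwa [hH'])]
    exact ((treeEmb hh (b false)).rot_of_not_inc v f hf).symm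

/-- The order of the edges at the leaves of the double tree with an edge `e` from `x` to `y`, in the
case that the leaf `y` follows `x` in the tree `false`. -/
def leafListEdge (h : ℕ) (e : TreeEdge) (x y l : List Bool) : List TreeEdge :=
  if l = x then [(false, l), (true, l), e]
  else if l = y then [(false, l), e, (true, l)]
  else leafList h l

variable {e : TreeEdge} {x y : List Bool}

theorem leaf_edge_ne (hh : 1 ≤ h) (he : e ∉ E(doubleTree h)) {l : List Bool} (hl : l.length = h)
    (i : Bool) : (i, l) ≠ e := by
  rintro rfl
  exact he ((inc_doubleTree_inl hh).2 ⟨hl, i, rfl⟩).edge_mem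

theorem mem_leafListEdge (hh : 1 ≤ h) (he : e ∉ E(doubleTree h)) (hx : x.length = h)
    (hy : y.length = h) (l : List Bool) (f : TreeEdge) :
    f ∈ leafListEdge h e x y l ↔
      (addEdge (doubleTree h) e (Sum.inl x) (Sum.inl y)).Inc f (Sum.inl l) := by
  have key : ∀ {s : Set TreeEdge}, s = {f | (addEdge (doubleTree h) e (Sum.inl x) (Sum.inl y)).Inc f
      (Sum.inl l)} → (f ∈ s ↔ (addEdge (doubleTree h) e (Sum.inl x) (Sum.inl y)).Inc f
      (Sum.inl l)) := by
    rintro s rfl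
    rfl
  unfold leafListEdge
  split_ifs with h1 h2
  · subst h1
    rw [← key (setOf_inc_addEdge_end hh he hx (Or.inl rfl)).symm]
    simp
  · subst h2
    rw [← key (setOf_inc_addEdge_end hh he hy (Or.inr rfl)).symm]
    simp only [List.mem_cons, List.not_mem_nil, or_false, Set.mem_insert_iff,
      Set.mem_singleton_iff]
    tauto
  · rw [mem_leafList hh, inc_addEdge_iff]
    simp only [Sum.inl.injEq, h1, h2, or_self, and_false, or_false]
    exact ⟨fun h => ⟨by rintro rfl; exact he h.edge_mem, h⟩, fun h => h.2⟩

theorem nodup_leafListEdge (hh : 1 ≤ h) (he : e ∉ E(doubleTree h)) (hx : x.length = h)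
    (hy : y.length = h) (l : List Bool) : (leafListEdge h e x y l).Nodup := by
  unfold leafListEdge
  split_ifs with h1 h2
  · subst h1
    simp [leaf_edge_ne hh he hx]
  · subst h2
    simp [leaf_edge_ne hh he hy, (leaf_edge_ne hh he hy _).symm]
  · exact nodup_leafList l

theorem isTreeRotation_addEdge (hh : 1 ≤ h) (he : e ∉ E(doubleTree h)) (hx : x.length = h)
    (hy : y.length = h) (β : List Bool → Bool) :
    IsTreeRotation h (addEdge (doubleTree h) e (Sum.inl x) (Sum.inl y))
      (fun v => (rotList h (leafListEdge h e x y) β v).formPerm) (fun i w => i ^^ β w) :=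
  isTreeRotation_rotList (finite_vertexSet_addEdge (finite_vertexSet_doubleTree h))
    (finite_edgeSet_addEdge he)
    (fun i c _ hw => isLink_addEdge_doubleTree he (isLink_doubleTree i c hw))
    (fun _ _ _ => inc_addEdge_inr he) (mem_leafListEdge hh he hx hy)
    (nodup_leafListEdge hh he hx hy)

theorem rot_leafListEdge (hh : 1 ≤ h) (he : e ∉ E(doubleTree h)) (hx : x.length = h)
    (hy : y.length = h) (hxy : x ≠ y) {l : List Bool} (hl : l.length = h) :
    ((leafListEdge h e x y l).formPerm (false, l) = if l = y then e else (true, l)) ∧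
    ((leafListEdge h e x y l).formPerm (true, l) = if l = x then e else (false, l)) ∧
    ((leafListEdge h e x y x).formPerm e = (false, x)) ∧
    ((leafListEdge h e x y y).formPerm e = (true, y)) := by
  have h1 := leaf_edge_ne hh he hl
  have tx := formPerm_triple_apply (show ((false, x) : TreeEdge) ≠ (true, x) by simp)
    (leaf_edge_ne hh he hx false) (leaf_edge_ne hh he hx true)
  have ty := formPerm_triple_apply (leaf_edge_ne hh he hy false)
    (show ((false, y) : TreeEdge) ≠ (true, y) by simp) (leaf_edge_ne hh he hy true).symm
  have ex : leafListEdge h e x y x = [(false, x), (true, x), e] := if_pos rfl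
  have ey : leafListEdge h e x y y = [(false, y), e, (true, y)] := by
    simp [leafListEdge, hxy.symm]
  rw [ex, ey]
  refine ⟨?_, ?_, tx.2.2, ty.2.1⟩
  · by_cases hlx : l = x
    · subst hlx
      rw [ex, if_neg hxy]
      exact tx.1
    by_cases hly : l = y
    · subst hly
      rw [ey, if_pos rfl]
      exact ty.1
    simp [leafListEdge, leafList, hlx, hly, hl]
  · by_cases hlx : l = x
    · subst hlx
      rw [ex, if_pos rfl]
      exact tx.2.1
    by_cases hly : l = y
    · subst hly
      rw [ey, if_neg hxy.symm]
      exact ty.2.2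
    simp [leafListEdge, leafList, hlx, hly, hl]

/-- The plane embedding of the double tree with an edge from `x` to `y`, where `y` follows `x`. -/
def edgeEmb (hh : 1 ≤ h) (he : e ∉ E(doubleTree h)) (hxy : NextLeaf h β x y) :
    PlaneGraph TreeVertex TreeEdge where
  graph := addEdge (doubleTree h) e (Sum.inl x) (Sum.inl y)
  finite_vertexSet := finite_vertexSet_addEdge (finite_vertexSet_doubleTree h)
  finite_edgeSet := finite_edgeSet_addEdge he
  loopless := by
    refine ⟨fun f v hf => ?_⟩
    by_cases hfe : f = e
    · subst hfe
      rcases isLink_addEdge_self.1 hf with ⟨h1, h2⟩ | ⟨h1, h2⟩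
      · exact hxy.ne (Sum.inl_injective (h1.symm.trans h2))
      · exact hxy.ne (Sum.inl_injective (h2.symm.trans h1))
    · exact not_isLink_self_doubleTree ((isLink_addEdge_of_ne hfe).1 hf)
  rot v := (rotList h (leafListEdge h e x y) β v).formPerm
  rot_isCycleOn :=
    (isTreeRotation_addEdge hh he hxy.length_left hxy.length_right β).isCycleOn
  rot_of_not_inc v f hf := by
    refine List.formPerm_apply_of_notMem fun hmem => hf ?_
    rcases v with l | p
    · exact (mem_leafListEdge hh he hxy.length_left hxy.length_right l f).1 hmem
    · exact (inc_addEdge_inr he).2 (mem_rotList_inr.1 hmem)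
  euler := by
    have hx := hxy.length_left
    have hy := hxy.length_right
    rw [euler_addEdge_iff hh he hx hy hxy.ne _ rfl]
    have T := isTreeRotation_addEdge hh he hx hy β
    have ru := FirstReturn.rightUnique (D := leafDarts
      (addEdge (doubleTree h) e (Sum.inl x) (Sum.inl y)))
      (faceStep_rightUnique (G := addEdge (doubleTree h) e (Sum.inl x) (Sum.inl y))
        (rot' := fun v => (rotList h (leafListEdge h e x y) β v).formPerm))
    -- The leaf that follows a given one is unique.
    have nu : ∀ {i l l₁ l₂}, NextLeaf h (fun w => i ^^ β w) l l₁ →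
        NextLeaf h (fun w => i ^^ β w) l l₂ → l₁ = l₂ := fun h1 h2 =>
      Sum.inl_injective (Prod.mk.inj (ru (T.firstReturn _ h1) (T.firstReturn _ h2))).1
    have hlink : (addEdge (doubleTree h) e (Sum.inl x) (Sum.inl y)).IsLink e
        (Sum.inl x) (Sum.inl y) := isLink_addEdge_self.2 (Or.inl ⟨rfl, rfl⟩)
    have rl := fun {l : List Bool} (hl : l.length = h) => rot_leafListEdge hh he hx hy hxy.ne hl
    have nf : NextLeaf h (fun w => false ^^ β w) x y := by simpa using hxy
    have nt : NextLeaf h (fun w => true ^^ β w) y x := nextLeaf_mirror_xor nf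
    have r1 := firstReturn_edge T.isCycleOn hlink
    have r2 := firstReturn_edge T.isCycleOn hlink.symm
    have r3 := T.firstReturn false nf
    have r4 := T.firstReturn true nt
    simp only [rotList, (rl hx).2.1, (rl hx).2.2.1, (rl hy).2.2.2, (rl hy).1,
      if_true] at r1 r2 r3 r4
    -- The face on one side of `e` runs along `e` and back through one tree, that on the other side
    -- through the other tree; all other faces are faces of the double tree.
    refine T.card_of_symm (hret_addEdge rfl T hh he hxy.ne) fun d hd d' hdd' => ?_
    suffices hs : ∃ d₁, FirstReturn (FaceStep _ _) _ d d₁ ∧ FirstReturn (FaceStep _ _) _ d₁ d by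
      obtain ⟨d₁, hs1, hs2⟩ := hs
      obtain rfl := ru hdd' hs1
      exact hs2
    rw [leafDarts_addEdge he] at hd
    rcases hd with rfl | rfl | hd
    · exact ⟨_, r1, r4⟩
    · exact ⟨_, r2, r3⟩
    obtain ⟨i, l, hl, rfl⟩ := (mem_leafDarts_doubleTree hh).1 hd
    obtain ⟨l', hl'⟩ := exists_nextLeaf hh (fun w => i ^^ β w) l hl
    cases i
    · by_cases hlx : l = x
      · subst hlx
        exact ⟨_, r3, r2⟩
      have hb := nextLeaf_mirror_xor hl'
      have hly' : l' ≠ y := by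
        rintro rfl
        exact hlx (nu hb nt)
      have s1 := T.firstReturn false hl'
      have s2 := T.firstReturn true hb
      simp only [rotList, (rl hl'.length_right).1, (rl hl).2.1, hly', hlx, if_false] at s1 s2
      exact ⟨_, s1, s2⟩
    · by_cases hly : l = y
      · subst hly
        exact ⟨_, r4, r1⟩
      have hb := nextLeaf_mirror_xor hl'
      have hlx' : l' ≠ x := by
        rintro rfl
        exact hly (nu hb nf)
      have s1 := T.firstReturn true hl'
      have s2 := T.firstReturn false hb
      simp only [rotList, (rl hl'.length_right).2.1, (rl hl).1, hlx', hly, if_false] at s1 s2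
      exact ⟨_, s1, s2⟩

theorem edgeEmb_mem_Emb (hh : 1 ≤ h) (he : e ∉ E(doubleTree h)) (hxy : NextLeaf h β x y) :
    edgeEmb hh he hxy ∈ Emb (addEdge (doubleTree h) e (Sum.inl x) (Sum.inl y)) :=
  rfl

theorem deleteEdges_addEdge {V E : Type*} {G : Graph V E} {e : E} {x y : V} (he : e ∉ E(G))
    (hx : x ∈ V(G)) (hy : y ∈ V(G)) : (addEdge G e x y).deleteEdges {e} = G := by
  refine Graph.ext ?_ fun f u v => ?_
  · exact vertexSet_addEdge (e := e) hx hy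
  · rw [Graph.deleteEdges_isLink]
    by_cases hf : f = e
    · subst hf
      simp only [Set.mem_singleton_iff, not_true_eq_false, and_false, false_iff]
      exact fun h => he h.edge_mem
    · simp [isLink_addEdge_of_ne hf, hf]

theorem isDeletion_edgeEmb (hh : 1 ≤ h) (he : e ∉ E(doubleTree h)) (hxy : NextLeaf h β x y) :
    IsDeletion (edgeEmb hh he hxy) e (treeEmb hh β) := by
  have hx := hxy.length_left
  have hy := hxy.length_right
  refine ⟨?_, ?_, ?_⟩
  · exact (isLink_addEdge_self.2 (Or.inl ⟨rfl, rfl⟩) :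
      (addEdge (doubleTree h) e (Sum.inl x) (Sum.inl y)).IsLink e _ _).edge_mem
  · exact (deleteEdges_addEdge he (mem_vertexSet_inl.2 hx) (mem_vertexSet_inl.2 hy)).symm
  · intro v
    have same : rotList h (leafList h) β v = rotList h (leafListEdge h e x y) β v →
        (treeEmb hh β).rot v = Equiv.swap e ((edgeEmb hh he hxy).rot v e) *
          (edgeEmb hh he hxy).rot v := by
      intro heq
      have h1 : (edgeEmb hh he hxy).rot v = (treeEmb hh β).rot v := congrArg List.formPerm heq.symm
      have h2 : (treeEmb hh β).rot v e = e :=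
        (treeEmb hh β).rot_of_not_inc v e fun h => he h.edge_mem
      rw [h1, h2, Equiv.swap_self]
      rfl
    rcases v with l | p
    · by_cases hlx : l = x
      · subst hlx
        simp only [treeEmb, edgeEmb, rotList, leafList, leafListEdge, hx, if_true]
        exact formPerm_pair_eq_last (by simp) (leaf_edge_ne hh he hx _) (leaf_edge_ne hh he hx _)
      by_cases hly : l = y
      · subst hly
        simp only [treeEmb, edgeEmb, rotList, leafList, leafListEdge, hy, if_true, hlx, if_false]
        exact formPerm_pair_eq_mid (by simp) (leaf_edge_ne hh he hy _) (leaf_edge_ne hh he hy _)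
      exact same (by simp [rotList, leafListEdge, hlx, hly])
    · exact same rfl

end Embeddings

/-! ### Slides exchanging the two subtrees of a node -/

section Slides

variable {h : ℕ}

/-- The edges of the two trees in the subtrees of the node `v`, together with the edges from `v` to
its parents. -/
def branchEdges (h : ℕ) (v : List Bool) : Set TreeEdge :=
  {f | v <:+ f.2 ∧ f.2.length ≤ h}

theorem branchEdges_connected (hh : 1 ≤ h) {v : List Bool} (hne : v ≠ []) (hv : v.length ≤ h) :
    ∀ e ∈ branchEdges h v, ∀ f ∈ branchEdges h v, Relation.ReflTransGen (fun e' f' =>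
      f' ∈ branchEdges h v ∧ ∃ u, (doubleTree h).Inc e' u ∧ (doubleTree h).Inc f' u) e f := by
  set R : TreeEdge → TreeEdge → Prop := fun e' f' => e' ∈ branchEdges h v ∧ f' ∈ branchEdges h v ∧
    ∃ u, (doubleTree h).Inc e' u ∧ (doubleTree h).Inc f' u with hR
  have symm : ∀ {a b}, Relation.ReflTransGen R a b → Relation.ReflTransGen R b a := by
    intro a b hab
    induction hab with
    | refl => exact .refl
    | tail _ h2 ih =>
      obtain ⟨h3, h4, u, h5, h6⟩ := h2
      exact .head ⟨h4, h3, u, h6, h5⟩ ih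
  have up : ∀ (i : Bool) (t : List Bool), (t ++ v).length ≤ h →
      Relation.ReflTransGen R (i, t ++ v) (i, v) := by
    intro i t
    induction t with
    | nil => exact fun _ => .refl
    | cons c t ih =>
      intro hlen
      have hlt : (t ++ v).length < h := by simp at hlen ⊢; omega
      have htv : t ++ v ≠ [] := by simp [hne]
      refine .head ⟨⟨⟨c :: t, rfl⟩, hlen⟩, ⟨⟨t, rfl⟩, hlt.le⟩, Sum.inr (i, t ++ v), ?_, ?_⟩
        (ih hlt.le)
      · exact inc_doubleTree_inr.2 ⟨hlt, Or.inr ⟨c, rfl⟩⟩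
      · exact inc_doubleTree_inr.2 ⟨hlt, Or.inl ⟨htv, rfl⟩⟩
  -- The two trees are connected through any leaf.
  have across : Relation.ReflTransGen R (false, v) (true, v) := by
    obtain ⟨l, hl⟩ := exists_endLeaf h (fun _ => true) v hv
    obtain ⟨t, rfl⟩ := hl.2.1
    refine (symm (up false t hl.1.le)).trans (.head ?_ (up true t hl.1.le))
    exact ⟨⟨⟨t, rfl⟩, hl.1.le⟩, ⟨⟨t, rfl⟩, hl.1.le⟩, Sum.inl (t ++ v),
      (inc_doubleTree_inl hh).2 ⟨hl.1, _, rfl⟩, (inc_doubleTree_inl hh).2 ⟨hl.1, _, rfl⟩⟩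
  have top : ∀ i j, Relation.ReflTransGen R (i, v) (j, v) := by
    intro i j
    cases i <;> cases j
    · exact .refl
    · exact across
    · exact symm across
    · exact .refl
  rintro ⟨i, a⟩ ⟨⟨t, ht⟩, ha⟩ ⟨j, b⟩ ⟨⟨t', ht'⟩, hb⟩
  simp only at ht ht' ha hb
  subst ht ht'
  exact Relation.ReflTransGen.mono (fun _ _ h => h.2) _ _
    ((up i t ha).trans ((top i j).trans (symm (up j t' hb))))

theorem isSeparated_branchEdges (hh : 1 ≤ h) (c : Bool) {w : List Bool} (hw : w.length < h) :
    IsSeparated (doubleTree h) (branchEdges h (c :: w)) (Sum.inr (false, w))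
      (Sum.inr (true, w)) where
  left_mem := mem_vertexSet_inr.2 hw
  right_mem := mem_vertexSet_inr.2 hw
  nonempty := ⟨(true, c :: w), List.suffix_rfl, hw⟩
  subset := by
    rintro ⟨i, u⟩ ⟨h1, h2⟩
    simp only at h1 h2
    obtain ⟨b, u, rfl⟩ := List.exists_cons_of_ne_nil (l := u) (by
      rintro rfl
      have := h1.length_le
      simp at this)
    exact mem_edgeSet_doubleTree.2 ⟨i, b, u, h2, rfl⟩
  connected := branchEdges_connected hh (by simp) hw
  separated := by
    rintro (l | ⟨i, u⟩) e f he hf hev hfv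
    · obtain ⟨_, j, rfl⟩ := (inc_doubleTree_inl hh).1 hev
      obtain ⟨_, j', rfl⟩ := (inc_doubleTree_inl hh).1 hfv
      exact absurd he hf
    · obtain ⟨hu, he'⟩ := inc_doubleTree_inr.1 hev
      obtain ⟨_, hf'⟩ := inc_doubleTree_inr.1 hfv
      have huw : u = w := by
        by_cases hs : c :: w <:+ u
        · exfalso
          rcases hf' with ⟨_, rfl⟩ | ⟨d, rfl⟩
          · exact hf ⟨hs, hu.le⟩
          · exact hf ⟨hs.trans (List.suffix_cons _ _), hu⟩
        · rcases he' with ⟨_, rfl⟩ | ⟨d, rfl⟩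
          · exact absurd he.1 hs
          · rcases List.suffix_cons_iff.1 he.1 with h1 | h1
            · exact (List.cons.inj h1).2.symm
            · exact absurd h1 hs
      subst huw
      cases i
      · exact Or.inl rfl
      · exact Or.inr rfl

/-- Exchanging the two subtrees of the node `w ≠ []` is a slide. -/
theorem isSlide_treeEmb (hh : 1 ≤ h) {β β' : List Bool → Bool} {w : List Bool} (hw : w.length < h)
    (hne : w ≠ []) (h1 : β' w = !β w) (h2 : ∀ v, v ≠ w → β' v = β v) :
    IsSlide (treeEmb hh β) (treeEmb hh β') := by
  refine ⟨rfl, branchEdges h (true :: w), Sum.inr (false, w), Sum.inr (true, w),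
    isSeparated_branchEdges hh true hw, ?_, ?_⟩
  · have key : ∀ i, ∃ a b b', IsCutAt (treeEmb hh β) (branchEdges h (true :: w)) (Sum.inr (i, w))
        a b ∧ b'.IsRotated b ∧ (treeEmb hh β').rot (Sum.inr (i, w)) = (a ++ b').formPerm := by
      intro i
      have hT : (i, true :: w) ∈ branchEdges h (true :: w) := ⟨List.suffix_rfl, hw⟩
      have hF : (i, false :: w) ∉ branchEdges h (true :: w) := by
        rintro ⟨hs, _⟩
        have := hs.eq_of_length (by simp)
        simp at this
      have hP : (i, w) ∉ branchEdges h (true :: w) := by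
        rintro ⟨hs, _⟩
        have := hs.length_le
        simp at this
      have hinc : ∀ f, (doubleTree h).Inc f (Sum.inr (i, w)) ↔
          f = (i, w) ∨ f = (i, false :: w) ∨ f = (i, true :: w) := fun f =>
        Set.ext_iff.1 (setOf_inc_node hw hne) f
      have ha : ∀ f, f ∈ [((i, true :: w) : TreeEdge)] ↔
          f ∈ branchEdges h (true :: w) ∧ (doubleTree h).Inc f (Sum.inr (i, w)) := by
        intro f
        rw [hinc, List.mem_singleton]
        constructor
        · rintro rfl
          exact ⟨hT, Or.inr (Or.inr rfl)⟩
        · rintro ⟨h3, rfl | rfl | rfl⟩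
          · exact absurd h3 hP
          · exact absurd h3 hF
          · rfl
      have hb : ∀ f, f ∈ [((i, w) : TreeEdge), (i, false :: w)] ↔
          f ∉ branchEdges h (true :: w) ∧ (doubleTree h).Inc f (Sum.inr (i, w)) := by
        intro f
        rw [hinc]
        simp only [List.mem_cons, List.not_mem_nil, or_false]
        constructor
        · rintro (rfl | rfl)
          · exact ⟨hP, Or.inl rfl⟩
          · exact ⟨hF, Or.inr (Or.inl rfl)⟩
        · rintro ⟨h3, rfl | rfl | rfl⟩
          · exact Or.inl rfl
          · exact Or.inr rfl
          · exact absurd hT h3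
      have r : ∀ β : List Bool → Bool, (treeEmb hh β).rot (Sum.inr (i, w)) =
          if i ^^ β w then [((i, true :: w) : TreeEdge), (i, w), (i, false :: w)].formPerm
          else [((i, true :: w) : TreeEdge), (i, false :: w), (i, w)].formPerm := by
        intro β
        simp only [treeEmb, rotList, hw, if_true, hne, if_false]
        cases i ^^ β w
        · exact (formPerm_triple_rotate (by simp) (by simp) (by simp)).symm
        · exact formPerm_triple_rotate (by simp) (by simp) (by simp)
      have hrot : [((i, w) : TreeEdge), (i, false :: w)].IsRotated [(i, false :: w), (i, w)] :=
        ⟨1, rfl⟩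
      have hb' : ∀ f, f ∈ [((i, false :: w) : TreeEdge), (i, w)] ↔
          f ∉ branchEdges h (true :: w) ∧ (doubleTree h).Inc f (Sum.inr (i, w)) := fun f => by
        rw [← hb, hrot.mem_iff]
      have r1 := r β
      have r2 := r β'
      rw [h1] at r2
      cases hiw : i ^^ β w
      · have hiw' : (i ^^ !β w) = true := by simpa using hiw
        simp only [hiw, hiw', if_true, Bool.false_eq_true, if_false] at r1 r2
        exact ⟨_, _, _, ⟨by simp, ha, hb', r1⟩, hrot, r2⟩
      · have hiw' : (i ^^ !β w) = false := by simpa using hiw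
        simp only [hiw, hiw', if_true, Bool.false_eq_true, if_false] at r1 r2
        exact ⟨_, _, _, ⟨by simp, ha, hb, r1⟩, hrot.symm, r2⟩
    rintro v (rfl | rfl)
    · exact key false
    · exact key true
  · rintro (l | ⟨i, u⟩) hs ht
    · rfl
    · have huw : u ≠ w := by
        rintro rfl
        cases i
        · exact hs rfl
        · exact ht rfl
      simp only [treeEmb, rotList, h2 u huw]

theorem edist_treeEmb_le_one (hh : 1 ≤ h) {β β' : List Bool → Bool} {w : List Bool}
    (hw : w.length < h) (hne : w ≠ []) (h1 : β' w = !β w) (h2 : ∀ v, v ≠ w → β' v = β v) :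
    (pureFlipGraph TreeVertex TreeEdge).edist (treeEmb hh β) (treeEmb hh β') ≤ 1 := by
  by_cases heq : treeEmb hh β = treeEmb hh β'
  · rw [heq, SimpleGraph.edist_self]
    exact zero_le
  · have hadj : (pureFlipGraph TreeVertex TreeEdge).Adj (treeEmb hh β) (treeEmb hh β') := by
      rw [pureFlipGraph, SimpleGraph.fromRel_adj]
      exact ⟨heq, Or.inl (Or.inr (isSlide_treeEmb hh hw hne h1 h2))⟩
    exact (SimpleGraph.edist_le hadj.toWalk).trans (by simp)

/-- Of the rule `β`, the value at one node `Z k` of each depth `k = 1, …, m` is negated. -/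
def flipRule (β : List Bool → Bool) (Z : ℕ → List Bool) (m : ℕ) (v : List Bool) : Bool :=
  if v ≠ [] ∧ v.length ≤ m ∧ v = Z v.length then !β v else β v

/-- One slide for each depth. -/
theorem edist_flipRule_le (hh : 1 ≤ h) (β : List Bool → Bool) (Z : ℕ → List Bool) (m : ℕ)
    (hm : m < h) : (pureFlipGraph TreeVertex TreeEdge).edist (treeEmb hh β)
      (treeEmb hh (flipRule β Z m)) ≤ m := by
  induction m with
  | zero =>
    have : flipRule β Z 0 = β := by
      funext v
      refine if_neg ?_
      rintro ⟨h1, h2, _⟩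
      exact h1 (List.length_eq_zero_iff.1 (by omega))
    rw [this, SimpleGraph.edist_self]
    exact zero_le
  | succ m ih =>
    refine SimpleGraph.edist_triangle.trans
      ((add_le_add (ih (by omega)) (?_ : _ ≤ (1 : ℕ∞))).trans (by simp))
    by_cases hZ : (Z (m + 1)).length = m + 1
    · refine edist_treeEmb_le_one hh (w := Z (m + 1)) (by omega) (by rintro h1; simp [h1] at hZ)
        ?_ ?_
      · have hne : Z (m + 1) ≠ [] := by rintro h1; simp [h1] at hZ
        simp [flipRule, hZ, hne]
      · intro v hv
        unfold flipRule
        refine if_congr ?_ rfl rfl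
        constructor
        · rintro ⟨h1, h2, h3⟩
          refine ⟨h1, ?_, h3⟩
          by_contra hlt
          have h4 : v.length = m + 1 := by omega
          rw [h4] at h3
          exact hv h3
        · rintro ⟨h1, h2, h3⟩
          exact ⟨h1, by omega, h3⟩
    · have : flipRule β Z (m + 1) = flipRule β Z m := by
        funext v
        unfold flipRule
        refine if_congr ?_ rfl rfl
        constructor
        · rintro ⟨h1, h2, h3⟩
          refine ⟨h1, ?_, h3⟩
          by_contra hlt
          have h4 : v.length = m + 1 := by omega
          rw [h4] at h3
          exact hZ (h3 ▸ h4)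
        · rintro ⟨h1, h2, h3⟩
          exact ⟨h1, by omega, h3⟩
      rw [this, SimpleGraph.edist_self]
      exact zero_le

end Slides

/-! ### Choosing the two leaves -/

section Choice

variable {h : ℕ}

/-- The rule that agrees with `β` at nodes of odd depth and differs from it at nodes of even
depth. -/
def zigzag (β : List Bool → Bool) (v : List Bool) : Bool :=
  if Odd v.length then β v else !β v

/-- After the negation of `h - 1` values of `β`, one at each depth, the zigzag leaves `x` and `y` in
the two subtrees of the root become consecutive. -/
theorem nextLeaf_flipRule {β : List Bool → Bool} {x y : List Bool}
    (hx : EndLeaf h (zigzag β) [true] x) (hy : EndLeaf h (zigzag β) [false] y) :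
    NextLeaf h (flipRule β (fun k => if Odd k then y.drop (h - k) else x.drop (h - k)) (h - 1))
      x y := by
  have hdrop : ∀ {l v : List Bool} {c : Bool}, l.length = h → c :: v <:+ l →
      v = l.drop (h - v.length) := by
    intro l v c hl hs
    have := List.suffix_iff_eq_drop.1 ((List.suffix_cons _ _).trans hs)
    rwa [hl] at this
  have hdiff : ∀ v, [true] <:+ v → v <:+ y → False := by
    intro v h1 h2
    have := not_cons_suffix_and (h1.trans h2) hy.2.1
    simp at this
  have hdiff' : ∀ v, [false] <:+ v → v <:+ x → False := by
    intro v h1 h2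
    have := not_cons_suffix_and (h1.trans h2) hx.2.1
    simp at this
  refine ⟨true, [], fun h => absurd rfl h, ⟨hx.1, hx.2.1, fun c v hc hv => ?_⟩,
    ⟨hy.1, hy.2.1, fun c v hc hv => ?_⟩⟩
  · have h1 := hx.2.2 c v hc hv
    have hne : v ≠ [] := by rintro rfl; simp at hv
    have hlen : v.length ≤ h - 1 := by have := hc.length_le; have := hx.1; simp at *; omega
    have h2 := hdrop hx.1 hc
    rw [h1]
    by_cases ho : Odd v.length <;> simp only [zigzag, flipRule, ho, if_true, if_false]
    · rw [if_neg]
      rintro ⟨_, _, h3⟩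
      exact hdiff v hv (List.suffix_iff_eq_drop.2 (by rwa [hy.1]))
    · rw [if_pos ⟨hne, hlen, h2⟩]
  · have h1 := hy.2.2 c v hc hv
    have hne : v ≠ [] := by rintro rfl; simp at hv
    have hlen : v.length ≤ h - 1 := by have := hc.length_le; have := hy.1; simp at *; omega
    have h2 := hdrop hy.1 hc
    rw [h1]
    by_cases ho : Odd v.length <;> simp only [zigzag, flipRule, ho, if_true, if_false]
    · rw [if_pos ⟨hne, hlen, h2⟩, Bool.not_not]
    · rw [if_neg]
      rintro ⟨_, _, h3⟩
      exact hdiff' v hv (List.suffix_iff_eq_drop.2 (by rwa [hx.1]))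

/-- Any two leaves are consecutive in some plane embedding. -/
theorem exists_nextLeaf_rule {x y : List Bool} (hx : x.length = h) (hy : y.length = h)
    (hxy : x ≠ y) : ∃ β, NextLeaf h β x y := by
  have hbranch : ∀ (x y : List Bool), x.length = y.length → x ≠ y →
      ∃ c w, c :: w <:+ x ∧ (!c) :: w <:+ y := by
    intro x
    induction x with
    | nil => intro y h1 h2; exact absurd (List.length_eq_zero_iff.1 h1.symm).symm h2
    | cons a x ih =>
      rintro (_ | ⟨b, y⟩) h1 h2
      · simp at h1
      · by_cases hxy : x = y
        · subst hxy
          have : b = !a := by cases a <;> cases b <;> simp_all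
          exact ⟨a, x, List.suffix_rfl, by rw [this]⟩
        · obtain ⟨c, w, h3, h4⟩ := ih y (by simpa using h1) hxy
          exact ⟨c, w, h3.trans (List.suffix_cons _ _), h4.trans (List.suffix_cons _ _)⟩
  obtain ⟨c, w, h1, h2⟩ := hbranch x y (hx.trans hy.symm) hxy
  -- Towards `x` the rule follows `x`, and elsewhere it negates `y`; at the branching node `w` it
  -- makes the subtree with `y` the last one.
  refine ⟨fun v => if c :: w <:+ v then decide (true :: v <:+ x) else if v = w then !c else
    !decide (true :: v <:+ y), c, w, fun _ => ?_, ⟨hx, h1, fun d v hd hv => ?_⟩,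
    ⟨hy, h2, fun d v hd hv => ?_⟩⟩
  · have : ¬ c :: w <:+ w := fun h => by simpa using h.length_le
    simp [this]
  · simp only [hv, if_true]
    cases d
    · have : ¬ true :: v <:+ x := fun h => by simpa using not_cons_suffix_and h hd
      simp [this]
    · simp [hd]
  · have h3 : ¬ c :: w <:+ v := fun h => by
      simpa using not_cons_suffix_and (h.trans ((List.suffix_cons _ _).trans hd)) h2
    have h4 : v ≠ w := by
      rintro rfl
      simpa using hv.length_le
    simp only [h3, if_false, h4, Bool.not_not]
    cases d
    · have : ¬ true :: v <:+ y := fun h => by simpa using not_cons_suffix_and h hd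
      simp [this]
    · simp [hd]

end Choice

/-! ### The nodes along the paths to the two leaves -/

section PathNodes

variable {h : ℕ} {l x y u : List Bool} {γ : List Bool → Bool}

theorem length_drop_sub {k : ℕ} (hl : l.length = h) (hk : k ≤ h) : (l.drop (h - k)).length = k := by
  rw [List.length_drop, hl]; omega

theorem EndLeaf.cons_drop_suffix {a : Bool} (hl : EndLeaf h γ [a] l) {k : ℕ} (hk1 : 1 ≤ k)
    (hk : k < h) : [a] <:+ l.drop (h - k) ∧ γ (l.drop (h - k)) :: l.drop (h - k) <:+ l := by
  have h1 : [a] <:+ l.drop (h - k) :=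
    List.suffix_of_suffix_length_le hl.2.1 (List.drop_suffix _ _)
      (by rw [length_drop_sub hl.1 hk.le]; simpa using hk1)
  have hlt : h - (k + 1) < l.length := by rw [hl.1]; omega
  have h2 := List.drop_eq_getElem_cons hlt
  rw [show h - (k + 1) + 1 = h - k by omega] at h2
  have h3 : l[h - (k + 1)] :: l.drop (h - k) <:+ l := by rw [← h2]; exact List.drop_suffix _ _
  exact ⟨h1, by rwa [hl.2.2 _ _ h3 h1] at h3⟩

/-- The length of the longest common suffix of `u` and the leaf `l`, but at most `h - 1`. -/
def sufLen (h : ℕ) (l u : List Bool) : ℕ :=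
  Nat.findGreatest (fun k => l.drop (h - k) <:+ u) (h - 1)

/-- A node that branches off from the path to `l` at depth `k` shares exactly `k` steps with it. -/
theorem sufLen_eq {k : ℕ} {c : Bool} (hl : l.length = h) (hk : k < h)
    (hc : c :: l.drop (h - k) <:+ l)
    (hu : u = l.drop (h - k) ∨ (!c) :: l.drop (h - k) <:+ u) : sufLen h l u = k := by
  unfold sufLen
  rw [Nat.findGreatest_eq_iff]
  refine ⟨by omega, fun _ => ?_, fun n hn hn' hs => ?_⟩
  · rcases hu with rfl | hu
    · exact List.suffix_rfl
    · exact (List.suffix_cons _ _).trans hu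
  · have h1 := length_drop_sub hl (show n ≤ h by omega)
    have h2 := length_drop_sub hl (show k ≤ h by omega)
    rcases hu with rfl | hu
    · have := hs.length_le
      omega
    · have h3 : c :: l.drop (h - k) <:+ l.drop (h - n) :=
        List.suffix_of_suffix_length_le hc (List.drop_suffix _ _)
          (by simp only [List.length_cons]; omega)
      have := not_cons_suffix_and (h3.trans hs) hu
      simp at this

/-- The position of a node along the path from the leaf `x` to the leaf `y`: the node of this path
at which one has to branch off is the one with this number, if the inner nodes of the path other
than the root are numbered from `0` to `2 * h - 3`. -/
def nodePos (h : ℕ) (x y u : List Bool) : ℕ :=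
  if [true] <:+ u then h - 1 - sufLen h x u else h - 2 + sufLen h y u

/-- The node number `n` of the path from the leaf `x` to the leaf `y`. -/
def pathNode (h : ℕ) (x y : List Bool) (n : ℕ) : List Bool :=
  if n + 1 < h then x.drop (h - (h - 1 - n)) else y.drop (h - (n + 2 - h))

variable {β : List Bool → Bool} {n : ℕ}

/-- The path node number `n`, and everything below its child that is not on the path, has the
position `n`. -/
theorem pathNode_spec (hx : EndLeaf h γ [true] x) (hy : EndLeaf h γ [false] y)
    (hn : n < 2 * (h - 1)) :
    pathNode h x y n ≠ [] ∧ (pathNode h x y n).length < h ∧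
      ∀ u, (u = pathNode h x y n ∨ (!γ (pathNode h x y n)) :: pathNode h x y n <:+ u) →
        nodePos h x y u = n := by
  unfold pathNode
  split_ifs with hlt
  · have h1 := length_drop_sub hx.1 (show h - 1 - n ≤ h by omega)
    obtain ⟨h2, h3⟩ := hx.cons_drop_suffix (k := h - 1 - n) (by omega) (by omega)
    refine ⟨by rintro h0; rw [h0] at h1; simp at h1; omega, by omega, fun u hu => ?_⟩
    have h4 : [true] <:+ u := by
      rcases hu with rfl | hu
      · exact h2
      · exact h2.trans ((List.suffix_cons _ _).trans hu)
    rw [nodePos, if_pos h4, sufLen_eq hx.1 (by omega) h3 hu]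
    omega
  · have h1 := length_drop_sub hy.1 (show n + 2 - h ≤ h by omega)
    obtain ⟨h2, h3⟩ := hy.cons_drop_suffix (k := n + 2 - h) (by omega) (by omega)
    refine ⟨by rintro h0; rw [h0] at h1; simp at h1; omega, by omega, fun u hu => ?_⟩
    have h4 : [false] <:+ u := by
      rcases hu with rfl | hu
      · exact h2
      · exact h2.trans ((List.suffix_cons _ _).trans hu)
    have h5 : ¬ [true] <:+ u := fun h => by simpa using not_cons_suffix_and h h4
    rw [nodePos, if_neg h5, sufLen_eq hy.1 (by omega) h3 hu]
    omega

/-- Consecutive nodes of the path are adjacent in the tree, unless they are the two children of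
the root. -/
theorem pathNode_succ (hx : EndLeaf h γ [true] x) (hy : EndLeaf h γ [false] y)
    (hn : n + 1 < 2 * (h - 1)) :
    (∃ c, pathNode h x y n = c :: pathNode h x y (n + 1)) ∨
    (∃ c, pathNode h x y (n + 1) = c :: pathNode h x y n) ∨
    (nodePos h x y [] = n ∧ pathNode h x y n = [true] ∧ pathNode h x y (n + 1) = [false]) := by
  have hdrop : ∀ {l : List Bool} {k : ℕ}, l.length = h → k < h →
      ∃ c, l.drop (h - (k + 1)) = c :: l.drop (h - k) := by
    intro l k hl hk
    have hlt : h - (k + 1) < l.length := by omega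
    have h2 := List.drop_eq_getElem_cons hlt
    rw [show h - (k + 1) + 1 = h - k by omega] at h2
    exact ⟨_, h2⟩
  rcases Nat.lt_trichotomy (n + 2) h with h1 | h1 | h1
  · left
    obtain ⟨c, hc⟩ := hdrop (k := h - 1 - (n + 1)) hx.1 (by omega)
    rw [show h - 1 - (n + 1) + 1 = h - 1 - n by omega] at hc
    refine ⟨c, ?_⟩
    rw [pathNode, pathNode, if_pos (by omega), if_pos (by omega), hc]
  · right; right
    have h2 := length_drop_sub hx.1 (show 1 ≤ h by omega)
    have h3 := length_drop_sub hy.1 (show 1 ≤ h by omega)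
    have h4 := (hx.cons_drop_suffix (k := 1) le_rfl (by omega)).1.eq_of_length h2.symm
    have h5 := (hy.cons_drop_suffix (k := 1) le_rfl (by omega)).1.eq_of_length h3.symm
    refine ⟨?_, ?_, ?_⟩
    · have h6 : sufLen h y [] = 0 := by
        unfold sufLen
        rw [Nat.findGreatest_eq_zero_iff]
        intro k hk hk' hs
        have := hs.length_le
        rw [length_drop_sub hy.1 (by omega)] at this
        simp at this
        omega
      rw [nodePos, if_neg (by simp), h6]
      omega
    · rw [pathNode, if_pos (by omega), show h - 1 - n = 1 by omega, ← h4]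
    · rw [pathNode, if_neg (by omega), show n + 1 + 2 - h = 1 by omega, ← h5]
  · right; left
    obtain ⟨c, hc⟩ := hdrop (k := n + 2 - h) hy.1 (by omega)
    rw [show n + 2 - h + 1 = n + 1 + 2 - h by omega] at hc
    refine ⟨c, ?_⟩
    rw [pathNode, pathNode, if_neg (by omega), if_neg (by omega), hc]

/-- Consecutive leaves in different subtrees of the root branch at the root, so each of them is
reached from a child of the root by following the rule or its negation. -/
theorem NextLeaf.endLeaf_root {b : List Bool → Bool} {c : Bool} {l l' : List Bool}
    (hl : NextLeaf h b l l') (hc : [c] <:+ l) (hc' : [!c] <:+ l') :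
    EndLeaf h b [c] l ∧ EndLeaf h (fun v => !b v) [!c] l' := by
  obtain ⟨d, w, _, h1, h2⟩ := hl
  rcases List.eq_nil_or_concat w with rfl | ⟨w, a, rfl⟩
  · obtain rfl := not_cons_suffix_and h1.2.1 hc
    exact ⟨h1, h2⟩
  · -- Otherwise the leaves have the same ancestor at depth `1`.
    exfalso
    have h3 : [a] <:+ l := List.IsSuffix.trans ⟨d :: w, by simp⟩ h1.2.1
    have h4 : [a] <:+ l' := List.IsSuffix.trans ⟨(!d) :: w, by simp⟩ h2.2.1
    have h5 := not_cons_suffix_and h3 hc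
    have h6 := not_cons_suffix_and h4 hc'
    rw [h5] at h6
    simp at h6

theorem decide_odd_add (m n : ℕ) : decide (Odd (m + n)) = (decide (Odd m) ^^ decide (Odd n)) := by
  by_cases hm : Odd m <;> by_cases hn : Odd n <;>
    simp [Nat.odd_add, hm, hn, ← Nat.not_odd_iff_even]

theorem zigzag_eq (v : List Bool) : zigzag β v = !(decide (Odd v.length) ^^ β v) := by
  unfold zigzag
  by_cases ho : Odd v.length <;> simp [ho]

/-- If the two leaves have become consecutive, then the bits at every other node of the path between
them have changed: up to a reflection of the whole embedding, given by `κ`, those at the nodes with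
odd numbers. -/
theorem changed_of_nextLeaf (hx : EndLeaf h (zigzag β) [true] x)
    (hy : EndLeaf h (zigzag β) [false] y) {b : Bool → List Bool → Bool} {i : Bool}
    (h1 : NextLeaf h (b i) y x) (h2 : NextLeaf h (b !i) x y) :
    ∃ κ : Bool, ∀ j n, n < 2 * (h - 1) →
      b j (pathNode h x y n) = ((j ^^ β (pathNode h x y n)) ^^ (κ ^^ decide (Odd n))) := by
  obtain ⟨y1, x1⟩ := h1.endLeaf_root hy.2.1 hx.2.1
  obtain ⟨x2, y2⟩ := h2.endLeaf_root hx.2.1 hy.2.1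
  refine ⟨!(i ^^ decide (Odd h)), fun j n hn => ?_⟩
  unfold pathNode
  split_ifs with hlt
  · have hlen := length_drop_sub hx.1 (show h - 1 - n ≤ h by omega)
    obtain ⟨h3, h4⟩ := hx.cons_drop_suffix (k := h - 1 - n) (by omega) (by omega)
    set w := x.drop (h - (h - 1 - n))
    have e1 := x1.2.2 _ _ h4 h3
    have e2 := x2.2.2 _ _ h4 h3
    have e3 : decide (Odd h) = ((decide (Odd w.length) ^^ decide (Odd n)) ^^ true) := by
      rw [show h = (w.length + n) + 1 by omega, decide_odd_add, decide_odd_add]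
      simp
    rw [zigzag_eq] at e1 e2
    rw [e3]
    generalize decide (Odd w.length) = a1 at *
    generalize decide (Odd n) = a2 at *
    generalize β w = a3 at *
    clear * - e1 e2
    cases i <;> cases j <;> simp only [Bool.not_false, Bool.not_true] at e1 e2 ⊢ <;>
    · generalize b true w = b1 at *
      generalize b false w = b2 at *
      clear_value w
      revert a1 a2 a3 b1 b2
      decide
  · have hlen := length_drop_sub hy.1 (show n + 2 - h ≤ h by omega)
    obtain ⟨h3, h4⟩ := hy.cons_drop_suffix (k := n + 2 - h) (by omega) (by omega)
    set w := y.drop (h - (n + 2 - h))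
    have e1 := y1.2.2 _ _ h4 h3
    have e2 := y2.2.2 _ _ h4 h3
    have e3 : decide (Odd n) = (decide (Odd w.length) ^^ decide (Odd h)) := by
      have e4 : decide (Odd (n + 2)) = decide (Odd (w.length + h)) := by
        rw [show n + 2 = w.length + h by omega]
      rw [decide_odd_add, decide_odd_add] at e4
      rw [← e4]
      simp only [show ¬ Odd 2 by decide, decide_false, Bool.xor_false]
    rw [zigzag_eq] at e1 e2
    rw [e3]
    generalize decide (Odd w.length) = a1 at *
    generalize decide (Odd h) = a2 at *
    generalize β w = a3 at *
    clear * - e1 e2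
    cases i <;> cases j <;> simp only [Bool.not_false, Bool.not_true] at e1 e2 ⊢ <;>
    · generalize b true w = b1 at *
      generalize b false w = b2 at *
      clear_value w
      revert a1 a2 a3 b1 b2
      decide

end PathNodes

/-! ### The effect of a flip on the rotations -/

section Moves

variable {V E : Type*}

/-- What a flip with the separating vertices `s, t` does at the other vertices: the rotations at the
vertices in `Q` are inverted, the others are kept, and adjacent vertices are both in `Q` or both
not. -/
def FlipAt (H K : PlaneGraph V E) (s t : V) (Q : V → Prop) : Prop :=
  K.graph = H.graph ∧
  (∀ u v, H.graph.Adj u v → u ≠ s → u ≠ t → v ≠ s → v ≠ t → (Q u ↔ Q v)) ∧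
  ∀ v, v ≠ s → v ≠ t → (Q v → K.rot v = (H.rot v)⁻¹) ∧ (¬ Q v → K.rot v = H.rot v)

theorem FlipAt.symm {H K : PlaneGraph V E} {s t : V} {Q : V → Prop} (h : FlipAt H K s t Q) :
    FlipAt K H s t Q := by
  obtain ⟨h1, h2, h3⟩ := h
  refine ⟨h1.symm, by rwa [h1], fun v hs ht => ⟨fun hQ => ?_, fun hQ => ?_⟩⟩
  · rw [(h3 v hs ht).1 hQ, inv_inv]
  · rw [(h3 v hs ht).2 hQ]

/-- For a reflection, `Q` consists of the vertices of the reflected subgraph; for a slide, it is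
empty. -/
theorem IsFlip.exists_flipAt [DecidableEq E] {H K : PlaneGraph V E} (h : IsFlip H K) :
    ∃ s t Q, FlipAt H K s t Q := by
  rcases h with ⟨hg, A, s, t, hA, _, h2, h3⟩ | ⟨hg, A, s, t, _, _, h2⟩
  · refine ⟨s, t, fun v => ∃ e ∈ A, H.graph.Inc e v, hg, ?_,
      fun v hs ht => ⟨h2 v hs ht, h3 v hs ht⟩⟩
    have key : ∀ u v, H.graph.Adj u v → u ≠ s → u ≠ t →
        (∃ e ∈ A, H.graph.Inc e u) → ∃ e ∈ A, H.graph.Inc e v := by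
      rintro u v ⟨f, hf⟩ hs ht ⟨e, he, heu⟩
      by_cases hfA : f ∈ A
      · exact ⟨f, hfA, hf.inc_right⟩
      · exact ((hA.separated u e f he hfA heu hf.inc_left).elim hs ht).elim
    exact fun u v huv h1 h2 h3 h4 => ⟨key u v huv h1 h2, key v u huv.symm h3 h4⟩
  · exact ⟨s, t, fun _ => False, hg, fun _ _ _ _ _ _ _ => Iff.rfl, fun v hs ht =>
      ⟨False.elim, fun _ => h2 v hs ht⟩⟩

theorem flipGraph_adj_cases [DecidableEq E] {H K : PlaneGraph V E} (h : (flipGraph V E).Adj H K) :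
    (∃ e, IsDeletion H e K ∨ IsDeletion K e H) ∨ ∃ s t Q, FlipAt H K s t Q := by
  rw [flipGraph, SimpleGraph.fromRel_adj] at h
  rcases h.2 with (⟨e, he⟩ | hf) | ⟨e, he⟩ | hf
  · exact Or.inl ⟨e, Or.inl he⟩
  · exact Or.inr hf.exists_flipAt
  · exact Or.inl ⟨e, Or.inr he⟩
  · obtain ⟨s, t, Q, hQ⟩ := hf.exists_flipAt
    exact Or.inr ⟨s, t, Q, hQ.symm⟩

theorem IsDeletion.isLink_iff [DecidableEq E] {H K : PlaneGraph V E} {e f : E}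
    (h : IsDeletion H e K) (hf : f ≠ e) {u v : V} :
    K.graph.IsLink f u v ↔ H.graph.IsLink f u v := by
  rw [h.2.1, Graph.deleteEdges_isLink]
  simp [hf]

theorem IsDeletion.mem_iff [DecidableEq E] {H K : PlaneGraph V E} {e f : E} (h : IsDeletion H e K) :
    f ∈ E(K.graph) ↔ f ∈ E(H.graph) ∧ f ≠ e := by
  rw [h.2.1]
  exact Iff.rfl

end Moves

/-! ### The defect of four bits -/

section Defect

/-- The least number of the four bits whose change makes them equal. -/
def defect (b : Bool → Bool → Bool) : ℕ :=
  min ((b false false).toNat + (b false true).toNat + (b true false).toNat + (b true true).toNat)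
    (4 - ((b false false).toNat + (b false true).toNat + (b true false).toNat +
      (b true true).toNat))

theorem defect_le_two (b : Bool → Bool → Bool) : defect b ≤ 2 := by
  unfold defect
  omega

/-- The defect is invariant under a change of all bits. -/
theorem defect_eq_of_xor {b b' : Bool → Bool → Bool} (c : Bool)
    (hb : ∀ j q, b' j q = (b j q ^^ c)) : defect b' = defect b := by
  unfold defect
  simp only [hb]
  generalize b false false = b1
  generalize b false true = b2
  generalize b true false = b3
  generalize b true true = b4
  clear hb
  revert b1 b2 b3 b4 c
  decide

/-- Up to a change of all bits, only the bit at `(j₀, q₀)` is altered. -/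
theorem defect_le_add_one {b b' : Bool → Bool → Bool} (c : Bool) (j₀ q₀ : Bool)
    (hb : ∀ j q, ¬ (j = j₀ ∧ q = q₀) → b' j q = (b j q ^^ c)) : defect b' ≤ defect b + 1 := by
  have key : ∀ j q, ¬ (j = j₀ ∧ q = q₀) → (b' j q).toNat = (b j q ^^ c).toNat :=
    fun j q h => congrArg Bool.toNat (hb j q h)
  have h1 := key false false
  have h2 := key false true
  have h3 := key true false
  have h4 := key true true
  have l1 := (b false false).toNat_le
  have l2 := (b false true).toNat_le
  have l3 := (b true false).toNat_le
  have l4 := (b true true).toNat_le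
  have l1' := (b' false false).toNat_le
  have l2' := (b' false true).toNat_le
  have l3' := (b' true false).toNat_le
  have l4' := (b' true true).toNat_le
  unfold defect
  have hnot : ∀ a : Bool, (!a).toNat = 1 - a.toNat := by decide
  cases c <;> simp only [Bool.xor_false, Bool.xor_true, hnot] at h1 h2 h3 h4 <;>
    cases j₀ <;> cases q₀ <;>
    simp only [and_true, and_false, and_self, not_true_eq_false, not_false_eq_true, forall_const,
      IsEmpty.forall_iff, reduceCtorEq, Bool.false_eq_true] at h1 h2 h3 h4 <;> omega

theorem defect_eq_two (κ : Bool) : defect (fun _ q => κ ^^ q) = 2 := by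
  cases κ <;> rfl

end Defect

/-! ### The groups of vertices and their connectedness -/

section Groups

variable {h : ℕ} {x y : List Bool} {γ : List Bool → Bool}

/-- The list that labels a vertex. -/
def vertexList : TreeVertex → List Bool
  | Sum.inl l => l
  | Sum.inr p => p.2

/-- The vertices are divided into groups, according to their positions along the path from `x` to
`y`: the group `n` is at the positions `2 * n` and `2 * n + 1`. -/
def group (h : ℕ) (x y : List Bool) (v : TreeVertex) : ℕ :=
  nodePos h x y (vertexList v) / 2

theorem vertexList_treeNode (j : Bool) (u : List Bool) : vertexList (treeNode h j u) = u := by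
  unfold treeNode
  split_ifs <;> rfl

theorem group_treeNode (j : Bool) (u : List Bool) :
    group h x y (treeNode h j u) = nodePos h x y u / 2 := by
  rw [group, vertexList_treeNode]

/-- The two copies of a node are connected in the union of the two subtrees below them. -/
theorem iff_of_subtree {Q : TreeVertex → Prop} (v : List Bool) (hv : v.length ≤ h)
    (hQ : ∀ j c u, v <:+ u → u.length < h →
      (Q (treeNode h j (c :: u)) ↔ Q (treeNode h j u))) :
    Q (treeNode h false v) ↔ Q (treeNode h true v) := by
  induction hn : h - v.length generalizing v with
  | zero =>
    rw [treeNode_leaf (by omega), treeNode_leaf (by omega)]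
  | succ n ih =>
    have hlt : v.length < h := by omega
    rw [← hQ false true v List.suffix_rfl hlt, ← hQ true true v List.suffix_rfl hlt]
    exact ih (true :: v) hlt (fun j c u hu => hQ j c u ((List.suffix_cons _ _).trans hu))
      (by simp; omega)

/-- If at most one vertex or edge of a four-cycle is missing, the remaining vertices are connected:
the vertices are `P j` and `R j`, missing if `π j` or `κ j` holds; the edges between the copies
`false` and `true` are missing if `α` or `α'` holds, and the edge from `P j` to `R j` if `ρ j`
holds. The number `t` says which of these eight cases occurs. -/
theorem exists_const_of_four_cycle {P R ρ π κ : Bool → Prop} {α α' : Prop} (t : ℕ)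
    (hα : α → t = 0) (hα' : α' → t = 1) (hρ : ∀ j, ρ j → t = 2 + j.toNat)
    (hπ : ∀ j, π j → t = 4 + j.toNat) (hκ : ∀ j, κ j → t = 6 + j.toNat)
    (h1 : ¬ α → ¬ π false → ¬ π true → (P false ↔ P true))
    (h2 : ¬ α' → ¬ κ false → ¬ κ true → (R false ↔ R true))
    (h3 : ∀ j, ¬ ρ j → ¬ π j → ¬ κ j → (P j ↔ R j)) :
    ∃ c : Prop, ∀ j, (¬ π j → (P j ↔ c)) ∧ (¬ κ j → (R j ↔ c)) := by
  have e1 : t ≠ 0 → t ≠ 4 → t ≠ 5 → (P false ↔ P true) := fun a b c =>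
    h1 (fun h => a (hα h)) (fun h => b (hπ _ h)) (fun h => c (hπ _ h))
  have e2 : t ≠ 1 → t ≠ 6 → t ≠ 7 → (R false ↔ R true) := fun a b c =>
    h2 (fun h => a (hα' h)) (fun h => b (hκ _ h)) (fun h => c (hκ _ h))
  have e3 : ∀ j : Bool, t ≠ 2 + j.toNat → ¬ π j → t ≠ 6 + j.toNat → (P j ↔ R j) := fun j a b c =>
    h3 j (fun h => a (hρ _ h)) b (fun h => c (hκ _ h))
  by_cases ht : t = 4 ∨ t = 5
  · have e2' := e2 (by omega) (by omega) (by omega)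
    refine ⟨R false, fun j => ⟨fun hj => ?_, fun _ => by cases j <;> simp [e2']⟩⟩
    have hj2 := j.toNat_le
    rw [e3 j (by omega) hj (by omega)]
    cases j <;> simp [e2']
  have hπ' : ∀ j, ¬ π j := fun j h => by
    have h4 := hπ j h
    have h5 := j.toNat_le
    omega
  by_cases ht0 : t = 0
  · have e2' := e2 (by omega) (by omega) (by omega)
    have e3' : ∀ j, P j ↔ R j := fun j => e3 j (by omega) (hπ' j) (by omega)
    refine ⟨R false, fun j => ?_⟩
    cases j <;> simp [e3', e2']
  have e1' := e1 ht0 (by omega) (by omega)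
  have hP : ∀ j, P j ↔ P false := fun j => by cases j <;> simp [e1']
  refine ⟨P false, fun j => ⟨fun _ => hP j, fun hj => ?_⟩⟩
  by_cases ht2 : t = 2 + j.toNat
  · have hj2 := j.toNat_le
    have e2' := e2 (by omega) (by omega) (by omega)
    have h4 := e3 (!j) (by cases j <;> simp at ht2 ⊢ <;> omega) (hπ' _)
      (by cases j <;> simp at ht2 ⊢ <;> omega)
    rw [← hP (!j), h4]
    cases j <;> simp [e2']
  · exact (h3 j (fun h => ht2 (hρ _ h)) (hπ' j) hj).symm.trans (hP j)

/-- The four copies of the two path nodes of a group stay connected within this group if one vertex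
is removed. -/
theorem exists_const_of_group (hx : EndLeaf h γ [true] x) (hy : EndLeaf h γ [false] y) {n : ℕ}
    (hn : n < h - 1) {Q : TreeVertex → Prop} (s : TreeVertex)
    (hQ : ∀ u v, (doubleTree h).Adj u v → group h x y u = n → group h x y v = n → u ≠ s → v ≠ s →
      (Q u ↔ Q v)) :
    ∃ c : Prop, ∀ j (q : Bool), Sum.inr (j, pathNode h x y (2 * n + q.toNat)) ≠ s →
      (Q (Sum.inr (j, pathNode h x y (2 * n + q.toNat))) ↔ c) := by
  obtain ⟨hp0, hplt, hpos⟩ := pathNode_spec hx hy (n := 2 * n) (by omega)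
  obtain ⟨hq0, hqlt, hqos⟩ := pathNode_spec hx hy (n := 2 * n + 1) (by omega)
  have hsucc := pathNode_succ hx hy (n := 2 * n) (by omega)
  set p := pathNode h x y (2 * n) with hp
  set q := pathNode h x y (2 * n + 1) with hq
  have adj : ∀ j c u, u.length < h → nodePos h x y (c :: u) / 2 = n → nodePos h x y u / 2 = n →
      treeNode h j (c :: u) ≠ s → treeNode h j u ≠ s →
      (Q (treeNode h j (c :: u)) ↔ Q (treeNode h j u)) := by
    intro j c u hu h1 h2 h3 h4
    exact hQ _ _ (isLink_doubleTree j c hu).adj (by rwa [group_treeNode]) (by rwa [group_treeNode])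
      h3 h4
  -- The branch at a path node joins its two copies.
  have branch : ∀ w, w.length < h →
      (∀ u, (u = w ∨ (!γ w) :: w <:+ u) → nodePos h x y u / 2 = n) →
      ¬ (!γ w) :: w <:+ vertexList s → Sum.inr (false, w) ≠ s → Sum.inr (true, w) ≠ s →
      (Q (Sum.inr (false, w)) ↔ Q (Sum.inr (true, w))) := by
    intro w hw hpos hs hf ht
    have hne : ∀ j u, (!γ w) :: w <:+ u → treeNode h j u ≠ s := by
      rintro j u hu rfl
      rw [vertexList_treeNode] at hs
      exact hs hu
    have h1 := iff_of_subtree (Q := Q) ((!γ w) :: w) hw fun j c u hu hlt =>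
      adj j c u hlt (hpos _ (Or.inr (hu.trans (List.suffix_cons _ _)))) (hpos _ (Or.inr hu))
        (hne _ _ (hu.trans (List.suffix_cons _ _))) (hne _ _ hu)
    have h2 : ∀ j, Sum.inr (j, w) ≠ s →
        (Q (treeNode h j ((!γ w) :: w)) ↔ Q (Sum.inr (j, w))) := by
      intro j hj
      have := adj j (!γ w) w hw (hpos _ (Or.inr List.suffix_rfl)) (hpos _ (Or.inl rfl))
        (hne _ _ List.suffix_rfl) (by rwa [treeNode_of_lt hw])
      rwa [treeNode_of_lt hw] at this
    rw [← h2 false hf, ← h2 true ht, h1]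
  have bp := branch p hplt fun u hu => by rw [hpos u hu]; omega
  have bq := branch q hqlt fun u hu => by rw [hqos u hu]; omega
  -- The two path nodes are joined in either tree, directly or through the root.
  have link : ∀ j, Sum.inr (j, []) ≠ s → Sum.inr (j, p) ≠ s → Sum.inr (j, q) ≠ s →
      (Q (Sum.inr (j, p)) ↔ Q (Sum.inr (j, q))) := by
    intro j h0 h1 h2
    have ep := hpos p (Or.inl rfl)
    have eq := hqos q (Or.inl rfl)
    rw [← treeNode_of_lt hplt, ← treeNode_of_lt hqlt] at *
    rcases hsucc with ⟨c, hc⟩ | ⟨c, hc⟩ | ⟨h3, h4, h5⟩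
    · rw [hc] at h1 ep ⊢
      exact adj j c q hqlt (by omega) (by omega) h1 h2
    · rw [hc] at h2 eq ⊢
      exact (adj j c p hplt (by omega) (by omega) h2 h1).symm
    · rw [h4] at h1 ep ⊢
      rw [h5] at h2 eq ⊢
      have hh : 0 < h := by omega
      have h0' : treeNode h j [] ≠ s := by rwa [treeNode_of_lt hh]
      exact (adj j true [] hh (by omega) (by omega) h1 h0').trans
        (adj j false [] hh (by omega) (by omega) h2 h0').symm
  have hpq : p ≠ q := by
    intro heq
    have h1 := hpos p (Or.inl rfl)
    have h2 := hqos q (Or.inl rfl)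
    rw [heq] at h1
    omega
  -- The removed vertex breaks at most one of the four connections, or is one of the four vertices.
  have nil_of : ∀ {a : Bool} {w : List Bool}, ¬ a :: w <:+ [] := fun h => by
    simpa using h.length_le
  have self_of : ∀ {a : Bool} {w : List Bool}, ¬ a :: w <:+ w := fun h => by
    simpa using h.length_le
  have hpq' : ¬ (!γ p) :: p <:+ q := fun h1 => by
    have h2 := hpos q (Or.inr h1)
    have h3 := hqos q (Or.inl rfl)
    omega
  have hqp' : ¬ (!γ q) :: q <:+ p := fun h1 => by
    have h2 := hqos p (Or.inr h1)
    have h3 := hpos p (Or.inl rfl)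
    omega
  have hboth : ∀ u, (!γ p) :: p <:+ u → ¬ (!γ q) :: q <:+ u := fun u h1 h2 => by
    have h3 := hpos u (Or.inr h1)
    have h4 := hqos u (Or.inr h2)
    omega
  suffices hs : ∃ c : Prop, ∀ j, (Sum.inr (j, p) ≠ s → (Q (Sum.inr (j, p)) ↔ c)) ∧
      (Sum.inr (j, q) ≠ s → (Q (Sum.inr (j, q)) ↔ c)) by
    obtain ⟨c, hc⟩ := hs
    refine ⟨c, fun j r => ?_⟩
    cases r
    · exact (hc j).1
    · exact (hc j).2
  obtain ⟨c, hc⟩ := exists_const_of_four_cycle (P := fun j => Q (Sum.inr (j, p)))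
    (R := fun j => Q (Sum.inr (j, q))) (ρ := fun j => Sum.inr (j, []) = s)
    (π := fun j => Sum.inr (j, p) = s) (κ := fun j => Sum.inr (j, q) = s)
    (if (!γ p) :: p <:+ vertexList s then 0 else if (!γ q) :: q <:+ vertexList s then 1 else
      if vertexList s = [] then 2 + (Sum.elim (fun _ => false) Prod.fst s).toNat else
      if vertexList s = p then 4 + (Sum.elim (fun _ => false) Prod.fst s).toNat else
      6 + (Sum.elim (fun _ => false) Prod.fst s).toNat)
    (fun h => if_pos h) (fun h => by rw [if_neg fun h' => hboth _ h' h, if_pos h])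
    (by rintro j rfl; simp [vertexList, nil_of])
    (by rintro j rfl; simp [vertexList, self_of, hqp', hp0])
    (by rintro j rfl; simp [vertexList, self_of, hpq', hq0, hpq.symm])
    bp bq link
  exact ⟨c, hc⟩

end Groups

/-! ### The lower bound -/

section LowerBound

variable {h : ℕ} {x y : List Bool} {γ : List Bool → Bool}

open Classical in
/-- The cyclic orders of the three edges of the double tree at the four copies of the two path
nodes of the group `n`: the bit `(j, q)` belongs to the path node `2 * n + q` of the tree `j`. -/
noncomputable def orderBit (h : ℕ) (x y : List Bool) (n : ℕ) (H : PlaneGraph TreeVertex TreeEdge)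
    (j q : Bool) : Bool :=
  decide (CycOrd (H.rot (Sum.inr (j, pathNode h x y (2 * n + q.toNat))))
    (j, pathNode h x y (2 * n + q.toNat)) (j, true :: pathNode h x y (2 * n + q.toNat))
    (j, false :: pathNode h x y (2 * n + q.toNat)))

/-- The defect of the changes of the bits of the group `n` between `H₀` and `H`. -/
noncomputable def groupDefect (h : ℕ) (x y : List Bool) (H₀ H : PlaneGraph TreeVertex TreeEdge)
    (n : ℕ) : ℕ :=
  defect fun j q => orderBit h x y n H j q ^^ orderBit h x y n H₀ j q

/-- All edges of the double tree at the vertices of the group `n` are present in `H`. -/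
def GroupPresent (h : ℕ) (x y : List Bool) (n : ℕ) (H : PlaneGraph TreeVertex TreeEdge) : Prop :=
  ∀ f u v, (doubleTree h).IsLink f u v → group h x y u = n → H.graph.IsLink f u v

theorem group_pathNode (hx : EndLeaf h γ [true] x) (hy : EndLeaf h γ [false] y) {n : ℕ}
    (hn : n < h - 1) (j q : Bool) :
    group h x y (Sum.inr (j, pathNode h x y (2 * n + q.toNat))) = n := by
  have hq := q.toNat_le
  rw [group, vertexList, (pathNode_spec hx hy (by omega)).2.2 _ (Or.inl rfl)]
  omega

theorem GroupPresent.inc (hx : EndLeaf h γ [true] x) (hy : EndLeaf h γ [false] y) {n : ℕ}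
    (hn : n < h - 1) {H : PlaneGraph TreeVertex TreeEdge} (hH : GroupPresent h x y n H)
    (j q : Bool) :
    (∀ c, H.graph.Inc (j, c :: pathNode h x y (2 * n + q.toNat))
      (Sum.inr (j, pathNode h x y (2 * n + q.toNat)))) ∧
    H.graph.Inc (j, pathNode h x y (2 * n + q.toNat))
      (Sum.inr (j, pathNode h x y (2 * n + q.toNat))) := by
  have hq := q.toNat_le
  obtain ⟨h1, h2, _⟩ := pathNode_spec hx hy (n := 2 * n + q.toNat) (by omega)
  have key : ∀ f, (doubleTree h).Inc f (Sum.inr (j, pathNode h x y (2 * n + q.toNat))) →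
      H.graph.Inc f (Sum.inr (j, pathNode h x y (2 * n + q.toNat))) := by
    rintro f ⟨v, hv⟩
    exact ⟨v, hH f _ v hv (group_pathNode hx hy hn j q)⟩
  exact ⟨fun c => key _ (inc_doubleTree_inr.2 ⟨h2, Or.inr ⟨c, rfl⟩⟩),
    key _ (inc_doubleTree_inr.2 ⟨h2, Or.inl ⟨h1, rfl⟩⟩)⟩

/-- A flip increases the defect of a group by at most the number of its separating vertices in this
group. -/
theorem groupDefect_flip_le (hx : EndLeaf h γ [true] x) (hy : EndLeaf h γ [false] y) {n : ℕ}
    (hn : n < h - 1) {H₀ H K : PlaneGraph TreeVertex TreeEdge} (hH : GroupPresent h x y n H)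
    {s t : TreeVertex} {Q : TreeVertex → Prop} (hflip : FlipAt H K s t Q) :
    groupDefect h x y H₀ K n ≤ groupDefect h x y H₀ H n +
      ((if group h x y s = n then 1 else 0) + (if group h x y t = n then 1 else 0)) := by
  classical
  by_cases hst : group h x y s = n ∧ group h x y t = n
  · rw [if_pos hst.1, if_pos hst.2]
    exact (defect_le_two _).trans (by omega)
  -- At most one vertex `s₀` of the group is separating.
  obtain ⟨s₀, hs₀, hs₁⟩ : ∃ s₀, (∀ v, group h x y v = n → v ≠ s₀ → v ≠ s ∧ v ≠ t) ∧
      (if group h x y s₀ = n then 1 else 0) ≤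
        (if group h x y s = n then 1 else 0) + (if group h x y t = n then 1 else 0) := by
    by_cases hs : group h x y s = n
    · refine ⟨s, fun v hv hvs => ⟨hvs, ?_⟩, by omega⟩
      rintro rfl
      exact hst ⟨hs, hv⟩
    · refine ⟨t, fun v hv hvt => ⟨?_, hvt⟩, by omega⟩
      rintro rfl
      exact hs hv
  refine le_trans ?_ (Nat.add_le_add_left hs₁ _)
  obtain ⟨c, hc⟩ := exists_const_of_group hx hy hn (Q := Q) s₀ fun u v huv hu hv hus hvs => by
    obtain ⟨f, hf⟩ := huv
    exact hflip.2.1 u v ⟨f, hH f u v hf hu⟩ (hs₀ u hu hus).1 (hs₀ u hu hus).2 (hs₀ v hv hvs).1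
      (hs₀ v hv hvs).2
  have hbit : ∀ j q, Sum.inr (j, pathNode h x y (2 * n + q.toNat)) ≠ s₀ →
      (orderBit h x y n K j q ^^ orderBit h x y n H₀ j q) =
        ((orderBit h x y n H j q ^^ orderBit h x y n H₀ j q) ^^ decide c) := by
    intro j q hne
    obtain ⟨h1, h2⟩ := hs₀ _ (group_pathNode hx hy hn j q) hne
    obtain ⟨h3, h4⟩ := hH.inc hx hy hn j q
    have h5 := hc j q hne
    have h6 := hflip.2.2 _ h1 h2
    have h7 : orderBit h x y n K j q = (orderBit h x y n H j q ^^ decide c) := by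
      by_cases hcc : c
      · have h8 := cycOrd_inv (H.finite_edgeSet.subset fun f hf => hf.edge_mem)
          (H.rot_isCycleOn (Sum.inr (j, pathNode h x y (2 * n + q.toNat)))) h4 (h3 true) (h3 false)
          (by simp) (by simp) (by simp)
        unfold orderBit
        rw [h6.1 (h5.2 hcc)]
        simp [h8, hcc]
      · unfold orderBit
        rw [h6.2 (fun h => hcc (h5.1 h))]
        simp [hcc]
    rw [h7, Bool.xor_assoc, Bool.xor_comm (decide c), ← Bool.xor_assoc]
  by_cases hs : ∃ j₀ q₀, s₀ = Sum.inr (j₀, pathNode h x y (2 * n + Bool.toNat q₀))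
  · obtain ⟨j₀, q₀, rfl⟩ := hs
    rw [if_pos (group_pathNode hx hy hn _ _)]
    refine defect_le_add_one (decide c) j₀ q₀ fun j q hjq => hbit j q fun heq => hjq ?_
    obtain ⟨rfl, h1⟩ := Prod.mk.inj (Sum.inr_injective heq)
    have hq := q.toNat_le
    have hq₀ := q₀.toNat_le
    have h2 := (pathNode_spec hx hy (n := 2 * n + q.toNat) (by omega)).2.2 _ (Or.inl rfl)
    have h3 := (pathNode_spec hx hy (n := 2 * n + q₀.toNat) (by omega)).2.2 _ (Or.inl rfl)
    rw [h1, h3] at h2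
    refine ⟨rfl, ?_⟩
    cases q <;> cases q₀ <;> simp_all
  · rw [groupDefect, defect_eq_of_xor (decide c) fun j q => hbit j q fun heq =>
      hs ⟨j, q, heq.symm⟩]
    exact Nat.le_add_right _ _

/-- Changes of an edge leave the defect of a group unaltered, even if the edge ends in the group, as
long as the edges of the double tree at this group are kept. -/
theorem groupDefect_deletion (hx : EndLeaf h γ [true] x) (hy : EndLeaf h γ [false] y) {n : ℕ}
    (hn : n < h - 1) {H₀ H K : PlaneGraph TreeVertex TreeEdge} (hK : GroupPresent h x y n K)
    {e : TreeEdge} (hdel : IsDeletion H e K) :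
    groupDefect h x y H₀ K n = groupDefect h x y H₀ H n := by
  unfold groupDefect
  congr 1
  funext j q
  congr 1
  obtain ⟨h3, h4⟩ := hK.inc hx hy hn j q
  have hne : ∀ {f v}, K.graph.Inc f v → f ≠ e := fun hf => (hdel.mem_iff.1 hf.edge_mem).2
  unfold orderBit
  rw [hdel.2.2]
  refine decide_eq_decide.2 ?_
  convert cycOrd_swap_mul (hne h4) (hne (h3 true)) (hne (h3 false))

/-- The bits of a tree rotation. -/
theorem IsTreeRotation.orderBit_eq (hx : EndLeaf h γ [true] x) (hy : EndLeaf h γ [false] y)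
    {n : ℕ} (hn : n < h - 1) {H : PlaneGraph TreeVertex TreeEdge}
    {b : Bool → List Bool → Bool} (T : IsTreeRotation h H.graph H.rot b) (j q : Bool) :
    orderBit h x y n H j q = !b j (pathNode h x y (2 * n + q.toNat)) := by
  have hq := q.toNat_le
  obtain ⟨h1, h2, _⟩ := pathNode_spec hx hy (n := 2 * n + q.toNat) (by omega)
  have h3 := T.rot_parent j _ h2 h1
  unfold orderBit
  cases hb : b j (pathNode h x y (2 * n + q.toNat)) <;> rw [hb] at h3
  · simpa using cycOrd_of_apply h3 (by simp)
  · simpa using not_cycOrd_of_apply h3 (by simp)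

/-- A property that holds at only one of the times `a` and `b` changes in between. -/
theorem one_le_sum_toggle {P : ℕ → Prop} [DecidablePred P] {a b : ℕ} (hab : a ≤ b)
    (hP : ¬ (P a ↔ P b)) :
    1 ≤ ∑ k ∈ Finset.Ico a b, (if P k ↔ P (k + 1) then 0 else 1) := by
  by_contra hlt
  have h0 : ∑ k ∈ Finset.Ico a b, (if P k ↔ P (k + 1) then 0 else 1) = 0 := by omega
  rw [Finset.sum_eq_zero_iff] at h0
  refine hP ?_
  have key : ∀ k, a ≤ k → k ≤ b → (P a ↔ P k) := by
    intro k hk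
    induction k, hk using Nat.le_induction with
    | base => exact fun _ => Iff.rfl
    | succ k hk ih =>
      intro hkb
      have h1 := h0 k (Finset.mem_Ico.2 ⟨hk, hkb⟩)
      refine (ih (by omega)).trans ?_
      by_contra h2
      simp [h2] at h1
  exact key b hab le_rfl

/-- Flips and changes of edges that lead from `treeEmb hh β` to an embedding in which the two zigzag
leaves are joined by an edge number at least `h`. -/
theorem le_length_of_walk (hh : 1 ≤ h) {β : List Bool → Bool} {e : TreeEdge}
    (he : e ∉ E(doubleTree h))
    (hx : EndLeaf h (zigzag β) [true] x) (hy : EndLeaf h (zigzag β) [false] y)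
    {H' : PlaneGraph TreeVertex TreeEdge}
    (hH' : H' ∈ Emb (addEdge (doubleTree h) e (Sum.inl x) (Sum.inl y)))
    (p : (flipGraph TreeVertex TreeEdge).Walk (treeEmb hh β) H') : h ≤ p.length := by
  classical
  set L := p.length with hL
  set S := fun k => p.getVert k with hS
  have S0 : S 0 = treeEmb hh β := p.getVert_zero
  have SL : S L = H' := p.getVert_length
  have hH'g : H'.graph = addEdge (doubleTree h) e (Sum.inl x) (Sum.inl y) := hH'
  have hE0 : E((S 0).graph) = E(doubleTree h) := by rw [S0]; rfl
  have hEL : E((S L).graph) = insert e E(doubleTree h) := by rw [SL, hH'g, edgeSet_addEdge he]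
  have step : ∀ k, k < L → (∃ e, IsDeletion (S k) e (S (k + 1)) ∨ IsDeletion (S (k + 1)) e (S k)) ∨
      ∃ s t Q, FlipAt (S k) (S (k + 1)) s t Q :=
    fun k hk => flipGraph_adj_cases (p.adj_getVert_succ hk)
  -- The edges of the double tree that are missing at some time, and the groups with such an edge.
  set D : Finset TreeEdge := (finite_edgeSet_doubleTree h).toFinset.filter
    (fun f => ∃ k ≤ L, f ∉ E((S k).graph)) with hD
  set T : Finset ℕ := D.biUnion fun f => {nodePos h x y f.2 / 2, nodePos h x y f.2.tail / 2} with hT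
  set U : Finset ℕ := Finset.range (h - 1) \ T with hU
  have hUn : ∀ n ∈ U, n < h - 1 := fun n hn => by
    rw [hU, Finset.mem_sdiff, Finset.mem_range] at hn
    exact hn.1
  -- An edge has its ends in at most two groups.
  have hcard : h - 1 ≤ U.card + 2 * D.card := by
    have h1 : T.card ≤ D.card * 2 :=
      Finset.card_biUnion_le_card_mul _ _ _ fun f _ => Finset.card_le_two
    have h2 := Finset.le_card_sdiff T (Finset.range (h - 1))
    rw [Finset.card_range, ← hU] at h2
    omega
  have keep : ∀ k, k ≤ L → ∀ f ∈ E(doubleTree h), f ∉ D → ∀ u v,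
      (S k).graph.IsLink f u v ↔ (doubleTree h).IsLink f u v := by
    intro k
    induction k with
    | zero =>
      intro _ f _ _ u v
      rw [S0]
      rfl
    | succ k ih =>
      intro hk f hf hfD u v
      rw [← ih (by omega) f hf hfD u v]
      have hmem : ∀ i ≤ L, f ∈ E((S i).graph) := by
        intro i hi
        by_contra hfi
        refine hfD ?_
        rw [hD, Finset.mem_filter, Set.Finite.mem_toFinset]
        exact ⟨hf, i, hi, hfi⟩
      rcases step k hk with ⟨e', h1 | h1⟩ | ⟨s, t, Q, h1⟩
      · exact h1.isLink_iff (h1.mem_iff.1 (hmem (k + 1) hk)).2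
      · exact (h1.isLink_iff (h1.mem_iff.1 (hmem k (by omega))).2).symm
      · rw [h1.1]
  have present : ∀ n ∈ U, ∀ k ≤ L, GroupPresent h x y n (S k) := by
    intro n hn k hk f u v hf hu
    refine (keep k hk f hf.edge_mem ?_ u v).2 hf
    intro hfD
    rw [hU, Finset.mem_sdiff] at hn
    refine hn.2 ?_
    rw [hT, Finset.mem_biUnion]
    refine ⟨f, hfD, ?_⟩
    obtain ⟨i, b, w, _, rfl, ⟨rfl, _⟩ | ⟨rfl, _⟩⟩ := hf
    · rw [group_treeNode] at hu
      simp [hu]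
    · rw [group_treeNode] at hu
      simp [hu]
  -- Every step pays for its share of the defects and of the changes of edges.
  set F : Finset TreeEdge := insert e D with hF
  set tog : ℕ → TreeEdge → ℕ := fun k f =>
    if f ∈ E((S k).graph) ↔ f ∈ E((S (k + 1)).graph) then 0 else 1 with htog
  have togDel : ∀ k e', (∀ f, f ≠ e' → (f ∈ E((S k).graph) ↔ f ∈ E((S (k + 1)).graph))) →
      ∑ f ∈ F, tog k f ≤ 1 := by
    intro k e' hsame
    calc ∑ f ∈ F, tog k f ≤ ∑ f ∈ F, (if e' = f then 1 else 0) := by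
          refine Finset.sum_le_sum fun f _ => ?_
          by_cases hf : e' = f
          · rw [if_pos hf]
            simp only [htog]
            split_ifs <;> omega
          · simp [htog, hsame f (Ne.symm hf)]
      _ ≤ 1 := by
          rw [Finset.sum_ite_eq]
          split_ifs <;> omega
  have ineq : ∀ k, k < L → ∑ n ∈ U, groupDefect h x y (S 0) (S (k + 1)) n + 2 * ∑ f ∈ F, tog k f ≤
      ∑ n ∈ U, groupDefect h x y (S 0) (S k) n + 2 := by
    intro k hk
    rcases step k hk with ⟨e', h1 | h1⟩ | ⟨s, t, Q, h1⟩
    · have h2 := togDel k e' fun f hf => by rw [h1.mem_iff]; simp [hf]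
      have h3 : ∑ n ∈ U, groupDefect h x y (S 0) (S (k + 1)) n =
          ∑ n ∈ U, groupDefect h x y (S 0) (S k) n :=
        Finset.sum_congr rfl fun n hn =>
          groupDefect_deletion hx hy (hUn n hn) (present n hn (k + 1) hk) h1
      omega
    · have h2 := togDel k e' fun f hf => by rw [h1.mem_iff]; simp [hf]
      have h3 : ∑ n ∈ U, groupDefect h x y (S 0) (S k) n =
          ∑ n ∈ U, groupDefect h x y (S 0) (S (k + 1)) n :=
        Finset.sum_congr rfl fun n hn =>
          groupDefect_deletion hx hy (hUn n hn) (present n hn k hk.le) h1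
      omega
    · have h2 : ∑ f ∈ F, tog k f = 0 := by
        refine Finset.sum_eq_zero fun f _ => ?_
        simp [htog, h1.1]
      have h3 : ∑ n ∈ U, groupDefect h x y (S 0) (S (k + 1)) n ≤
          ∑ n ∈ U, (groupDefect h x y (S 0) (S k) n +
            ((if group h x y s = n then 1 else 0) + (if group h x y t = n then 1 else 0))) :=
        Finset.sum_le_sum fun n hn =>
          groupDefect_flip_le hx hy (hUn n hn) (present n hn k hk.le) h1
      rw [Finset.sum_add_distrib, Finset.sum_add_distrib, Finset.sum_ite_eq,
        Finset.sum_ite_eq] at h3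
      have h4 : (if group h x y s ∈ U then 1 else 0) ≤ 1 := by split_ifs <;> omega
      have h5 : (if group h x y t ∈ U then 1 else 0) ≤ 1 := by split_ifs <;> omega
      omega
  have total : ∀ k, k ≤ L → ∑ n ∈ U, groupDefect h x y (S 0) (S k) n +
      2 * ∑ i ∈ Finset.range k, ∑ f ∈ F, tog i f ≤ 2 * k := by
    intro k
    induction k with
    | zero =>
      intro _
      have : ∀ n ∈ U, groupDefect h x y (S 0) (S 0) n = 0 := fun n _ => by
        simp [groupDefect, defect]
      simp [Finset.sum_eq_zero this]
    | succ k ih =>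
      intro hk
      have h1 := ih (by omega)
      have h2 := ineq k hk
      rw [Finset.sum_range_succ]
      omega
  -- At the end, the orders at the two path nodes of each group have changed differently.
  have final : ∑ n ∈ U, groupDefect h x y (S 0) (S L) n = 2 * U.card := by
    have hxy : x ≠ y := by
      rintro rfl
      have := not_cons_suffix_and hx.2.1 hy.2.1
      simp at this
    obtain ⟨b, hb⟩ := exists_isTreeRotation_addEdge he hH'
    rw [← hH'g] at hb
    obtain ⟨i, n1, n2⟩ := nextLeaf_of_mem_Emb_addEdge hh he hx.1 hy.1 hxy hH' hb
    obtain ⟨κ, hκ⟩ := changed_of_nextLeaf hx hy n1 n2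
    have T0 : IsTreeRotation h (treeEmb hh β).graph (treeEmb hh β).rot (fun i w => i ^^ β w) :=
      isTreeRotation_doubleTree hh β
    rw [mul_comm, ← smul_eq_mul, ← Finset.sum_const]
    refine Finset.sum_congr rfl fun n hn => ?_
    rw [← defect_eq_two κ, groupDefect, S0, SL]
    congr 1
    funext j q
    have hq := q.toNat_le
    have hn' := hUn n hn
    rw [hb.orderBit_eq hx hy hn' j q, T0.orderBit_eq hx hy hn' j q, hκ j _ (by omega)]
    have hodd : decide (Odd (2 * n + q.toNat)) = q := by
      cases q <;> simp
    rw [hodd]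
    generalize (j ^^ β (pathNode h x y (2 * n + q.toNat))) = a
    cases a <;> cases κ <;> cases q <;> rfl
  -- The edge `e` appears, and each edge of `D` disappears and appears again.
  have hsum : 2 * D.card + 1 ≤ ∑ i ∈ Finset.range L, ∑ f ∈ F, tog i f := by
    have heD : e ∉ D := fun h1 => he ((Set.Finite.mem_toFinset _).1 (Finset.mem_filter.1 h1).1)
    rw [Finset.sum_comm, hF, Finset.sum_insert heD, add_comm, mul_comm]
    refine Nat.add_le_add ?_ ?_
    · rw [Finset.range_eq_Ico]
      refine one_le_sum_toggle (P := fun k => e ∈ E((S k).graph)) (Nat.zero_le L) ?_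
      rw [hE0, hEL]
      simp [he]
    · rw [← smul_eq_mul]
      refine Finset.card_nsmul_le_sum _ _ _ fun f hf => ?_
      rw [hD, Finset.mem_filter, Set.Finite.mem_toFinset] at hf
      obtain ⟨hf, k, hk, hfk⟩ := hf
      rw [Finset.range_eq_Ico, ← Finset.sum_Ico_consecutive _ (Nat.zero_le k) hk]
      refine Nat.add_le_add (a := 1) (c := 1) ?_ ?_
      · refine one_le_sum_toggle (P := fun k => f ∈ E((S k).graph)) (Nat.zero_le k) ?_
        simp only [hE0, hf, hfk]
        simp
      · refine one_le_sum_toggle (P := fun k => f ∈ E((S k).graph)) hk ?_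
        simp only [hEL, hf, hfk, Set.mem_insert_iff, or_true]
        simp
  have hfin := total L le_rfl
  rw [final] at hfin
  omega

end LowerBound

/-! ### The flip distance of the zigzag leaves -/

theorem EndLeaf.ne_of_root {h : ℕ} {γ : List Bool → Bool} {x y : List Bool}
    (hx : EndLeaf h γ [true] x) (hy : EndLeaf h γ [false] y) : x ≠ y := by
  rintro rfl
  exact absurd (not_cons_suffix_and hx.2.1 hy.2.1) (by simp)

/-- Deleting an edge is one step, and flips are steps, so in the flip-graph an embedding with the
new edge is at most one step further away than the one without it in the graph of flips. -/
theorem edist_flipGraph_le_add_one {V E : Type*} [DecidableEq E] {H H' K : PlaneGraph V E} {e : E}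
    (hK : IsDeletion H' e K) :
    (flipGraph V E).edist H H' ≤ (pureFlipGraph V E).edist H K + 1 := by
  have hle : pureFlipGraph V E ≤ flipGraph V E := by
    intro A B hAB
    rw [pureFlipGraph, SimpleGraph.fromRel_adj] at hAB
    rw [flipGraph, SimpleGraph.fromRel_adj]
    exact ⟨hAB.1, hAB.2.imp Or.inr Or.inr⟩
  have hadj : (flipGraph V E).edist K H' ≤ 1 := by
    rw [SimpleGraph.edist_le_one_iff_adj_or_eq, flipGraph, SimpleGraph.fromRel_adj]
    by_cases hKH : K = H'
    · exact Or.inr hKH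
    · exact Or.inl ⟨hKH, Or.inr (Or.inl ⟨e, hK⟩)⟩
  exact SimpleGraph.edist_triangle.trans (add_le_add (SimpleGraph.edist_anti hle) hadj)

theorem mainTheorem3 (h : ℕ) (hh : 1 ≤ h) :
    V(doubleTree h).ncard = 3 * 2 ^ h - 2 ∧
    IsPlanar (doubleTree h) ∧
    (∀ x ∈ leafSet h, ∀ y ∈ leafSet h, x ≠ y → ∀ e ∉ E(doubleTree h),
      IsPlanar (addEdge (doubleTree h) e x y)) ∧
    ∀ H ∈ Emb (doubleTree h), ∃ x ∈ leafSet h, ∃ y ∈ leafSet h, x ≠ y ∧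
      ∀ e ∉ E(doubleTree h),
        IsLeast {d : ℕ∞ | ∃ K ∈ Emb (doubleTree h),
            (∃ H' ∈ Emb (addEdge (doubleTree h) e x y), IsDeletion H' e K) ∧
            d = (pureFlipGraph TreeVertex TreeEdge).edist H K} ((h - 1 : ℕ) : ℕ∞) ∧
        IsLeast {d : ℕ∞ | ∃ H' ∈ Emb (addEdge (doubleTree h) e x y),
            d = (flipGraph TreeVertex TreeEdge).edist H H'} (h : ℕ∞) := by
  refine ⟨?_, ⟨treeEmb hh fun _ => true, treeEmb_mem_Emb hh _⟩, ?_, ?_⟩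
  · have := ncard_vertexSet_doubleTree h
    omega
  · rintro _ ⟨x, hx, rfl⟩ _ ⟨y, hy, rfl⟩ hxy e he
    obtain ⟨β, hβ⟩ := exists_nextLeaf_rule hx hy fun hne => hxy (congrArg Sum.inl hne)
    exact ⟨edgeEmb hh he hβ, edgeEmb_mem_Emb hh he hβ⟩
  intro H hH
  obtain ⟨β, rfl⟩ := exists_eq_treeEmb hh hH
  obtain ⟨x, hx⟩ := exists_endLeaf h (zigzag β) [true] hh
  obtain ⟨y, hy⟩ := exists_endLeaf h (zigzag β) [false] hh
  refine ⟨Sum.inl x, ⟨x, hx.1, rfl⟩, Sum.inl y, ⟨y, hy.1, rfl⟩,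
    fun hxy => hx.ne_of_root hy (Sum.inl_injective hxy), fun e he => ?_⟩
  have hnext := nextLeaf_flipRule hx hy
  have hle := edist_flipRule_le hh β
    (fun k => if Odd k then y.drop (h - k) else x.drop (h - k)) (h - 1) (by omega)
  have hsucc : (h : ℕ∞) = ((h - 1 : ℕ) : ℕ∞) + 1 := by
    exact_mod_cast (Nat.sub_add_cancel hh).symm
  have hlower : ∀ H' ∈ Emb (addEdge (doubleTree h) e (Sum.inl x) (Sum.inl y)),
      (h : ℕ∞) ≤ (flipGraph TreeVertex TreeEdge).edist (treeEmb hh β) H' := fun H' hH' =>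
    le_iInf fun p => Nat.cast_le.2 (le_length_of_walk hh he hx hy hH' p)
  have hpure : ∀ K H', H' ∈ Emb (addEdge (doubleTree h) e (Sum.inl x) (Sum.inl y)) →
      IsDeletion H' e K →
      ((h - 1 : ℕ) : ℕ∞) ≤ (pureFlipGraph TreeVertex TreeEdge).edist (treeEmb hh β) K := by
    intro K H' hH' hK
    have h1 := (hlower H' hH').trans (edist_flipGraph_le_add_one hK)
    rw [hsucc] at h1
    exact (ENat.add_le_add_iff_right ENat.one_ne_top).1 h1
  have hmem := edgeEmb_mem_Emb hh he hnext
  have hdel := isDeletion_edgeEmb hh he hnext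
  refine ⟨⟨⟨_, treeEmb_mem_Emb hh _, ⟨_, hmem, hdel⟩, ?_⟩, ?_⟩, ⟨_, hmem, ?_⟩, ?_⟩
  · exact le_antisymm (hpure _ _ hmem hdel) hle
  · rintro _ ⟨K, _, ⟨H', hH', hK⟩, rfl⟩
    exact hpure K H' hH' hK
  · refine le_antisymm (hlower _ hmem) ((edist_flipGraph_le_add_one hdel).trans ?_)
    rw [hsucc]
    exact add_le_add hle le_rfl
  · rintro _ ⟨H', hH', rfl⟩
    exact hlower H' hH'
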